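/- **Setting.** All manifolds, bundles, maps and connections are smooth. A quaternionic vector bundle over a manifold $M$ is a real vector bundle $E$ with a morphism of bundles of associative algebras $A\to\mathrm{End}(E)$, where $A$ is a bundle of associative algebras with typical fibre $\mathbb H$. Let $Q\subseteq\mathrm{End}(E)$ be the image of $\mathrm{Im}\,A$ and let $\pi:Z\to M$ be the bundle of admissible linear complex structures, i.e. the sphere bundle of $Q$ ($J\in Z$ iff $J\in Q$ and $J^2=-1$). For $J\in Z_x$ let $E^J\subseteq E_x^{\mathbb C}$ be the eigenspace of $J$ for the eigenvalue $-\mathrm i$. The fibres of $Z$ are complex curves: $T_J(Z_x)=\{q\in Q_x: qJ=-Jq\}$, with complex structure $q\mapsto Jq$. An almost $f$-quaternionic manifold $(M,E,V)$ is a manifold $M$ with a quaternionic vector bundle $E$ containing $TM$ and $V$ as vector subbundles such that $E=TM\oplus V$ and $J(V)\subseteq TM$ for every $J\in Z$. Let $\iota:TM\to E$ be the inclusion and $\rho:E\to TM$ the projection along $V$. A linear connection $D$ on $M$ is compatible if there is a (then unique) connection $D^V$ on $V$ such that $\nabla=D^V\oplus D$ preserves $Q$. Given such $\nabla$, let $\mathcal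 C$ and $\mathcal D$ be the complex distributions on $Z$ whose values at $J\in Z$ are $$\mathcal C_J=\big(\iota^{-1}(E^J)\big)^{h}\oplus(\ker d\pi)_J^{0,1},\qquad \mathcal D_J=\big(\rho(E^J)\big)^{h}\oplus(\ker d\pi)_J^{0,1},$$ where $h$ denotes the horizontal lift with respect to the connection induced by $\nabla$ on $Z$. These are the CR and the co-CR twistorial structures of $(M,E,V,\nabla)$; each is integrable if its space of sections is closed under the bracket. $(M,E,V,\nabla)$ is $f$-quaternionic if both $\mathcal C$ and $\mathcal D$ are integrable. Let $W\subseteq TM$ be the largest quaternionic vector subbundle of $E$ contained in $TM$. **Theorem.** Let $(M,E,V)$ be an almost $f$-quaternionic manifold with $\mathrm{rank}\,E=4k$ and $\mathrm{rank}\,V=l$, where $(k,l)\neq(2,2),(1,0)$. Let $D$ be a compatible torsion-free connection on $M$ and let $\nabla=D^V\oplus D$. Then: 1. The CR twistorial structure $\mathcal C$ is integrable. 2. If, moreover, $(k,l)\neq(1,1)$, then the co-CR twistorial structure $\mathcal D$ is integrable too; thus $(M,E,V,\nabla)$ is $f$-quaternionic. 3. $W$ is integrable, and geodesic with respect to $D$: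 $D_XY$ is a section of $W$ for any sections $X$ and $Y$ of $W$. -/

import Mathlib

open Bundle Module VectorField
open scoped Manifold ContDiff Topology Quaternion

noncomputable section

/-! ## Complex distributions along a subset of a manifold

A vector `ξ + iη` of the complexified tangent space of a manifold at `p` is represented by the
pair `(ξ, η)` of real tangent vectors. -/

section Distribution

variable {EN : Type*} [NormedAddCommGroup EN] [NormedSpace ℝ EN]
  {HN : Type*} [TopologicalSpace HN] (IN : ModelWithCorners ℝ EN HN)
  {N : Type*} [TopologicalSpace N] [ChartedSpace HN N] [IsManifold IN 1 N]

/-- The complex bracket `[X₁ + iX₂, Y₁ + iY₂]`, as a pair (real part, imaginary part). -/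
def complexBracket (X₁ X₂ Y₁ Y₂ : Π p : N, TangentSpace IN p) (p : N) :
    TangentSpace IN p × TangentSpace IN p :=
  (mlieBracket IN X₁ Y₁ p - mlieBracket IN X₂ Y₂ p,
    mlieBracket IN X₁ Y₂ p + mlieBracket IN X₂ Y₁ p)

/-- Integrability (closedness of the space of sections under the bracket) of a complex
distribution `C` on an embedded submanifold `Z` of `N`, where `C p ⊆ T_p^ℂ Z ⊆ T_p^ℂ N` for
`p ∈ Z`.  Local sections of `C` over `Z` are the restrictions to `Z` of the complex vector fields
on open subsets of `N` which, at the points of `Z`, take values in `C`; as these are tangent to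
`Z` along `Z`, their bracket in `N` restricts to the bracket on `Z`. -/
def IsIntegrableAlong (Z : Set N) (C : ∀ p : N, Set (TangentSpace IN p × TangentSpace IN p)) :
    Prop :=
  ∀ (O : Set N), IsOpen O → ∀ X₁ X₂ Y₁ Y₂ : Π p : N, TangentSpace IN p,
    ContMDiffOn IN IN.tangent ∞ (fun p ↦ (⟨p, X₁ p⟩ : TangentBundle IN N)) O →
    ContMDiffOn IN IN.tangent ∞ (fun p ↦ (⟨p, X₂ p⟩ : TangentBundle IN N)) O →
    ContMDiffOn IN IN.tangent ∞ (fun p ↦ (⟨p, Y₁ p⟩ : TangentBundle IN N)) O →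
    ContMDiffOn IN IN.tangent ∞ (fun p ↦ (⟨p, Y₂ p⟩ : TangentBundle IN N)) O →
    (∀ p ∈ O ∩ Z, (X₁ p, X₂ p) ∈ C p) → (∀ p ∈ O ∩ Z, (Y₁ p, Y₂ p) ∈ C p) →
    ∀ p ∈ O ∩ Z, complexBracket IN X₁ X₂ Y₁ Y₂ p ∈ C p

end Distribution

variable (EM : Type*) [NormedAddCommGroup EM] [NormedSpace ℝ EM] [FiniteDimensional ℝ EM]
  {M : Type*} [TopologicalSpace M] [ChartedSpace EM M] [IsManifold 𝓘(ℝ, EM) ∞ M]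
  (A : M → Type*) [∀ x, Ring (A x)] [∀ x, Algebra ℝ (A x)] [∀ x, TopologicalSpace (A x)]
  [TopologicalSpace (TotalSpace ℍ[ℝ] A)] [FiberBundle ℍ[ℝ] A] [VectorBundle ℝ ℍ[ℝ] A]
  [ContMDiffVectorBundle ∞ ℍ[ℝ] A 𝓘(ℝ, EM)]
  (F : Type*) [NormedAddCommGroup F] [NormedSpace ℝ F]
  (E : M → Type*) [∀ x, AddCommGroup (E x)] [∀ x, Module ℝ (E x)] [∀ x, TopologicalSpace (E x)]
  [∀ x, IsTopologicalAddGroup (E x)] [∀ x, ContinuousSMul ℝ (E x)]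
  [TopologicalSpace (TotalSpace F E)] [FiberBundle F E] [VectorBundle ℝ F E]
  [ContMDiffVectorBundle ∞ F E 𝓘(ℝ, EM)]

/-! ## Quaternionic vector bundles and almost `f`-quaternionic structures -/

/-- A linear quaternionic structure on the vector bundle `E`: the vector bundle `A` with typical
fibre `ℍ` is a bundle of associative algebras (its trivializations are fibrewise multiplicative,
that is, its structural group is the automorphism group of `ℍ`) and `act` is a smooth morphism of
bundles of associative algebras from `A` to `End E`. -/
structure QuaternionicBundleStructure where
  trivialization_mul : ∀ (e : Trivialization ℍ[ℝ] (TotalSpace.proj : TotalSpace ℍ[ℝ] A → M))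
    [MemTrivializationAtlas e], ∀ x ∈ e.baseSet, ∀ a b : A x,
      (e ⟨x, a * b⟩).2 = (e ⟨x, a⟩).2 * (e ⟨x, b⟩).2
  act : ∀ x, A x →ₐ[ℝ] Module.End ℝ (E x)
  act_smooth : ∀ U : Set M, IsOpen U → ∀ (a : Π x, A x) (s : Π x, E x),
    ContMDiffOn 𝓘(ℝ, EM) (𝓘(ℝ, EM).prod 𝓘(ℝ, ℍ[ℝ])) ∞
      (fun x ↦ TotalSpace.mk' ℍ[ℝ] x (a x)) U →
    ContMDiffOn 𝓘(ℝ, EM) (𝓘(ℝ, EM).prod 𝓘(ℝ, F)) ∞ (fun x ↦ TotalSpace.mk' F x (s x)) U →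
    ContMDiffOn 𝓘(ℝ, EM) (𝓘(ℝ, EM).prod 𝓘(ℝ, F)) ∞
      (fun x ↦ TotalSpace.mk' F x (act x (a x) (s x))) U

/-- An almost `f`-quaternionic structure `(E, V)` on `M`: `E` is a quaternionic vector bundle,
`TM` is embedded in `E` by `ι`, and `V` is a vector subbundle with `E = TM ⊕ V` and `J(V) ⊆ TM`
for any admissible complex structure `J`.  The subbundle `V` complementary to `TM` is given by the
smooth projection `ρ : E → TM` whose kernel is `V`. The admissible complex structures at `x` are
the elements `J` of `A x` with `J² = -1` (the imaginary quaternions of length one). -/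
structure AlmostFQuaternionicStructure extends QuaternionicBundleStructure EM A F E where
  ι : ∀ x, TangentSpace 𝓘(ℝ, EM) x →ₗ[ℝ] E x
  ι_smooth : ContMDiff 𝓘(ℝ, EM).tangent (𝓘(ℝ, EM).prod 𝓘(ℝ, F)) ∞
    (fun p : TangentBundle 𝓘(ℝ, EM) M ↦ TotalSpace.mk' F p.1 (ι p.1 p.2))
  ρ : ∀ x, E x →ₗ[ℝ] TangentSpace 𝓘(ℝ, EM) x
  ρ_smooth : ContMDiff (𝓘(ℝ, EM).prod 𝓘(ℝ, F)) 𝓘(ℝ, EM).tangent ∞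
    (fun p : TotalSpace F E ↦ (⟨p.1, ρ p.1 p.2⟩ : TangentBundle 𝓘(ℝ, EM) M))
  ρ_ι : ∀ x (X : TangentSpace 𝓘(ℝ, EM) x), ρ x (ι x X) = X
  act_mem : ∀ x (J : A x), J * J = -1 → ∀ v ∈ LinearMap.ker (ρ x),
    act x J v ∈ LinearMap.range (ι x)

/-! ## The sphere bundle `Z`, as a submanifold of the total space of `A` -/

/-- The bundle of admissible complex structures, embedded in the total space of `A`. -/
def admissibleBundle : Set (TotalSpace ℍ[ℝ] A) := {p | p.2 * p.2 = -1}

variable {A} in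
/-- The imaginary elements of `A x ≅ ℍ`: those whose square is a nonpositive real number. -/
def IsImaginary {x : M} (a : A x) : Prop := ∃ r : ℝ, a * a = algebraMap ℝ (A x) (-(r ^ 2))

variable {A} in
/-- The vector tangent at `p` to the fibre of the total space of `A`, determined by `q`. -/
def verticalLift (p : TotalSpace ℍ[ℝ] A) (q : A p.1) :
    TangentSpace (𝓘(ℝ, EM).prod 𝓘(ℝ, ℍ[ℝ])) p :=
  (mfderiv 𝓘(ℝ, ℝ) (𝓘(ℝ, EM).prod 𝓘(ℝ, ℍ[ℝ]))
    (fun t : ℝ ↦ TotalSpace.mk' ℍ[ℝ] p.1 (p.2 + t • q)) 0 (1 : ℝ) : EM × ℍ[ℝ])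

namespace QuaternionicBundleStructure

variable {EM A F E} (𝒬 : QuaternionicBundleStructure EM A F E)
  (nabla : CovariantDerivative 𝓘(ℝ, EM) F E)

/-- `(∇_X a)_x = b`, for the connection induced by `∇` on endomorphisms of `E` and a section `a`
of `A` (differentiable at `x`): `∇_X (a s) = b s + a ∇_X s` for any section `s` of `E`
differentiable at `x`. -/
def HasEndDeriv (a : Π x, A x) (x : M) (X : TangentSpace 𝓘(ℝ, EM) x) (b : A x) : Prop :=
  ∀ s : Π y, E y, MDifferentiableAt 𝓘(ℝ, EM) (𝓘(ℝ, EM).prod 𝓘(ℝ, F))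
      (fun y ↦ TotalSpace.mk' F y (s y)) x →
    nabla (fun y ↦ 𝒬.act y (a y) (s y)) x X =
      𝒬.act x b (s x) + 𝒬.act x (a x) (nabla s x X)

/-- The connection `∇` on `E` is compatible with the linear quaternionic structure, that is, it
preserves the bundle `Q` of imaginary elements. -/
def IsQuaternionicConnection : Prop :=
  ∀ U : Set M, IsOpen U → ∀ a : Π x, A x,
    ContMDiffOn 𝓘(ℝ, EM) (𝓘(ℝ, EM).prod 𝓘(ℝ, ℍ[ℝ])) ∞
      (fun x ↦ TotalSpace.mk' ℍ[ℝ] x (a x)) U →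
    (∀ x ∈ U, IsImaginary (a x)) →
    ∀ x ∈ U, ∀ X : TangentSpace 𝓘(ℝ, EM) x,
      ∃ b : A x, IsImaginary b ∧ 𝒬.HasEndDeriv nabla a x X b

/-- `ξ` is the horizontal lift at `p` of `X`: it is the image of `X` through the differential of
a local section `a` of `A` passing through `p` and with `∇_X a = 0`. -/
def IsHorizontalLift (p : TotalSpace ℍ[ℝ] A) (X : TangentSpace 𝓘(ℝ, EM) p.1)
    (ξ : TangentSpace (𝓘(ℝ, EM).prod 𝓘(ℝ, ℍ[ℝ])) p) : Prop :=
  ∃ U : Set M, IsOpen U ∧ p.1 ∈ U ∧ ∃ a : Π x, A x,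
    ContMDiffOn 𝓘(ℝ, EM) (𝓘(ℝ, EM).prod 𝓘(ℝ, ℍ[ℝ])) ∞
      (fun x ↦ TotalSpace.mk' ℍ[ℝ] x (a x)) U ∧
    a p.1 = p.2 ∧ 𝒬.HasEndDeriv nabla a p.1 X 0 ∧
    ξ = (mfderiv 𝓘(ℝ, EM) (𝓘(ℝ, EM).prod 𝓘(ℝ, ℍ[ℝ]))
      (fun x ↦ TotalSpace.mk' ℍ[ℝ] x (a x)) p.1 X : EM × ℍ[ℝ])

/-- `E^J`, the eigenspace of `J` in the complexification of `E_x` for the eigenvalue `-i`;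
the pair `(e, f)` stands for `e + if`. -/
def eigenspaceNegI (x : M) (J : A x) : Set (E x × E x) :=
  {p | 𝒬.act x J p.1 = p.2 ∧ 𝒬.act x J p.2 = -p.1}

/-- The direct sum, at `p = J`, of the horizontal lift of the subspace `S J` of the complexified
tangent space of `M` and of the antiholomorphic tangent space of the fibre of `Z` through `J`.
The tangent space of the fibre of `Z` is `{q | qJ = -Jq}`, its complex structure is `q ↦ Jq`, and
so its antiholomorphic tangent space is `{q + iJq}`. -/
def twistorDistribution
    (S : ∀ x, A x → Set (TangentSpace 𝓘(ℝ, EM) x × TangentSpace 𝓘(ℝ, EM) x))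
    (p : TotalSpace ℍ[ℝ] A) :
    Set (TangentSpace (𝓘(ℝ, EM).prod 𝓘(ℝ, ℍ[ℝ])) p ×
      TangentSpace (𝓘(ℝ, EM).prod 𝓘(ℝ, ℍ[ℝ])) p) :=
  {ζ | ∃ X Y : TangentSpace 𝓘(ℝ, EM) p.1, (X, Y) ∈ S p.1 p.2 ∧
    ∃ ξ η : TangentSpace (𝓘(ℝ, EM).prod 𝓘(ℝ, ℍ[ℝ])) p,
      𝒬.IsHorizontalLift nabla p X ξ ∧ 𝒬.IsHorizontalLift nabla p Y η ∧
    ∃ q : A p.1, q * p.2 = -(p.2 * q) ∧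
      ζ = (ξ + verticalLift EM p q, η + verticalLift EM p (p.2 * q))}

end QuaternionicBundleStructure

namespace AlmostFQuaternionicStructure

variable {EM A F E} (𝒮 : AlmostFQuaternionicStructure EM A F E)
  (nabla : CovariantDerivative 𝓘(ℝ, EM) F E)
  (D : CovariantDerivative 𝓘(ℝ, EM) EM (TangentSpace 𝓘(ℝ, EM) : M → Type _))

/-- The fibre of `V`. -/
def V (x : M) : Submodule ℝ (E x) := LinearMap.ker (𝒮.ρ x)

/-- The almost twistorial structure of `(M, E, ι, ∇)` is integrable: the distribution on `Z` given
by the horizontal lifts of the spaces `ι⁻¹(E^J)` and by the antiholomorphic vertical vectors. -/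
def IsCRQuaternionic : Prop :=
  IsIntegrableAlong (𝓘(ℝ, EM).prod 𝓘(ℝ, ℍ[ℝ])) (admissibleBundle A)
    (𝒮.twistorDistribution nabla
      fun x J ↦ {p | (𝒮.ι x p.1, 𝒮.ι x p.2) ∈ 𝒮.eigenspaceNegI x J})

/-- The almost twistorial structure of `(M, E, ρ, ∇)` is integrable: the distribution on `Z` given
by the horizontal lifts of the spaces `ρ(E^J)` and by the antiholomorphic vertical vectors. -/
def IsCoCRQuaternionic : Prop :=
  IsIntegrableAlong (𝓘(ℝ, EM).prod 𝓘(ℝ, ℍ[ℝ])) (admissibleBundle A)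
    (𝒮.twistorDistribution nabla
      fun x J ↦ {p | ∃ e f : E x, (e, f) ∈ 𝒮.eigenspaceNegI x J ∧ p = (𝒮.ρ x e, 𝒮.ρ x f)})

/-- `(M, E, V, ∇)` is `f`-quaternionic. -/
def IsFQuaternionic : Prop := 𝒮.IsCRQuaternionic nabla ∧ 𝒮.IsCoCRQuaternionic nabla

/-- `∇ = D^V ⊕ D` for some connection `D^V` on `V`: in terms of the inclusion `ι` and of the
projection `ρ`, `∇_X (ι Y) = ι (D_X Y)` and `ρ (∇_X s) = D_X (ρ s)` (in particular, `∇` preserves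
`V`). -/
structure IsDirectSumConnection : Prop where
  ι_comm : ∀ (x : M) (X : TangentSpace 𝓘(ℝ, EM) x) (Y : Π y : M, TangentSpace 𝓘(ℝ, EM) y),
    MDifferentiableAt 𝓘(ℝ, EM) 𝓘(ℝ, EM).tangent
      (fun y ↦ (⟨y, Y y⟩ : TangentBundle 𝓘(ℝ, EM) M)) x →
    nabla (fun y ↦ 𝒮.ι y (Y y)) x X = 𝒮.ι x (D Y x X)
  ρ_comm : ∀ (x : M) (X : TangentSpace 𝓘(ℝ, EM) x) (s : Π y : M, E y),
    MDifferentiableAt 𝓘(ℝ, EM) (𝓘(ℝ, EM).prod 𝓘(ℝ, F))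
      (fun y ↦ TotalSpace.mk' F y (s y)) x →
    𝒮.ρ x (nabla s x X) = D (fun y ↦ 𝒮.ρ y (s y)) x X

/-- `D` is a compatible connection on `M` and `∇ = D^V ⊕ D` is the connection on `E` induced by
it.  A linear connection `D` corresponds to a principal connection on the reduction of the frame
bundle of `M` determined by `(E, V)` if and only if there is a connection `D^V` on `V` such that
`D^V ⊕ D` is compatible with the linear quaternionic structure of `E`; then `D^V` is determined
by `D`. -/
structure IsCompatibleConnection : Prop extends 𝒮.IsDirectSumConnection nabla D where
  quaternionic : 𝒮.IsQuaternionicConnection nabla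

/-- The fibre at `x` of the largest quaternionic subbundle `W` of `E` contained in `TM`. -/
def W (x : M) : Submodule ℝ (TangentSpace 𝓘(ℝ, EM) x) where
  carrier := {w | ∀ a : A x, 𝒮.act x a (𝒮.ι x w) ∈ LinearMap.range (𝒮.ι x)}
  add_mem' hv hw a := by
    rw [map_add, map_add]
    exact add_mem (hv a) (hw a)
  zero_mem' a := by
    rw [map_zero, map_zero]
    exact zero_mem _
  smul_mem' c w hw a := by
    rw [map_smul, map_smul]
    exact Submodule.smul_mem _ _ (hw a)

/-- `W` is integrable: the bracket of two local sections of `W` is a section of `W`. -/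
def WIsIntegrable : Prop :=
  ∀ U : Set M, IsOpen U → ∀ X Y : Π x : M, TangentSpace 𝓘(ℝ, EM) x,
    ContMDiffOn 𝓘(ℝ, EM) 𝓘(ℝ, EM).tangent ∞
      (fun x ↦ (⟨x, X x⟩ : TangentBundle 𝓘(ℝ, EM) M)) U →
    ContMDiffOn 𝓘(ℝ, EM) 𝓘(ℝ, EM).tangent ∞
      (fun x ↦ (⟨x, Y x⟩ : TangentBundle 𝓘(ℝ, EM) M)) U →
    (∀ x ∈ U, X x ∈ 𝒮.W x) → (∀ x ∈ U, Y x ∈ 𝒮.W x) →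
    ∀ x ∈ U, mlieBracket 𝓘(ℝ, EM) X Y x ∈ 𝒮.W x

/-- `W` is geodesic with respect to `D`: `D_X Y` is a section of `W` for any local sections `X`
and `Y` of `W`. -/
def WIsGeodesic : Prop :=
  ∀ U : Set M, IsOpen U → ∀ X Y : Π x : M, TangentSpace 𝓘(ℝ, EM) x,
    ContMDiffOn 𝓘(ℝ, EM) 𝓘(ℝ, EM).tangent ∞
      (fun x ↦ (⟨x, X x⟩ : TangentBundle 𝓘(ℝ, EM) M)) U →
    ContMDiffOn 𝓘(ℝ, EM) 𝓘(ℝ, EM).tangent ∞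
      (fun x ↦ (⟨x, Y x⟩ : TangentBundle 𝓘(ℝ, EM) M)) U →
    (∀ x ∈ U, X x ∈ 𝒮.W x) → (∀ x ∈ U, Y x ∈ 𝒮.W x) →
    ∀ x ∈ U, D Y x (X x) ∈ 𝒮.W x

end AlmostFQuaternionicStructure

end

noncomputable section

set_option linter.unusedSectionVars false
set_option synthInstance.maxHeartbeats 400000
set_option maxHeartbeats 1000000

/-! ### Pointwise calculus of families of continuous linear maps. -/

section ContinuousLinearMap

variable {V W : Type*} [NormedAddCommGroup V] [NormedSpace ℝ V]
  [NormedAddCommGroup W] [NormedSpace ℝ W]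

/-! The problem is local. In a chart and trivialisations, the connections on `E`, `TM` and `A`
become `d + Γ`, `d + G` and `d + Ω`, and the data become a `LocalFQuaternionicModel`: `ι`, `ρ` and
the action are parallel, `G` is symmetric (no torsion), and `Ω` acts by derivations. The connection
`Ω` exists and is smooth because quaternions act faithfully on a nonzero fibre.

Sections of the twistorial distributions are constrained only where `τ² = -1`. Derivatives along
vectors tangent to this set depend only on the values there (`fderiv_eq_of_eq_on_sphere`), which is
all that a bracket needs. Write `J` for the action of `τ`. The horizontal part of a section lifts to
a section `e + iJe` of `E^J`: explicitly by `coCR_lift` in the co-CR case, through `ι` in the CR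
case. Without torsion, the base part of a bracket is the image of the antisymmetrised covariant
derivative of the lifts; that derivative stays in `E^J` because the vertical parts are
antiholomorphic (`bracket_lift`). In the vertical part only the curvature term `R(X, Y)τ` is an
obstruction (`bracket_vert`), and `CurvatureCondition` says that it is antiholomorphic too.

This condition comes from the first Bianchi identity. As `ρ` is parallel, the cyclic sum of the
curvature of `E` takes values in `V`. On three vectors of `E^J`, this gives a cyclic identity,
modulo `V + JV`, for the quaternions `curvatureDefect`, which anticommute with `τ`. If one of them
is nonzero, it is invertible, and the identity can be solved for the third vector: every vector of
the fibre lies in `V + JV + Qe₁ + Qe₂`, with `Q` the at most two-dimensional space of elements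
anticommuting with `τ`. Hence `4k ≤ 2l + 4`. Also `l ≤ k`, since `V`, `iV`, `jV`, `ijV` are
independent. Only `(1,0)`, `(1,1)`, `(2,2)` survive when `k > 0`, and for `k = 0` all curvatures
vanish. This gives the co-CR case, and the CR case by inclusion, except for `(1,1)`. There the
largest `J`-stable subspace of `TM` is at most a complex line, so the condition for the CR structure
holds by antisymmetry of the curvature.

For `W`: if `Y` is a section of `W` and `a` is imaginary with `∇a = b`, then `∇(aY) = bY + a DY`,
where the left side and `bY` are tangent to `M`; hence so is `a DY`. Thus `D` preserves `W`, and
zero torsion makes it integrable. -/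

lemma clm_add_apply (f g : V →L[ℝ] W) (x : V) : (f + g) x = f x + g x := rfl

lemma clm_sub_apply (f g : V →L[ℝ] W) (x : V) : (f - g) x = f x - g x := rfl

lemma clm_neg_apply (f : V →L[ℝ] W) (x : V) : (-f) x = -f x := rfl

lemma clm_smul_apply (r : ℝ) (f : V →L[ℝ] W) (x : V) : (r • f) x = r • f x := rfl

variable {B : Type*} [NormedAddCommGroup B] [NormedSpace ℝ B]

/-- The Leibniz rule for the evaluation of a family of continuous linear maps. -/
lemma fderiv_clm_apply_apply {Φ : B → V →L[ℝ] W} {f : B → V} {z : B} (hΦ : DifferentiableAt ℝ Φ z)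
    (hf : DifferentiableAt ℝ f z) (v : B) :
    fderiv ℝ (fun y ↦ Φ y (f y)) z v = fderiv ℝ Φ z v (f z) + Φ z (fderiv ℝ f z v) := by
  rw [(hΦ.hasFDerivAt.clm_apply hf.hasFDerivAt).fderiv]
  exact add_comm _ _

lemma fderiv_clm_apply_const {Φ : B → V →L[ℝ] W} {z : B} (hΦ : DifferentiableAt ℝ Φ z)
    (f : V) (v : B) : fderiv ℝ (fun y ↦ Φ y f) z v = fderiv ℝ Φ z v f := by
  rw [fderiv_clm_apply_apply hΦ (differentiableAt_const f), fderiv_fun_const]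
  exact (congrArg _ ((Φ z).map_zero)).trans (add_zero _)

end ContinuousLinearMap

/-! ### Curvature of `d + Γ`, parallel maps and the first Bianchi identity. -/

section Christoffel

variable {B F F₁ F₂ : Type*} [NormedAddCommGroup B] [NormedSpace ℝ B]
  [NormedAddCommGroup F] [NormedSpace ℝ F]
  [NormedAddCommGroup F₁] [NormedSpace ℝ F₁] [NormedAddCommGroup F₂] [NormedSpace ℝ F₂]

/-- The curvature of the connection `d + Γ` on the trivial bundle with fibre `F`. -/
def christoffelCurvature (Γ : B → B →L[ℝ] F →L[ℝ] F) (z u v : B) (f : F) : F :=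
  fderiv ℝ Γ z u v f - fderiv ℝ Γ z v u f + (Γ z u (Γ z v f) - Γ z v (Γ z u f))

lemma christoffelCurvature_swap (Γ : B → B →L[ℝ] F →L[ℝ] F) (z u v : B) (f : F) :
    christoffelCurvature Γ z u v f = -christoffelCurvature Γ z v u f := by
  unfold christoffelCurvature; abel

lemma christoffelCurvature_add_left (Γ : B → B →L[ℝ] F →L[ℝ] F) (z u u' v : B) (f : F) :
    christoffelCurvature Γ z (u + u') v f =
      christoffelCurvature Γ z u v f + christoffelCurvature Γ z u' v f := by
  unfold christoffelCurvature
  rw [(fderiv ℝ Γ z).map_add, (fderiv ℝ Γ z v).map_add, (Γ z).map_add, clm_add_apply,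
    clm_add_apply, clm_add_apply, clm_add_apply, clm_add_apply, (Γ z v).map_add]
  abel

lemma christoffelCurvature_smul_left (Γ : B → B →L[ℝ] F →L[ℝ] F) (z u v : B) (r : ℝ) (f : F) :
    christoffelCurvature Γ z (r • u) v f = r • christoffelCurvature Γ z u v f := by
  unfold christoffelCurvature
  rw [(fderiv ℝ Γ z).map_smul, (fderiv ℝ Γ z v).map_smul, (Γ z).map_smul, clm_smul_apply,
    clm_smul_apply, clm_smul_apply, clm_smul_apply, clm_smul_apply, (Γ z v).map_smul, smul_add,
    smul_sub, smul_sub]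

lemma christoffelCurvature_add_right (Γ : B → B →L[ℝ] F →L[ℝ] F) (z u v v' : B) (f : F) :
    christoffelCurvature Γ z u (v + v') f =
      christoffelCurvature Γ z u v f + christoffelCurvature Γ z u v' f := by
  rw [christoffelCurvature_swap, christoffelCurvature_add_left, christoffelCurvature_swap Γ z v,
    christoffelCurvature_swap Γ z v']; abel

lemma christoffelCurvature_smul_right (Γ : B → B →L[ℝ] F →L[ℝ] F) (z u v : B) (r : ℝ) (f : F) :
    christoffelCurvature Γ z u (r • v) f = r • christoffelCurvature Γ z u v f := by
  rw [christoffelCurvature_swap, christoffelCurvature_smul_left, christoffelCurvature_swap Γ z v,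
    smul_neg, neg_neg]

lemma differentiableAt_fderiv {Φ : B → F} {z : B} (hΦ : ContDiffAt ℝ 2 Φ z) :
    DifferentiableAt ℝ (fderiv ℝ Φ) z :=
  (hΦ.fderiv_right (m := 1) (by norm_num)).differentiableAt (by norm_num)

/-- The curvature operators are intertwined by a parallel bundle map. -/
lemma christoffelCurvature_parallel {Γ₁ : B → B →L[ℝ] F₁ →L[ℝ] F₁} {Γ₂ : B → B →L[ℝ] F₂ →L[ℝ] F₂}
    {Φ : B → F₁ →L[ℝ] F₂} {z : B} (hΦ : ContDiffAt ℝ 2 Φ z)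
    (h₁ : DifferentiableAt ℝ Γ₁ z) (h₂ : DifferentiableAt ℝ Γ₂ z)
    (hpar : ∀ᶠ y in 𝓝 z, ∀ u f, fderiv ℝ Φ y u f + Γ₂ y u (Φ y f) = Φ y (Γ₁ y u f))
    (u v : B) (f : F₁) :
    Φ z (christoffelCurvature Γ₁ z u v f) = christoffelCurvature Γ₂ z u v (Φ z f) := by
  have hd : DifferentiableAt ℝ Φ z := hΦ.differentiableAt (by norm_num)
  have hdd := differentiableAt_fderiv hΦ
  have hsymm := (hΦ.isSymmSndFDerivAt (by simp)).eq
  have p' : ∀ u f, fderiv ℝ Φ z u f = Φ z (Γ₁ z u f) - Γ₂ z u (Φ z f) := fun u f ↦ by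
    rw [← hpar.self_of_nhds]; abel
  have key : ∀ u v, fderiv ℝ (fderiv ℝ Φ) z v u f =
      fderiv ℝ Φ z v (Γ₁ z u f) + Φ z (fderiv ℝ Γ₁ z v u f) -
        (fderiv ℝ Γ₂ z v u (Φ z f) + Γ₂ z u (fderiv ℝ Φ z v f)) := by
    intro u v
    have e : (fun y ↦ fderiv ℝ Φ y u f) =ᶠ[𝓝 z] fun y ↦ Φ y (Γ₁ y u f) - Γ₂ y u (Φ y f) := by
      filter_upwards [hpar] with y hy
      rw [← hy]; abel
    have d₁ : DifferentiableAt ℝ (fun y ↦ Γ₁ y u) z := h₁.clm_apply (differentiableAt_const u)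
    have d₂ : DifferentiableAt ℝ (fun y ↦ Γ₂ y u) z := h₂.clm_apply (differentiableAt_const u)
    have d₃ : DifferentiableAt ℝ (fun y ↦ Γ₁ y u f) z := d₁.clm_apply (differentiableAt_const f)
    have d₄ : DifferentiableAt ℝ (fun y ↦ Φ y f) z := hd.clm_apply (differentiableAt_const f)
    have d₅ : DifferentiableAt ℝ (fun y ↦ fderiv ℝ Φ y u) z :=
      hdd.clm_apply (differentiableAt_const u)
    rw [← fderiv_clm_apply_const hdd u v, ← fderiv_clm_apply_const d₅, e.fderiv_eq,
      fderiv_fun_sub (hd.clm_apply d₃) (d₂.clm_apply d₄), clm_sub_apply,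
      fderiv_clm_apply_apply hd d₃, fderiv_clm_apply_apply d₂ d₄, fderiv_clm_apply_const d₁,
      fderiv_clm_apply_const h₁, fderiv_clm_apply_const h₂, fderiv_clm_apply_const hd]
  -- These are two expressions for the same second derivative of `Φ`. Equating them and eliminating
  -- first derivatives of `Φ` by `p'` leaves the curvatures.
  have k1 := key u v
  have k2 := key v u
  rw [hsymm v u, k2] at k1
  simp only [p', (Γ₂ z u).map_sub, (Γ₂ z v).map_sub] at k1
  simp only [christoffelCurvature, (Φ z).map_add, (Φ z).map_sub]
  rw [← sub_eq_zero] at k1 ⊢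
  rw [← k1]
  abel

/-- The curvature of a connection for which the action of an algebra bundle is parallel. -/
lemma christoffelCurvature_parallel_action {Γ₁ : B → B →L[ℝ] F₁ →L[ℝ] F₁}
    {Γ : B → B →L[ℝ] F →L[ℝ] F} {Φ : B → F₁ →L[ℝ] F →L[ℝ] F} {z : B} (hΦ : ContDiffAt ℝ 2 Φ z)
    (h₁ : DifferentiableAt ℝ Γ₁ z) (h : DifferentiableAt ℝ Γ z)
    (hpar : ∀ᶠ y in 𝓝 z, ∀ u a f, fderiv ℝ Φ y u a f + Γ y u (Φ y a f) =
      Φ y (Γ₁ y u a) f + Φ y a (Γ y u f))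
    (u v : B) (a : F₁) (f : F) :
    christoffelCurvature Γ z u v (Φ z a f) =
      Φ z (christoffelCurvature Γ₁ z u v a) f + Φ z a (christoffelCurvature Γ z u v f) := by
  have hd : DifferentiableAt ℝ Φ z := hΦ.differentiableAt (by norm_num)
  have hdd := differentiableAt_fderiv hΦ
  have hsymm := (hΦ.isSymmSndFDerivAt (by simp)).eq
  have p' : ∀ u a f, fderiv ℝ Φ z u a f =
      Φ z (Γ₁ z u a) f + Φ z a (Γ z u f) - Γ z u (Φ z a f) := fun u a f ↦ by
    rw [← hpar.self_of_nhds]; abel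
  have key : ∀ u v, fderiv ℝ (fderiv ℝ Φ) z v u a f =
      (fderiv ℝ Φ z v (Γ₁ z u a) f + Φ z (fderiv ℝ Γ₁ z v u a) f) +
      (fderiv ℝ Φ z v a (Γ z u f) + Φ z a (fderiv ℝ Γ z v u f)) -
        (fderiv ℝ Γ z v u (Φ z a f) + Γ z u (fderiv ℝ Φ z v a f)) := by
    intro u v
    have e : (fun y ↦ fderiv ℝ Φ y u a f) =ᶠ[𝓝 z]
        fun y ↦ Φ y (Γ₁ y u a) f + Φ y a (Γ y u f) - Γ y u (Φ y a f) := by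
      filter_upwards [hpar] with y hy
      rw [← hy]; abel
    have d₁ : DifferentiableAt ℝ (fun y ↦ Γ₁ y u) z := h₁.clm_apply (differentiableAt_const u)
    have d₂ : DifferentiableAt ℝ (fun y ↦ Γ y u) z := h.clm_apply (differentiableAt_const u)
    have d₃ : DifferentiableAt ℝ (fun y ↦ Γ₁ y u a) z := d₁.clm_apply (differentiableAt_const a)
    have d₄ : DifferentiableAt ℝ (fun y ↦ Φ y a) z := hd.clm_apply (differentiableAt_const a)
    have d₅ : DifferentiableAt ℝ (fun y ↦ fderiv ℝ Φ y u) z :=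
      hdd.clm_apply (differentiableAt_const u)
    have d₆ : DifferentiableAt ℝ (fun y ↦ fderiv ℝ Φ y u a) z :=
      d₅.clm_apply (differentiableAt_const a)
    have d₇ : DifferentiableAt ℝ (fun y ↦ Φ y a f) z := d₄.clm_apply (differentiableAt_const f)
    have d₈ : DifferentiableAt ℝ (fun y ↦ Φ y (Γ₁ y u a)) z := hd.clm_apply d₃
    have d₉ : DifferentiableAt ℝ (fun y ↦ Γ y u f) z := d₂.clm_apply (differentiableAt_const f)
    have d₁₀ : DifferentiableAt ℝ (fun y ↦ Φ y (Γ₁ y u a) f) z :=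
      d₈.clm_apply (differentiableAt_const f)
    rw [← fderiv_clm_apply_const hdd u v, ← fderiv_clm_apply_const d₅, ← fderiv_clm_apply_const d₆,
      e.fderiv_eq, fderiv_fun_sub (d₁₀.fun_add (d₄.clm_apply d₉)) (d₂.clm_apply d₇), clm_sub_apply,
      fderiv_fun_add d₁₀ (d₄.clm_apply d₉), clm_add_apply, fderiv_clm_apply_const d₈,
      fderiv_clm_apply_apply hd d₃, clm_add_apply, fderiv_clm_apply_apply d₄ d₉,
      fderiv_clm_apply_apply d₂ d₇, fderiv_clm_apply_const d₁, fderiv_clm_apply_const h₁,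
      fderiv_clm_apply_const hd, fderiv_clm_apply_const d₂, fderiv_clm_apply_const h,
      fderiv_clm_apply_const d₄, fderiv_clm_apply_const hd]
  -- Symmetry of the second derivative of `Φ` again. The cross terms `Φ z (Γ₁ a) (Γ f)` occur
  -- symmetrically in `u` and `v`, hence cancel.
  have k1 := key u v
  have k2 := key v u
  rw [hsymm v u, k2] at k1
  simp only [p', (Γ z u).map_sub, (Γ z v).map_sub, (Γ z u).map_add, (Γ z v).map_add] at k1
  simp only [christoffelCurvature, (Φ z).map_add, (Φ z).map_sub, (Φ z a).map_add, (Φ z a).map_sub,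
    clm_add_apply, clm_sub_apply]
  rw [← sub_eq_zero] at k1 ⊢
  rw [← neg_eq_zero, ← k1]
  abel

/-- The first Bianchi identity for a torsion-free connection. -/
lemma christoffelCurvature_bianchi {G : B → B →L[ℝ] B →L[ℝ] B} {z : B}
    (h : DifferentiableAt ℝ G z) (hG : ∀ᶠ y in 𝓝 z, ∀ u v, G y u v = G y v u) (u v w : B) :
    christoffelCurvature G z u v w + christoffelCurvature G z v w u +
      christoffelCurvature G z w u v = 0 := by
  -- Symmetry of `G` near `z` passes to its derivative, so the derivative terms and the quadratic
  -- terms of the cyclic sum cancel in pairs.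
  have hsymm : ∀ x u v, fderiv ℝ G z x u v = fderiv ℝ G z x v u := by
    intro x u v
    have d : ∀ u, DifferentiableAt ℝ (fun y ↦ G y u) z := fun u ↦
      h.clm_apply (differentiableAt_const u)
    have e : (fun y ↦ G y u v) =ᶠ[𝓝 z] fun y ↦ G y v u := by
      filter_upwards [hG] with y hy using hy u v
    rw [← fderiv_clm_apply_const h, ← fderiv_clm_apply_const (d u), e.fderiv_eq,
      fderiv_clm_apply_const (d v), fderiv_clm_apply_const h]
  have g := hG.self_of_nhds
  unfold christoffelCurvature
  rw [hsymm u v w, hsymm v w u, hsymm w u v, g v w, g w u, g u v]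
  abel

end Christoffel

/-! ### Imaginary unit quaternions, and derivatives along the sphere bundle. -/

section Sphere

/-- The imaginary components of `τ * τ` are those of `τ` times twice its real part. A nonzero real
part would thus make `τ` real, with nonnegative square. -/
lemma Quaternion.normSq_eq_one_of_mul_self {τ : ℍ[ℝ]} (hτ : τ * τ = -1) :
    τ.re = 0 ∧ Quaternion.normSq τ = 1 := by
  have h := Quaternion.ext_iff.1 hτ
  simp at h
  obtain ⟨h0, h1, h2, h3⟩ := h
  have hre : τ.re = 0 := by
    by_contra hne
    have i1 : τ.imI = 0 := by
      have : 2 * τ.re * τ.imI = 0 := by linarith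
      simpa [hne] using this
    have i2 : τ.imJ = 0 := by
      have : 2 * τ.re * τ.imJ = 0 := by linarith
      simpa [hne] using this
    have i3 : τ.imK = 0 := by
      have : 2 * τ.re * τ.imK = 0 := by linarith
      simpa [hne] using this
    rw [i1, i2, i3] at h0
    nlinarith [sq_nonneg τ.re]
  refine ⟨hre, ?_⟩
  rw [Quaternion.normSq_def']
  rw [hre] at h0 ⊢
  linarith

/-- Since `τ` has no real part, the imaginary components of `a * τ + τ * a` are those of `τ` times
`2 * a.re`. As `τ` has norm one, `a` is purely imaginary. -/
lemma Quaternion.mul_self_of_anticomm {τ a : ℍ[ℝ]} (hτ : τ * τ = -1) (ha : a * τ = -(τ * a)) :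
    a * a = (-Quaternion.normSq a) • (1 : ℍ[ℝ]) := by
  obtain ⟨h0, h1⟩ := Quaternion.normSq_eq_one_of_mul_self hτ
  have h := Quaternion.ext_iff.1 ha
  rw [Quaternion.normSq_def', h0] at h1
  simp [h0] at h
  obtain ⟨-, k1, k2, k3⟩ := h
  have hre : a.re = 0 := by
    have e1 : a.re * τ.imI = 0 := by linarith
    have e2 : a.re * τ.imJ = 0 := by linarith
    have e3 : a.re * τ.imK = 0 := by linarith
    have : a.re ^ 2 * (0 ^ 2 + τ.imI ^ 2 + τ.imJ ^ 2 + τ.imK ^ 2) = 0 := by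
      linear_combination a.re * τ.imI * e1 + a.re * τ.imJ * e2 + a.re * τ.imK * e3
    rw [h1, mul_one] at this
    exact pow_eq_zero_iff (two_ne_zero) |>.1 this
  rw [Quaternion.normSq_def', hre]
  ext <;> simp [hre] <;> ring

variable {B G : Type*} [NormedAddCommGroup B] [NormedSpace ℝ B]
  {H : Type*} [NormedRing H] [NormedAlgebra ℝ H]
  [NormedAddCommGroup G] [NormedSpace ℝ G]

variable (H) in
/-- The elements which anticommute with a square root of `-1` have nonpositive square, as it
happens in the algebra of quaternions. -/
def AnticommSqNonpos : Prop := ∀ τ a : H, τ * τ = -1 → a * τ = -(τ * a) →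
  ∃ s : ℝ, 0 ≤ s ∧ a * a = (-s) • (1 : H)

/-- The derivative of a function which vanishes on `B × {τ | τ² = -1}` vanishes in the directions
tangent to this submanifold. -/
lemma fderiv_eq_zero_of_eq_zero_on_sphere (hH : AnticommSqNonpos H) {f : B × H → G} {p : B × H}
    (hf : DifferentiableAt ℝ f p) (hp : p.2 * p.2 = -1)
    (h0 : ∀ᶠ q in 𝓝 p, q.2 * q.2 = -1 → f q = 0) {ξ : B × H}
    (hξ : ξ.2 * p.2 = -(p.2 * ξ.2)) : fderiv ℝ f p ξ = 0 := by
  obtain ⟨s, hs0, hs⟩ := hH p.2 ξ.2 hp hξ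
  -- The cross terms cancel in `(p.2 + t • ξ.2)²`, which is therefore `-(1 + t² s)`. Multiplying by
  -- `n t` puts the segment back on the sphere, and `n' 0 = 0` keeps the velocity equal to `ξ`.
  let n : ℝ → ℝ := fun t ↦ (Real.sqrt (1 + t ^ 2 * s))⁻¹
  have hpos : ∀ t : ℝ, 0 < 1 + t ^ 2 * s := fun t ↦ by positivity
  have hn : HasDerivAt n 0 0 := by
    have h1 : HasDerivAt (fun t : ℝ ↦ 1 + t ^ 2 * s) 0 0 := by
      simpa using ((hasDerivAt_pow 2 (0 : ℝ)).mul_const s).const_add 1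
    have h2 := (h1.sqrt (by simp)).inv (by simp)
    rw [zero_div, neg_zero, zero_div] at h2
    exact h2
  let γ : ℝ → B × H := fun t ↦ (p.1 + t • ξ.1, n t • (p.2 + t • ξ.2))
  have hγ0 : γ 0 = p := by simp [γ, n]
  have hγ : HasDerivAt γ ξ 0 := by
    have a1 : HasDerivAt (fun t : ℝ ↦ p.1 + t • ξ.1) ξ.1 0 := by
      simpa using ((hasDerivAt_id (0 : ℝ)).smul_const ξ.1).const_add p.1
    have a2 : HasDerivAt (fun t : ℝ ↦ p.2 + t • ξ.2) ξ.2 0 := by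
      simpa using ((hasDerivAt_id (0 : ℝ)).smul_const ξ.2).const_add p.2
    have a3 : HasDerivAt (fun t : ℝ ↦ n t • (p.2 + t • ξ.2)) ξ.2 0 := by
      have := hn.smul a2
      have hn0 : n 0 = 1 := by simp [n]
      rw [hn0, one_smul, zero_smul, add_zero] at this
      exact this
    exact a1.prodMk a3
  have hsq : ∀ t, (γ t).2 * (γ t).2 = -1 := by
    intro t
    have e1 : (p.2 + t • ξ.2) * (p.2 + t • ξ.2) = (-(1 + t ^ 2 * s)) • (1 : H) := by
      rw [add_mul, mul_add, mul_add, hp, smul_mul_smul_comm, hs, mul_smul_comm, smul_mul_assoc,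
        hξ]
      module
    have e2 : n t * n t * (1 + t ^ 2 * s) = 1 := by
      have := Real.mul_self_sqrt (hpos t).le
      simp only [n]
      rw [← mul_inv, this, inv_mul_cancel₀ (hpos t).ne']
    simp only [γ]
    rw [smul_mul_smul_comm, e1, smul_smul, mul_neg, e2, neg_smul, one_smul]
  have hcomp : HasDerivAt (f ∘ γ) (fderiv ℝ f p ξ) 0 := by
    have : HasFDerivAt f (fderiv ℝ f p) (γ 0) := by rw [hγ0]; exact hf.hasFDerivAt
    exact this.comp_hasDerivAt 0 hγ
  have hzero : f ∘ γ =ᶠ[𝓝 0] fun _ ↦ 0 := by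
    have := hγ.continuousAt.tendsto
    rw [hγ0] at this
    filter_upwards [this.eventually h0] with t ht using ht (hsq t)
  exact hcomp.unique ((hasDerivAt_const (0 : ℝ) (0 : G)).congr_of_eventuallyEq hzero)

lemma fderiv_eq_of_eq_on_sphere (hH : AnticommSqNonpos H) {f g : B × H → G} {p : B × H}
    (hf : DifferentiableAt ℝ f p) (hg : DifferentiableAt ℝ g p) (hp : p.2 * p.2 = -1)
    (h0 : ∀ᶠ q in 𝓝 p, q.2 * q.2 = -1 → f q = g q) {ξ : B × H}
    (hξ : ξ.2 * p.2 = -(p.2 * ξ.2)) : fderiv ℝ f p ξ = fderiv ℝ g p ξ := by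
  have := fderiv_eq_zero_of_eq_zero_on_sphere hH (hf.sub hg) hp
    (by filter_upwards [h0] with q hq hq' using sub_eq_zero.2 (hq hq')) hξ
  rw [fderiv_sub hf hg] at this
  exact sub_eq_zero.1 this

end Sphere

/-! ### The local model and its covariant calculus. -/

/-- An almost `f`-quaternionic structure together with a compatible torsion-free connection, on an
open subset of a vector space: the bundles are trivial, with fibres `F` and `H`, and the
connections on `E`, `TM` and `A` are `d + Γ`, `d + G` and `d + Ω`. -/
structure LocalFQuaternionicModel (B F H : Type*) [NormedAddCommGroup B] [NormedSpace ℝ B]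
    [NormedAddCommGroup F] [NormedSpace ℝ F]
    [NormedRing H] [NormedAlgebra ℝ H] where
  U : Set B
  isOpen_U : IsOpen U
  ι : B → B →L[ℝ] F
  ρ : B → F →L[ℝ] B
  act : B → H →L[ℝ] F →L[ℝ] F
  Γ : B → B →L[ℝ] F →L[ℝ] F
  G : B → B →L[ℝ] B →L[ℝ] B
  Ω : B → B →L[ℝ] H →L[ℝ] H
  contDiffOn_ι : ContDiffOn ℝ ∞ ι U
  contDiffOn_ρ : ContDiffOn ℝ ∞ ρ U
  contDiffOn_act : ContDiffOn ℝ ∞ act U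
  contDiffOn_Γ : ContDiffOn ℝ ∞ Γ U
  contDiffOn_G : ContDiffOn ℝ ∞ G U
  contDiffOn_Ω : ContDiffOn ℝ ∞ Ω U
  ρ_ι : ∀ z ∈ U, ∀ v, ρ z (ι z v) = v
  act_one : ∀ z ∈ U, ∀ f, act z 1 f = f
  act_mul : ∀ z ∈ U, ∀ a b f, act z (a * b) f = act z a (act z b f)
  act_mem : ∀ z ∈ U, ∀ τ : H, τ * τ = -1 → ∀ v, ρ z v = 0 →
    ι z (ρ z (act z τ v)) = act z τ v
  G_symm : ∀ z ∈ U, ∀ u v, G z u v = G z v u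
  ι_parallel : ∀ z ∈ U, ∀ u v, fderiv ℝ ι z u v + Γ z u (ι z v) = ι z (G z u v)
  ρ_parallel : ∀ z ∈ U, ∀ u f, fderiv ℝ ρ z u f + G z u (ρ z f) = ρ z (Γ z u f)
  act_parallel : ∀ z ∈ U, ∀ u a f, fderiv ℝ act z u a f + Γ z u (act z a f) =
    act z (Ω z u a) f + act z a (Γ z u f)
  Ω_mul : ∀ z ∈ U, ∀ u a b, Ω z u (a * b) = Ω z u a * b + a * Ω z u b

namespace LocalFQuaternionicModel

variable {B F H : Type*} [NormedAddCommGroup B] [NormedSpace ℝ B]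
    [NormedAddCommGroup F] [NormedSpace ℝ F]
    [NormedRing H] [NormedAlgebra ℝ H] (𝓜 : LocalFQuaternionicModel B F H)

/-- The vertical part, at `p`, of a tangent vector. -/
def vert (p ξ : B × H) : H := ξ.2 + 𝓜.Ω p.1 ξ.1 p.2

/-- The spaces `ι⁻¹(E^J)`. -/
def crSpace (z : B) (τ : H) : Set (B × B) := {x | 𝓜.act z τ (𝓜.ι z x.1) = 𝓜.ι z x.2}

/-- The spaces `ρ(E^J)`. -/
def coCRSpace (z : B) (τ : H) : Set (B × B) :=
  {x | ∃ e, x.1 = 𝓜.ρ z e ∧ x.2 = 𝓜.ρ z (𝓜.act z τ e)}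

/-- The twistorial distribution determined by the spaces `S z τ`. -/
def distribution (S : B → H → Set (B × B)) (p : B × H) :
    Set ((B × H) × (B × H)) :=
  {ζ | (ζ.1.1, ζ.2.1) ∈ S p.1 p.2 ∧ 𝓜.vert p ζ.1 * p.2 = -(p.2 * 𝓜.vert p ζ.1) ∧
    𝓜.vert p ζ.2 = p.2 * 𝓜.vert p ζ.1}

variable {𝓜} {z : B}

/-- A derivation kills `1`, hence also `τ * τ = -1`; expand by the Leibniz rule. -/
lemma Ω_anticomm (hz : z ∈ 𝓜.U) {τ : H} (hτ : τ * τ = -1) (u : B) :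
    𝓜.Ω z u τ * τ = -(τ * 𝓜.Ω z u τ) := by
  have h1 : 𝓜.Ω z u 1 = 0 := by
    have := 𝓜.Ω_mul z hz u 1 1
    rw [mul_one, mul_one, one_mul] at this
    simpa using this
  have := 𝓜.Ω_mul z hz u τ τ
  rw [hτ, (𝓜.Ω z u).map_neg, h1, neg_zero] at this
  exact eq_neg_of_add_eq_zero_left this.symm

/-- The connection term in `vert` is itself tangent to the sphere of imaginary units. So vectors
with admissible vertical part are tangent to the sphere bundle, and equations valid only on that
bundle may be differentiated along them. -/
lemma snd_anticomm {p : B × H} (hz : p.1 ∈ 𝓜.U) (hp : p.2 * p.2 = -1) {ξ : B × H}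
    (hξ : 𝓜.vert p ξ * p.2 = -(p.2 * 𝓜.vert p ξ)) : ξ.2 * p.2 = -(p.2 * ξ.2) := by
  have h := 𝓜.Ω_anticomm hz hp ξ.1
  unfold vert at hξ
  rw [add_mul, mul_add, h, neg_add] at hξ
  exact add_right_cancel hξ

variable (𝓜) in
/-- The covariant derivative, along `ξ`, of a section of the pull back of `E`. -/
def covE (e : B × H → F) (p ξ : B × H) : F := fderiv ℝ e p ξ + 𝓜.Γ p.1 ξ.1 (e p)

variable (𝓜) in
/-- The covariant derivative, along `ξ`, of a section of the pull back of `A`. -/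
def covA (a : B × H → H) (p ξ : B × H) : H := fderiv ℝ a p ξ + 𝓜.Ω p.1 ξ.1 (a p)

lemma contDiffAt_of_mem {G' : Type*} [NormedAddCommGroup G'] [NormedSpace ℝ G'] {f : B → G'}
    (h : ContDiffOn ℝ ∞ f 𝓜.U) (hz : z ∈ 𝓜.U) {n : ℕ} : ContDiffAt ℝ n f z :=
  (h.contDiffAt (𝓜.isOpen_U.mem_nhds hz)).of_le (by exact_mod_cast le_top)

lemma differentiableAt_of_mem {G' : Type*} [NormedAddCommGroup G'] [NormedSpace ℝ G'] {f : B → G'}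
    (h : ContDiffOn ℝ ∞ f 𝓜.U) (hz : z ∈ 𝓜.U) : DifferentiableAt ℝ f z :=
  (contDiffAt_of_mem (n := 1) h hz).differentiableAt (by norm_num)

lemma differentiableAt_comp_fst {G' : Type*} [NormedAddCommGroup G'] [NormedSpace ℝ G']
    {f : B → G'} {p : B × H}
    (h : DifferentiableAt ℝ f p.1) :
    DifferentiableAt ℝ (fun q : B × H ↦ f q.1) p :=
  h.comp p differentiableAt_fst

lemma fderiv_comp_fst {G' : Type*} [NormedAddCommGroup G'] [NormedSpace ℝ G']
    {f : B → G'} {p : B × H}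
    (h : DifferentiableAt ℝ f p.1) (ξ : B × H) :
    fderiv ℝ (fun q : B × H ↦ f q.1) p ξ = fderiv ℝ f p.1 ξ.1 := by
  have : HasFDerivAt (fun q : B × H ↦ f q.1) _ p := h.hasFDerivAt.comp p hasFDerivAt_fst
  rw [this.fderiv]; rfl

variable {p : B × H}

lemma covE_ι (hz : p.1 ∈ 𝓜.U) {x : B × H → B} (hx : DifferentiableAt ℝ x p) (ξ : B × H) :
    𝓜.covE (fun q ↦ 𝓜.ι q.1 (x q)) p ξ =
      𝓜.ι p.1 (fderiv ℝ x p ξ + 𝓜.G p.1 ξ.1 (x p)) := by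
  have d := differentiableAt_of_mem 𝓜.contDiffOn_ι hz
  unfold covE
  rw [fderiv_clm_apply_apply (differentiableAt_comp_fst d) hx, fderiv_comp_fst d,
    (𝓜.ι p.1).map_add, ← 𝓜.ι_parallel p.1 hz]
  abel

lemma fderiv_ρ (hz : p.1 ∈ 𝓜.U) {e : B × H → F} (he : DifferentiableAt ℝ e p)
    (ξ : B × H) :
    fderiv ℝ (fun q ↦ 𝓜.ρ q.1 (e q)) p ξ =
      𝓜.ρ p.1 (𝓜.covE e p ξ) - 𝓜.G p.1 ξ.1 (𝓜.ρ p.1 (e p)) := by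
  have d := differentiableAt_of_mem 𝓜.contDiffOn_ρ hz
  unfold covE
  rw [fderiv_clm_apply_apply (differentiableAt_comp_fst d) he, fderiv_comp_fst d,
    (𝓜.ρ p.1).map_add, ← 𝓜.ρ_parallel p.1 hz]
  abel

lemma differentiableAt_act (hz : p.1 ∈ 𝓜.U) : DifferentiableAt ℝ (fun q ↦ 𝓜.act q.1 q.2) p :=
  (differentiableAt_comp_fst (differentiableAt_of_mem 𝓜.contDiffOn_act hz)).clm_apply
    differentiableAt_snd

/-- The map `q ↦ q.2` is the tautological section of the pull back of `A`; its covariant derivative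
is the vertical part, and the action is parallel. -/
lemma covE_act (hz : p.1 ∈ 𝓜.U) {e : B × H → F} (he : DifferentiableAt ℝ e p)
    (ξ : B × H) :
    𝓜.covE (fun q ↦ 𝓜.act q.1 q.2 (e q)) p ξ =
      𝓜.act p.1 (𝓜.vert p ξ) (e p) + 𝓜.act p.1 p.2 (𝓜.covE e p ξ) := by
  have d := differentiableAt_of_mem 𝓜.contDiffOn_act hz
  unfold covE vert
  rw [fderiv_clm_apply_apply (differentiableAt_act hz) he,
    fderiv_clm_apply_apply (differentiableAt_comp_fst d) differentiableAt_snd, fderiv_comp_fst d,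
    fderiv_snd, (𝓜.act p.1).map_add, clm_add_apply, clm_add_apply, (𝓜.act p.1 p.2).map_add]
  have := 𝓜.act_parallel p.1 hz ξ.1 p.2 (e p)
  rw [← eq_sub_iff_add_eq] at this
  rw [this]
  simp only [ContinuousLinearMap.coe_snd']
  abel

lemma covA_mul (hz : p.1 ∈ 𝓜.U) {a b : B × H → H} (ha : DifferentiableAt ℝ a p)
    (hb : DifferentiableAt ℝ b p) (ξ : B × H) :
    𝓜.covA (fun q ↦ a q * b q) p ξ = 𝓜.covA a p ξ * b p + a p * 𝓜.covA b p ξ := by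
  unfold covA
  have : HasFDerivAt (fun q ↦ a q * b q) _ p := ha.hasFDerivAt.mul' hb.hasFDerivAt
  rw [this.fderiv, 𝓜.Ω_mul p.1 hz, clm_add_apply]
  change a p * fderiv ℝ b p ξ + fderiv ℝ a p ξ * b p + _ = _
  rw [add_mul, mul_add]
  abel

lemma covA_snd (ξ : B × H) : 𝓜.covA (fun q ↦ q.2) p ξ = 𝓜.vert p ξ := by
  unfold covA vert
  rw [fderiv_snd]
  rfl

lemma differentiableAt_vert (hz : p.1 ∈ 𝓜.U) {Y : B × H → B × H}
    (hY : DifferentiableAt ℝ Y p) : DifferentiableAt ℝ (fun q ↦ 𝓜.vert q (Y q)) p :=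
  hY.snd.add (((differentiableAt_comp_fst (differentiableAt_of_mem 𝓜.contDiffOn_Ω hz)).clm_apply
    hY.fst).clm_apply differentiableAt_snd)

/-- The structure equation: the curvature measures the vertical part of brackets. -/
lemma vert_lieBracket (hz : p.1 ∈ 𝓜.U) {X Y : B × H → B × H}
    (hX : DifferentiableAt ℝ X p) (hY : DifferentiableAt ℝ Y p) :
    𝓜.vert p (lieBracket ℝ X Y p) = 𝓜.covA (fun q ↦ 𝓜.vert q (Y q)) p (X p) -
      𝓜.covA (fun q ↦ 𝓜.vert q (X q)) p (Y p) -
      christoffelCurvature 𝓜.Ω p.1 (X p).1 (Y p).1 p.2 := by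
  have d := differentiableAt_of_mem 𝓜.contDiffOn_Ω hz
  have key : ∀ {Y : B × H → B × H} (_ : DifferentiableAt ℝ Y p) (ξ : B × H),
      fderiv ℝ (fun q ↦ 𝓜.vert q (Y q)) p ξ = (fderiv ℝ Y p ξ).2 +
        ((fderiv ℝ 𝓜.Ω p.1 ξ.1 (Y p).1) p.2 + 𝓜.Ω p.1 (fderiv ℝ Y p ξ).1 p.2 +
          𝓜.Ω p.1 (Y p).1 ξ.2) := by
    intro Y hY ξ
    have d1 := differentiableAt_comp_fst d
    have h1 : ∀ ξ, fderiv ℝ (fun q ↦ (Y q).1) p ξ = (fderiv ℝ Y p ξ).1 := fun ξ ↦ by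
      rw [(hY.hasFDerivAt.fst).fderiv]; rfl
    have h2 : ∀ ξ, fderiv ℝ (fun q ↦ (Y q).2) p ξ = (fderiv ℝ Y p ξ).2 := fun ξ ↦ by
      rw [(hY.hasFDerivAt.snd).fderiv]; rfl
    unfold vert
    rw [fderiv_fun_add hY.snd ((d1.clm_apply hY.fst).clm_apply differentiableAt_snd),
      clm_add_apply, h2, fderiv_clm_apply_apply (d1.clm_apply hY.fst) differentiableAt_snd,
      fderiv_clm_apply_apply d1 hY.fst, fderiv_comp_fst d, h1, fderiv_snd, clm_add_apply]
    rfl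
  unfold covA
  -- On antisymmetrising, the terms `Ω (Y p).1 (X p).2` and `Ω (X p).1 (Y p).2` cancel against those
  -- from `covA`. The derivatives of `Ω` and the double products left over form the curvature.
  rw [key hY, key hX]
  unfold vert christoffelCurvature lieBracket
  rw [(𝓜.Ω p.1 (X p).1).map_add, (𝓜.Ω p.1 (Y p).1).map_add]
  simp only [Prod.fst_sub, Prod.snd_sub, (𝓜.Ω p.1).map_sub, clm_sub_apply]
  abel

end LocalFQuaternionicModel

/-! ### Integrability of the local distributions under a curvature condition. -/

namespace LocalFQuaternionicModel

variable {B F H : Type*} [NormedAddCommGroup B] [NormedSpace ℝ B]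
    [NormedAddCommGroup F] [NormedSpace ℝ F]
    [NormedRing H] [NormedAlgebra ℝ H] {𝓜 : LocalFQuaternionicModel B F H}
    {z : B} {p : B × H}

/-- Multiplication is a constant and parallel action of the algebra on itself, so the curvature acts
by derivations. -/
lemma curvature_Ω_mul (hz : z ∈ 𝓜.U) (u v : B) (a b : H) :
    christoffelCurvature 𝓜.Ω z u v (a * b) =
      christoffelCurvature 𝓜.Ω z u v a * b + a * christoffelCurvature 𝓜.Ω z u v b := by
  have d := differentiableAt_of_mem 𝓜.contDiffOn_Ω hz
  refine christoffelCurvature_parallel_action (Φ := fun _ ↦ ContinuousLinearMap.mul ℝ H)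
    contDiffAt_const d d ?_ u v a b
  filter_upwards [𝓜.isOpen_U.mem_nhds hz] with y hy u a f
  rw [fderiv_fun_const]
  exact (zero_add _).trans (𝓜.Ω_mul y hy u a f)

lemma curvature_Ω_anticomm (hz : z ∈ 𝓜.U) {τ : H} (hτ : τ * τ = -1) (u v : B) :
    christoffelCurvature 𝓜.Ω z u v τ * τ = -(τ * christoffelCurvature 𝓜.Ω z u v τ) := by
  have hneg : ∀ a, christoffelCurvature 𝓜.Ω z u v (-a) = -christoffelCurvature 𝓜.Ω z u v a := by
    intro a
    unfold christoffelCurvature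
    rw [(fderiv ℝ 𝓜.Ω z u v).map_neg, (fderiv ℝ 𝓜.Ω z v u).map_neg, (𝓜.Ω z u).map_neg,
      (𝓜.Ω z v).map_neg, (𝓜.Ω z u).map_neg, (𝓜.Ω z v).map_neg]
    abel
  have h1 : christoffelCurvature 𝓜.Ω z u v 1 = 0 := by
    have := curvature_Ω_mul hz u v 1 1
    rw [mul_one, mul_one, one_mul] at this
    simpa using this
  have := curvature_Ω_mul hz u v τ τ
  rw [hτ, hneg, h1, neg_zero] at this
  exact eq_neg_of_add_eq_zero_left this.symm

/-- The base component of the bracket of two vector fields. -/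
lemma lieBracket_fst (hH : AnticommSqNonpos H) (hz : p.1 ∈ 𝓜.U) (hp : p.2 * p.2 = -1)
    {X Y : B × H → B × H} {eX eY : B × H → F}
    (hX : DifferentiableAt ℝ X p) (hY : DifferentiableAt ℝ Y p)
    (heX : DifferentiableAt ℝ eX p) (heY : DifferentiableAt ℝ eY p)
    (hρX : ∀ᶠ q in 𝓝 p, q.2 * q.2 = -1 → (X q).1 = 𝓜.ρ q.1 (eX q))
    (hρY : ∀ᶠ q in 𝓝 p, q.2 * q.2 = -1 → (Y q).1 = 𝓜.ρ q.1 (eY q))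
    (hXt : (X p).2 * p.2 = -(p.2 * (X p).2)) (hYt : (Y p).2 * p.2 = -(p.2 * (Y p).2)) :
    (lieBracket ℝ X Y p).1 = 𝓜.ρ p.1 (𝓜.covE eY p (X p) - 𝓜.covE eX p (Y p)) := by
  have d := differentiableAt_comp_fst (p := p) (differentiableAt_of_mem 𝓜.contDiffOn_ρ hz)
  have key : ∀ {Y : B × H → B × H} {e : B × H → F}, DifferentiableAt ℝ Y p →
      DifferentiableAt ℝ e p →
      (∀ᶠ q in 𝓝 p, q.2 * q.2 = -1 → (Y q).1 = 𝓜.ρ q.1 (e q)) → ∀ ξ : B × H,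
      ξ.2 * p.2 = -(p.2 * ξ.2) → (fderiv ℝ Y p ξ).1 =
        𝓜.ρ p.1 (𝓜.covE e p ξ) - 𝓜.G p.1 ξ.1 (Y p).1 := by
    intro Y e hY he hρ ξ hξ
    have h1 : fderiv ℝ (fun q ↦ (Y q).1) p ξ = (fderiv ℝ Y p ξ).1 := by
      rw [(hY.hasFDerivAt.fst).fderiv]; rfl
    -- The equation relating `Y` and `e` holds only over the sphere bundle, so it is differentiated
    -- only in the tangent direction `ξ`.
    rw [← h1, fderiv_eq_of_eq_on_sphere hH hY.fst (d.clm_apply he) hp hρ hξ, fderiv_ρ hz he,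
      hρ.self_of_nhds hp]
  unfold lieBracket
  -- Zero torsion enters here: by symmetry of `G`, the two Christoffel terms cancel.
  rw [Prod.fst_sub, key hY heY hρY _ hXt, key hX heX hρX _ hYt, 𝓜.G_symm p.1 hz (X p).1,
    (𝓜.ρ p.1).map_sub]
  abel

/-- The integrability of the twistorial distributions: the horizontal part. -/
lemma bracket_lift (hz : p.1 ∈ 𝓜.U) (hp : p.2 * p.2 = -1) {ξ₁ ξ₂ η₁ η₂ : B × H}
    {eX eY : B × H → F} (heX : DifferentiableAt ℝ eX p) (heY : DifferentiableAt ℝ eY p)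
    (hξ : 𝓜.vert p ξ₂ = p.2 * 𝓜.vert p ξ₁) (hη : 𝓜.vert p η₂ = p.2 * 𝓜.vert p η₁) :
    (𝓜.covE (fun q ↦ 𝓜.act q.1 q.2 (eY q)) p ξ₁ - 𝓜.covE eX p η₂) +
        (𝓜.covE eY p ξ₂ - 𝓜.covE (fun q ↦ 𝓜.act q.1 q.2 (eX q)) p η₁) =
      𝓜.act p.1 p.2 ((𝓜.covE eY p ξ₁ - 𝓜.covE eX p η₁) -
        (𝓜.covE (fun q ↦ 𝓜.act q.1 q.2 (eY q)) p ξ₂ -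
          𝓜.covE (fun q ↦ 𝓜.act q.1 q.2 (eX q)) p η₂)) := by
  have hm := 𝓜.act_mul p.1 hz
  have hneg : ∀ f, 𝓜.act p.1 p.2 (𝓜.act p.1 p.2 f) = -f := fun f ↦ by
    rw [← hm, hp, (𝓜.act p.1).map_neg, clm_neg_apply, 𝓜.act_one p.1 hz]
  -- Differentiating `J` adds the action of a vertical part. By `hξ` and `hη` the vertical parts of
  -- `ξ₂`, `η₂` are `τ` times those of `ξ₁`, `η₁`, so these extra terms match after applying `J`.
  rw [covE_act hz heY, covE_act hz heX, covE_act hz heY, covE_act hz heX]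
  simp only [(𝓜.act p.1 p.2).map_sub, (𝓜.act p.1 p.2).map_add, hneg, hξ, hη, hm]
  abel

/-- The integrability of the twistorial distributions: the vertical part. -/
lemma bracket_vert (hH : AnticommSqNonpos H) (hz : p.1 ∈ 𝓜.U) (hp : p.2 * p.2 = -1)
    {X₁ X₂ Y₁ Y₂ : B × H → B × H}
    (hX₁ : DifferentiableAt ℝ X₁ p) (hX₂ : DifferentiableAt ℝ X₂ p)
    (hY₁ : DifferentiableAt ℝ Y₁ p) (hY₂ : DifferentiableAt ℝ Y₂ p)
    (hX : ∀ᶠ q in 𝓝 p, q.2 * q.2 = -1 → 𝓜.vert q (X₁ q) * q.2 = -(q.2 * 𝓜.vert q (X₁ q)) ∧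
      𝓜.vert q (X₂ q) = q.2 * 𝓜.vert q (X₁ q))
    (hY : ∀ᶠ q in 𝓝 p, q.2 * q.2 = -1 → 𝓜.vert q (Y₁ q) * q.2 = -(q.2 * 𝓜.vert q (Y₁ q)) ∧
      𝓜.vert q (Y₂ q) = q.2 * 𝓜.vert q (Y₁ q))
    (hR : christoffelCurvature 𝓜.Ω p.1 (X₁ p).1 (Y₂ p).1 p.2 +
        christoffelCurvature 𝓜.Ω p.1 (X₂ p).1 (Y₁ p).1 p.2 =
      p.2 * (christoffelCurvature 𝓜.Ω p.1 (X₁ p).1 (Y₁ p).1 p.2 -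
        christoffelCurvature 𝓜.Ω p.1 (X₂ p).1 (Y₂ p).1 p.2)) :
    𝓜.vert p (lieBracket ℝ X₁ Y₁ p - lieBracket ℝ X₂ Y₂ p) * p.2 =
        -(p.2 * 𝓜.vert p (lieBracket ℝ X₁ Y₁ p - lieBracket ℝ X₂ Y₂ p)) ∧
      𝓜.vert p (lieBracket ℝ X₁ Y₂ p + lieBracket ℝ X₂ Y₁ p) =
        p.2 * 𝓜.vert p (lieBracket ℝ X₁ Y₁ p - lieBracket ℝ X₂ Y₂ p) := by
  have hsub : ∀ ξ η : B × H, 𝓜.vert p (ξ - η) = 𝓜.vert p ξ - 𝓜.vert p η := by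
    intro ξ η; unfold vert
    rw [Prod.fst_sub, Prod.snd_sub, (𝓜.Ω p.1).map_sub, clm_sub_apply]; abel
  have hadd : ∀ ξ η : B × H, 𝓜.vert p (ξ + η) = 𝓜.vert p ξ + 𝓜.vert p η := by
    intro ξ η; unfold vert
    rw [Prod.fst_add, Prod.snd_add, (𝓜.Ω p.1).map_add, clm_add_apply]; abel
  have hneg : ∀ f : H, p.2 * (p.2 * f) = -f := fun f ↦ by rw [← mul_assoc, hp, neg_one_mul]
  have dsnd : DifferentiableAt ℝ (fun q : B × H ↦ q.2) p := differentiableAt_snd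
  -- the covariant derivatives of the equations of the distribution
  have key : ∀ {Y₁ Y₂ : B × H → B × H}, DifferentiableAt ℝ Y₁ p → DifferentiableAt ℝ Y₂ p →
      (∀ᶠ q in 𝓝 p, q.2 * q.2 = -1 → 𝓜.vert q (Y₁ q) * q.2 = -(q.2 * 𝓜.vert q (Y₁ q)) ∧
        𝓜.vert q (Y₂ q) = q.2 * 𝓜.vert q (Y₁ q)) →
      ∀ ξ : B × H, 𝓜.vert p ξ * p.2 = -(p.2 * 𝓜.vert p ξ) →
      𝓜.covA (fun q ↦ 𝓜.vert q (Y₂ q)) p ξ = 𝓜.vert p ξ * 𝓜.vert p (Y₁ p) +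
        p.2 * 𝓜.covA (fun q ↦ 𝓜.vert q (Y₁ q)) p ξ ∧
      𝓜.covA (fun q ↦ 𝓜.vert q (Y₁ q)) p ξ * p.2 + 𝓜.vert p (Y₁ p) * 𝓜.vert p ξ =
        -(𝓜.vert p ξ * 𝓜.vert p (Y₁ p) + p.2 * 𝓜.covA (fun q ↦ 𝓜.vert q (Y₁ q)) p ξ) := by
    intro Y₁ Y₂ h₁ h₂ hY ξ hξ
    have hξ2 := snd_anticomm hz hp hξ
    have d₁ := differentiableAt_vert hz h₁
    have d₂ := differentiableAt_vert hz h₂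
    have dm : DifferentiableAt ℝ (fun q ↦ q.2 * 𝓜.vert q (Y₁ q)) p := dsnd.mul d₁
    have dm' : DifferentiableAt ℝ (fun q ↦ 𝓜.vert q (Y₁ q) * q.2) p := d₁.mul dsnd
    have h0 := hY.self_of_nhds hp
    have e₁ : 𝓜.covA (fun q ↦ 𝓜.vert q (Y₂ q)) p ξ =
        𝓜.covA (fun q ↦ q.2 * 𝓜.vert q (Y₁ q)) p ξ := by
      unfold covA
      rw [fderiv_eq_of_eq_on_sphere hH d₂ dm hp (hY.mono fun q h hq ↦ (h hq).2) hξ2]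
      beta_reduce
      rw [h0.2]
    have e₂ : 𝓜.covA (fun q ↦ 𝓜.vert q (Y₁ q) * q.2) p ξ =
        -𝓜.covA (fun q ↦ q.2 * 𝓜.vert q (Y₁ q)) p ξ := by
      unfold covA
      rw [fderiv_eq_of_eq_on_sphere hH dm' dm.neg hp (hY.mono fun q h hq ↦ (h hq).1) hξ2,
        fderiv_neg]
      beta_reduce
      rw [h0.1, (𝓜.Ω p.1 ξ.1).map_neg, clm_neg_apply, neg_add]
    rw [covA_mul hz dsnd d₁, covA_snd] at e₁ e₂
    rw [covA_mul hz d₁ dsnd, covA_snd] at e₂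
    exact ⟨e₁, e₂⟩
  have tX := hX.self_of_nhds hp
  have tY := hY.self_of_nhds hp
  have anti : ∀ {a b : H}, a * p.2 = -(p.2 * a) → b = p.2 * a → b * p.2 = -(p.2 * b) := by
    intro a b ha hb; rw [hb, mul_assoc, ha, mul_neg]
  have tX₂ := anti tX.1 tX.2
  have tY₂ := anti tY.1 tY.2
  rw [hsub, hadd, vert_lieBracket hz hX₁ hY₁, vert_lieBracket hz hX₂ hY₂,
    vert_lieBracket hz hX₁ hY₂, vert_lieBracket hz hX₂ hY₁]
  obtain ⟨a1, a2⟩ := key hY₁ hY₂ hY _ tX.1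
  obtain ⟨b1, b2⟩ := key hY₁ hY₂ hY _ tX₂
  obtain ⟨c1, c2⟩ := key hX₁ hX₂ hX _ tY.1
  obtain ⟨d1, d2⟩ := key hX₁ hX₂ hX _ tY₂
  have r1 := curvature_Ω_anticomm hz hp (X₁ p).1 (Y₁ p).1
  have r2 := curvature_Ω_anticomm hz hp (X₂ p).1 (Y₂ p).1
  rw [tX.2] at b1 b2
  rw [tY.2] at d1 d2
  rw [a1, b1, c1, d1]
  rw [← eq_sub_iff_add_eq] at a2 b2 c2 d2
  rw [mul_sub] at hR
  rw [← eq_sub_iff_add_eq] at hR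
  -- All covariant derivative terms are controlled by the differentiated equations. For the
  -- curvature terms, the first claim uses that `R τ` anticommutes with `τ`; the second is exactly
  -- where `hR` is needed.
  constructor
  · simp only [sub_mul, add_mul, mul_sub, mul_add, a2, b2, c2, d2, r1, r2, mul_assoc, hneg, tX.1,
      tY.1, mul_neg, neg_add, neg_neg]
    abel
  · simp only [mul_sub, mul_add, mul_assoc, hneg, hR]
    abel

lemma distribution_mem_iff {S : B → H → Set (B × B)} {ζ : (B × H) × (B × H)} :
    ζ ∈ 𝓜.distribution S p ↔ (ζ.1.1, ζ.2.1) ∈ S p.1 p.2 ∧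
      𝓜.vert p ζ.1 * p.2 = -(p.2 * 𝓜.vert p ζ.1) ∧ 𝓜.vert p ζ.2 = p.2 * 𝓜.vert p ζ.1 := Iff.rfl

lemma act_act_self (hz : p.1 ∈ 𝓜.U) (hp : p.2 * p.2 = -1) (f : F) :
    𝓜.act p.1 p.2 (𝓜.act p.1 p.2 f) = -f := by
  rw [← 𝓜.act_mul p.1 hz, hp, (𝓜.act p.1).map_neg, clm_neg_apply, 𝓜.act_one p.1 hz]

/-- The vector `f - ι (ρ f)` is the component of `f` in `V`, and `J` maps `V` into `TM`. -/
lemma act_ι_ρ (hz : p.1 ∈ 𝓜.U) (hp : p.2 * p.2 = -1) (f : F) :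
    𝓜.ι p.1 (𝓜.ρ p.1 (𝓜.act p.1 p.2 (f - 𝓜.ι p.1 (𝓜.ρ p.1 f)))) =
      𝓜.act p.1 p.2 (f - 𝓜.ι p.1 (𝓜.ρ p.1 f)) :=
  𝓜.act_mem p.1 hz p.2 hp _ (by rw [(𝓜.ρ p.1).map_sub, 𝓜.ρ_ι p.1 hz, sub_self])

/-- The section of `E` which lifts a section of the spaces `ρ(E^J)`. -/
lemma coCR_lift (hz : p.1 ∈ 𝓜.U) (hp : p.2 * p.2 = -1) {x : B × B}
    (hx : x ∈ 𝓜.coCRSpace p.1 p.2) :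
    let e := 𝓜.ι p.1 x.1 - 𝓜.act p.1 p.2 (𝓜.ι p.1 (x.2 - 𝓜.ρ p.1 (𝓜.act p.1 p.2 (𝓜.ι p.1 x.1))))
    x.1 = 𝓜.ρ p.1 e ∧ x.2 = 𝓜.ρ p.1 (𝓜.act p.1 p.2 e) := by
  obtain ⟨f, h1, h2⟩ := hx
  intro e
  have hρ := 𝓜.ρ_ι p.1 hz
  have hv := act_ι_ρ hz hp f
  -- The lift is unique. If `v` is the `V`-component of `f`, then `Jv` is tangent and equals `ι (x.2
  -- - ρ J ι x.1)`, so `v = -J(Jv)` is recovered from `x`.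
  suffices h : e = f by rw [h]; exact ⟨h1, h2⟩
  have h3 : x.2 - 𝓜.ρ p.1 (𝓜.act p.1 p.2 (𝓜.ι p.1 x.1)) =
      𝓜.ρ p.1 (𝓜.act p.1 p.2 (f - 𝓜.ι p.1 (𝓜.ρ p.1 f))) := by
    rw [h1, h2, (𝓜.act p.1 p.2).map_sub, (𝓜.ρ p.1).map_sub]
  change 𝓜.ι p.1 x.1 - 𝓜.act p.1 p.2 (𝓜.ι p.1 (x.2 - 𝓜.ρ p.1 (𝓜.act p.1 p.2 (𝓜.ι p.1 x.1)))) = f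
  rw [h3, hv, act_act_self hz hp, h1]
  abel

/-- The condition on the curvature for the twistorial distribution determined by `S` to be
integrable. -/
def CurvatureCondition (𝓜 : LocalFQuaternionicModel B F H) (S : B → H → Set (B × B)) (z : B)
    (τ : H) : Prop :=
  ∀ x ∈ S z τ, ∀ y ∈ S z τ,
    christoffelCurvature 𝓜.Ω z x.1 y.2 τ + christoffelCurvature 𝓜.Ω z x.2 y.1 τ =
      τ * (christoffelCurvature 𝓜.Ω z x.1 y.1 τ - christoffelCurvature 𝓜.Ω z x.2 y.2 τ)

variable {X₁ X₂ Y₁ Y₂ : B × H → B × H}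

/-- The co-CR twistorial structure is integrable. -/
theorem coCR_integrable (hH : AnticommSqNonpos H) (hz : p.1 ∈ 𝓜.U) (hp : p.2 * p.2 = -1)
    (hX₁ : DifferentiableAt ℝ X₁ p) (hX₂ : DifferentiableAt ℝ X₂ p)
    (hY₁ : DifferentiableAt ℝ Y₁ p) (hY₂ : DifferentiableAt ℝ Y₂ p)
    (hX : ∀ᶠ q in 𝓝 p, q.2 * q.2 = -1 → (X₁ q, X₂ q) ∈ 𝓜.distribution 𝓜.coCRSpace q)
    (hY : ∀ᶠ q in 𝓝 p, q.2 * q.2 = -1 → (Y₁ q, Y₂ q) ∈ 𝓜.distribution 𝓜.coCRSpace q)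
    (hR : 𝓜.CurvatureCondition 𝓜.coCRSpace p.1 p.2) :
    (lieBracket ℝ X₁ Y₁ p - lieBracket ℝ X₂ Y₂ p, lieBracket ℝ X₁ Y₂ p + lieBracket ℝ X₂ Y₁ p) ∈
      𝓜.distribution 𝓜.coCRSpace p := by
  have tX := hX.self_of_nhds hp
  have tY := hY.self_of_nhds hp
  rw [distribution_mem_iff] at tX tY ⊢
  refine ⟨?_, bracket_vert hH hz hp hX₁ hX₂ hY₁ hY₂
    (hX.mono fun q h hq ↦ (h hq).2) (hY.mono fun q h hq ↦ (h hq).2)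
    (hR _ tX.1 _ tY.1)⟩
  -- The formula of `coCR_lift` makes sense, and is differentiable, off the sphere bundle too,
  -- though it is a lift only over it.
  let lift : (B × H → B × H) → (B × H → B × H) → B × H → F := fun X₁ X₂ q ↦ 𝓜.ι q.1 (X₁ q).1 -
    𝓜.act q.1 q.2 (𝓜.ι q.1 ((X₂ q).1 - 𝓜.ρ q.1 (𝓜.act q.1 q.2 (𝓜.ι q.1 (X₁ q).1))))
  have dι := differentiableAt_comp_fst (p := p) (differentiableAt_of_mem 𝓜.contDiffOn_ι hz)
  have dρ := differentiableAt_comp_fst (p := p) (differentiableAt_of_mem 𝓜.contDiffOn_ρ hz)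
  have da := differentiableAt_act (𝓜 := 𝓜) hz
  have hd : ∀ {X₁ X₂ : B × H → B × H}, DifferentiableAt ℝ X₁ p → DifferentiableAt ℝ X₂ p →
      DifferentiableAt ℝ (lift X₁ X₂) p := fun h₁ h₂ ↦
    (dι.clm_apply h₁.fst).sub (da.clm_apply (dι.clm_apply (h₂.fst.sub
      (dρ.clm_apply (da.clm_apply (dι.clm_apply h₁.fst))))))
  have hU : ∀ᶠ q : B × H in 𝓝 p, q.1 ∈ 𝓜.U :=
    continuousAt_fst.eventually (𝓜.isOpen_U.mem_nhds hz)
  have hl : ∀ {X₁ X₂ : B × H → B × H},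
      (∀ᶠ q in 𝓝 p, q.2 * q.2 = -1 → (X₁ q, X₂ q) ∈ 𝓜.distribution 𝓜.coCRSpace q) →
      ∀ᶠ q in 𝓝 p, q.2 * q.2 = -1 → (X₁ q).1 = 𝓜.ρ q.1 (lift X₁ X₂ q) ∧
        (X₂ q).1 = 𝓜.ρ q.1 (𝓜.act q.1 q.2 (lift X₁ X₂ q)) := by
    intro X₁ X₂ h
    filter_upwards [hU, h] with q hq1 hq hqτ
    exact coCR_lift hq1 hqτ (hq hqτ).1
  have dX := hd hX₁ hX₂
  have dY := hd hY₁ hY₂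
  have lX := hl hX
  have lY := hl hY
  have anti : ∀ {a b : H}, a * p.2 = -(p.2 * a) → b = p.2 * a → b * p.2 = -(p.2 * b) := by
    intro a b ha hb; rw [hb, mul_assoc, ha, mul_neg]
  have tX₂ := anti tX.2.1 tX.2.2
  have tY₂ := anti tY.2.1 tY.2.2
  have uX₁ := snd_anticomm hz hp tX.2.1
  have uY₁ := snd_anticomm hz hp tY.2.1
  have uX₂ := snd_anticomm hz hp tX₂
  have uY₂ := snd_anticomm hz hp tY₂
  have lX1 := lX.mono fun q h hq ↦ (h hq).1
  have lX2 := lX.mono fun q h hq ↦ (h hq).2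
  have lY1 := lY.mono fun q h hq ↦ (h hq).1
  have lY2 := lY.mono fun q h hq ↦ (h hq).2
  -- The witness is the real part of `∇_X e_Y - ∇_Y e_X` for the complex sections `e + iJe`;
  -- `bracket_lift` identifies the imaginary part with its image under `J`.
  refine ⟨(𝓜.covE (lift Y₁ Y₂) p (X₁ p) - 𝓜.covE (lift X₁ X₂) p (Y₁ p)) -
        (𝓜.covE (fun q ↦ 𝓜.act q.1 q.2 (lift Y₁ Y₂ q)) p (X₂ p) -
          𝓜.covE (fun q ↦ 𝓜.act q.1 q.2 (lift X₁ X₂ q)) p (Y₂ p)), ?_, ?_⟩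
  rotate_left
  · change (lieBracket ℝ X₁ Y₂ p + lieBracket ℝ X₂ Y₁ p).1 = _
    rw [← bracket_lift hz hp dX dY tX.2.2 tY.2.2, Prod.fst_add,
      lieBracket_fst hH hz hp hX₁ hY₂ dX (da.clm_apply dY) lX1 lY2 uX₁ uY₂,
      lieBracket_fst hH hz hp hX₂ hY₁ (da.clm_apply dX) dY lX2 lY1 uX₂ uY₁]
    exact ((𝓜.ρ p.1).map_add _ _).symm
  · change (lieBracket ℝ X₁ Y₁ p - lieBracket ℝ X₂ Y₂ p).1 = _
    rw [Prod.fst_sub,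
      lieBracket_fst hH hz hp hX₁ hY₁ dX dY lX1 lY1 uX₁ uY₁,
      lieBracket_fst hH hz hp hX₂ hY₂ (da.clm_apply dX) (da.clm_apply dY) lX2 lY2 uX₂ uY₂]
    exact ((𝓜.ρ p.1).map_sub _ _).symm

/-- The CR twistorial structure is integrable. -/
theorem CR_integrable (hH : AnticommSqNonpos H) (hz : p.1 ∈ 𝓜.U) (hp : p.2 * p.2 = -1)
    (hX₁ : DifferentiableAt ℝ X₁ p) (hX₂ : DifferentiableAt ℝ X₂ p)
    (hY₁ : DifferentiableAt ℝ Y₁ p) (hY₂ : DifferentiableAt ℝ Y₂ p)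
    (hX : ∀ᶠ q in 𝓝 p, q.2 * q.2 = -1 → (X₁ q, X₂ q) ∈ 𝓜.distribution 𝓜.crSpace q)
    (hY : ∀ᶠ q in 𝓝 p, q.2 * q.2 = -1 → (Y₁ q, Y₂ q) ∈ 𝓜.distribution 𝓜.crSpace q)
    (hR : 𝓜.CurvatureCondition 𝓜.crSpace p.1 p.2) :
    (lieBracket ℝ X₁ Y₁ p - lieBracket ℝ X₂ Y₂ p, lieBracket ℝ X₁ Y₂ p + lieBracket ℝ X₂ Y₁ p) ∈
      𝓜.distribution 𝓜.crSpace p := by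
  have tX := hX.self_of_nhds hp
  have tY := hY.self_of_nhds hp
  rw [distribution_mem_iff] at tX tY ⊢
  refine ⟨?_, bracket_vert hH hz hp hX₁ hX₂ hY₁ hY₂
    (hX.mono fun q h hq ↦ (h hq).2) (hY.mono fun q h hq ↦ (h hq).2)
    (hR _ tX.1 _ tY.1)⟩
  have dι := differentiableAt_comp_fst (p := p) (differentiableAt_of_mem 𝓜.contDiffOn_ι hz)
  have da := differentiableAt_act (𝓜 := 𝓜) hz
  have anti : ∀ {a b : H}, a * p.2 = -(p.2 * a) → b = p.2 * a → b * p.2 = -(p.2 * b) := by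
    intro a b ha hb; rw [hb, mul_assoc, ha, mul_neg]
  have tX₂ := anti tX.2.1 tX.2.2
  have tY₂ := anti tY.2.1 tY.2.2
  have dX := dι.clm_apply hX₁.fst
  have dY := dι.clm_apply hY₁.fst
  have key : ∀ {X₁ X₂ : B × H → B × H}, DifferentiableAt ℝ X₁ p → DifferentiableAt ℝ X₂ p →
      (∀ᶠ q in 𝓝 p, q.2 * q.2 = -1 → (X₁ q, X₂ q) ∈ 𝓜.distribution 𝓜.crSpace q) →
      ∀ ξ : B × H, 𝓜.vert p ξ * p.2 = -(p.2 * 𝓜.vert p ξ) →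
      𝓜.covE (fun q ↦ 𝓜.act q.1 q.2 (𝓜.ι q.1 (X₁ q).1)) p ξ =
        𝓜.ι p.1 ((fderiv ℝ X₂ p ξ).1 + 𝓜.G p.1 ξ.1 (X₂ p).1) := by
    intro X₁ X₂ h₁ h₂ h ξ hξ
    have h1 : fderiv ℝ (fun q ↦ (X₂ q).1) p ξ = (fderiv ℝ X₂ p ξ).1 := by
      rw [(h₂.hasFDerivAt.fst).fderiv]; rfl
    rw [← h1, ← covE_ι hz h₂.fst]
    unfold covE
    rw [fderiv_eq_of_eq_on_sphere hH (da.clm_apply (dι.clm_apply h₁.fst))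
      (dι.clm_apply h₂.fst) hp (h.mono fun q hq hqτ ↦ (hq hqτ).1) (snd_anticomm hz hp hξ)]
    congr 2
    exact (h.self_of_nhds hp).1
  have key1 : ∀ {X₁ : B × H → B × H}, DifferentiableAt ℝ X₁ p → ∀ ξ : B × H,
      𝓜.covE (fun q ↦ 𝓜.ι q.1 (X₁ q).1) p ξ =
        𝓜.ι p.1 ((fderiv ℝ X₁ p ξ).1 + 𝓜.G p.1 ξ.1 (X₁ p).1) := by
    intro X₁ h₁ ξ
    have h1 : fderiv ℝ (fun q ↦ (X₁ q).1) p ξ = (fderiv ℝ X₁ p ξ).1 := by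
      rw [(h₁.hasFDerivAt.fst).fderiv]; rfl
    rw [← h1, ← covE_ι hz h₁.fst]
  -- With lifts `ι X₁` and `ι Y₁`, the sections `J ι X₁` and `J ι Y₁` may be replaced by `ι X₂` and
  -- `ι Y₂` in tangent derivatives. Both sides then involve only `ι` of brackets, by the symmetry of
  -- `G`.
  have hb := bracket_lift hz hp dX dY tX.2.2 tY.2.2
  rw [key hY₁ hY₂ hY _ tX.2.1, key hY₁ hY₂ hY _ tX₂, key hX₁ hX₂ hX _ tY.2.1,
    key hX₁ hX₂ hX _ tY₂, key1 hY₁, key1 hY₁, key1 hX₁, key1 hX₁] at hb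
  simp only [← (𝓜.ι p.1).map_sub, ← (𝓜.ι p.1).map_add] at hb
  have hG := 𝓜.G_symm p.1 hz
  have main : ∀ X Y : B × H → B × H, (fderiv ℝ Y p (X p)).1 + 𝓜.G p.1 (X p).1 (Y p).1 -
      ((fderiv ℝ X p (Y p)).1 + 𝓜.G p.1 (Y p).1 (X p).1) = (lieBracket ℝ X Y p).1 := by
    intro X Y
    unfold lieBracket
    rw [hG (X p).1, Prod.fst_sub]
    abel
  rw [main, main, main, main] at hb
  exact hb.symm

end LocalFQuaternionicModel

/-! ### Linear algebra of the quaternions. -/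

/-- The properties of the algebra of quaternions which are relevant for the integrability of the
twistorial structures. -/
structure IsQuaternionic (H : Type*) [NormedRing H] [NormedAlgebra ℝ H] : Prop where
  anticommSqNonpos : AnticommSqNonpos H
  exists_mul_eq_one : ∀ a : H, a ≠ 0 → ∃ b, a * b = 1
  finrank_eq : finrank ℝ H = 4
  exists_basis : ∃ i j : H, i * i = -1 ∧ j * j = -1 ∧ i * j = -(j * i)

lemma Quaternion.exists_anticommuting_pair :
    ∃ i j : ℍ[ℝ], i * i = -1 ∧ j * j = -1 ∧ i * j = -(j * i) := by
  obtain ⟨i, hi⟩ : ∃ i : ℍ[ℝ], i.re = 0 ∧ i.imI = 1 ∧ i.imJ = 0 ∧ i.imK = 0 :=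
    ⟨⟨0, 1, 0, 0⟩, rfl, rfl, rfl, rfl⟩
  obtain ⟨j, hj⟩ : ∃ j : ℍ[ℝ], j.re = 0 ∧ j.imI = 0 ∧ j.imJ = 1 ∧ j.imK = 0 :=
    ⟨⟨0, 0, 1, 0⟩, rfl, rfl, rfl, rfl⟩
  refine ⟨i, j, ?_, ?_, ?_⟩ <;> ext <;> simp [hi, hj]

lemma Quaternion.isQuaternionic : IsQuaternionic ℍ[ℝ] where
  anticommSqNonpos _ _ hτ ha :=
    ⟨_, Quaternion.normSq_nonneg, Quaternion.mul_self_of_anticomm hτ ha⟩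
  exists_mul_eq_one a ha := ⟨a⁻¹, mul_inv_cancel₀ ha⟩
  finrank_eq := Quaternion.finrank_eq_four
  exists_basis := Quaternion.exists_anticommuting_pair

section LinearAlgebra

variable {H : Type*} [NormedRing H] [NormedAlgebra ℝ H]

/-- If `τ² = -1` then `1` and `τ` are linearly independent, also when acting on a vector. -/
lemma linearIndependent_pair_of_sq {F : Type*} [AddCommGroup F] [Module ℝ F] (J : F →ₗ[ℝ] F)
    (hJ : ∀ f, J (J f) = -f) {f : F} (hf : f ≠ 0) : LinearIndependent ℝ ![f, J f] := by
  rw [LinearIndependent.pair_iff]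
  intro s t h
  have h1 := congrArg J h
  rw [map_add, map_smul, map_smul, hJ, map_zero] at h1
  have h2 : (s ^ 2 + t ^ 2) • f = 0 := by
    have : (s ^ 2 + t ^ 2) • f = s • (s • f + t • J f) - t • (s • J f + t • -f) := by module
    rw [this, h, h1, smul_zero, smul_zero, sub_zero]
  have h3 : s ^ 2 + t ^ 2 = 0 := (smul_eq_zero.1 h2).resolve_right hf
  constructor <;> nlinarith [sq_nonneg s, sq_nonneg t]

lemma finrank_span_pair_of_sq {F : Type*} [AddCommGroup F] [Module ℝ F] (J : F →ₗ[ℝ] F)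
    (hJ : ∀ f, J (J f) = -f) {f : F} (hf : f ≠ 0) :
    finrank ℝ (Submodule.span ℝ {f, J f}) = 2 := by
  have := finrank_span_eq_card (linearIndependent_pair_of_sq J hJ hf)
  rwa [Matrix.range_cons_cons_empty, Fintype.card_fin] at this

variable (H) in
/-- The elements which anticommute with `τ`. -/
def anticommSubmodule (τ : H) : Submodule ℝ H where
  carrier := {q | q * τ = -(τ * q)}
  add_mem' {a b} ha hb := by
    change (a + b) * τ = -(τ * (a + b))
    rw [add_mul, mul_add, ha, hb, neg_add]
  zero_mem' := by simp
  smul_mem' r a ha := by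
    change (r • a) * τ = -(τ * (r • a))
    rw [smul_mul_assoc, ha, mul_smul_comm, smul_neg]

/-- Elements of `span {1, τ}` commute with `τ`, so they anticommute with it only if zero. The
submodule thus meets a plane trivially inside a four-dimensional space. -/
lemma finrank_anticommSubmodule_le (hH : IsQuaternionic H) {τ : H} (hτ : τ * τ = -1) :
    finrank ℝ (anticommSubmodule H τ) ≤ 2 := by
  have : FiniteDimensional ℝ H := .of_finrank_pos (by rw [hH.finrank_eq]; norm_num)
  have : Nontrivial H := nontrivial_of_finrank_pos (R := ℝ) (by rw [hH.finrank_eq]; norm_num)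
  have h2 := finrank_span_pair_of_sq (LinearMap.mulLeft ℝ τ)
    (fun f ↦ by simp [← mul_assoc, hτ]) (one_ne_zero (α := H))
  have hd : Disjoint (anticommSubmodule H τ)
      (Submodule.span ℝ {(1 : H), LinearMap.mulLeft ℝ τ 1}) := by
    rw [Submodule.disjoint_def]
    intro q hq hq'
    obtain ⟨s, t, rfl⟩ := Submodule.mem_span_pair.1 hq'
    rw [LinearMap.mulLeft_apply, mul_one] at hq ⊢
    have hq : (s • 1 + t • τ) * τ = -(τ * (s • 1 + t • τ)) := hq
    rw [add_mul, mul_add, smul_mul_assoc, smul_mul_assoc, mul_smul_comm, mul_smul_comm, one_mul,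
      mul_one, eq_neg_iff_add_eq_zero] at hq
    have h : τ * (s • 1 + t • τ) = 0 := by
      rw [mul_add, mul_smul_comm, mul_smul_comm, mul_one]
      have : (2 : ℝ) • (s • τ + t • (τ * τ)) = 0 := by rw [← hq]; module
      exact (smul_eq_zero.1 this).resolve_left two_ne_zero
    have h' := congrArg (τ * ·) h
    simp only [← mul_assoc, hτ, mul_zero, neg_mul, one_mul, neg_eq_zero] at h'
    exact h'
  have := Submodule.finrank_add_finrank_le_of_disjoint hd
  rw [h2, hH.finrank_eq] at this
  omega

end LinearAlgebra

/-! ### The curvature condition, from the Bianchi identity and dimension counts. -/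

namespace LocalFQuaternionicModel

variable {B F H : Type*} [NormedAddCommGroup B] [NormedSpace ℝ B]
    [NormedAddCommGroup F] [NormedSpace ℝ F]
    [NormedRing H] [NormedAlgebra ℝ H] {𝓜 : LocalFQuaternionicModel B F H}
    {z : B} {τ : H}

/-- A parallel `ρ` carries the curvature of `E` to that of `D`, which satisfies the first Bianchi
identity. On `E` the cyclic sum need not vanish: it lies in `V`. -/
lemma curvature_bianchi (hz : z ∈ 𝓜.U) (e₁ e₂ e₃ : F) :
    𝓜.ρ z (christoffelCurvature 𝓜.Γ z (𝓜.ρ z e₁) (𝓜.ρ z e₂) e₃ +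
      christoffelCurvature 𝓜.Γ z (𝓜.ρ z e₂) (𝓜.ρ z e₃) e₁ +
      christoffelCurvature 𝓜.Γ z (𝓜.ρ z e₃) (𝓜.ρ z e₁) e₂) = 0 := by
  have hU := 𝓜.isOpen_U.mem_nhds hz
  have dG := differentiableAt_of_mem 𝓜.contDiffOn_G hz
  have key : ∀ u v f, 𝓜.ρ z (christoffelCurvature 𝓜.Γ z u v f) =
      christoffelCurvature 𝓜.G z u v (𝓜.ρ z f) :=
    christoffelCurvature_parallel (contDiffAt_of_mem (n := 2) 𝓜.contDiffOn_ρ hz)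
      (differentiableAt_of_mem 𝓜.contDiffOn_Γ hz) dG
      (by filter_upwards [hU] with y hy using 𝓜.ρ_parallel y hy)
  rw [(𝓜.ρ z).map_add, (𝓜.ρ z).map_add, key, key, key]
  exact christoffelCurvature_bianchi dG (by filter_upwards [hU] with y hy using 𝓜.G_symm y hy) _ _ _

lemma curvature_act (hz : z ∈ 𝓜.U) (u v : B) (a : H) (f : F) :
    christoffelCurvature 𝓜.Γ z u v (𝓜.act z a f) =
      𝓜.act z (christoffelCurvature 𝓜.Ω z u v a) f +
        𝓜.act z a (christoffelCurvature 𝓜.Γ z u v f) :=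
  christoffelCurvature_parallel_action (contDiffAt_of_mem (n := 2) 𝓜.contDiffOn_act hz)
    (differentiableAt_of_mem 𝓜.contDiffOn_Ω hz) (differentiableAt_of_mem 𝓜.contDiffOn_Γ hz)
    (by filter_upwards [𝓜.isOpen_U.mem_nhds hz] with y hy using 𝓜.act_parallel y hy) u v a f

variable (𝓜) in
/-- The failure of the curvature condition, for the co-CR twistorial structure. -/
def curvatureDefect (z : B) (τ : H) (e f : F) : H :=
  (christoffelCurvature 𝓜.Ω z (𝓜.ρ z e) (𝓜.ρ z (𝓜.act z τ f)) τ +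
    christoffelCurvature 𝓜.Ω z (𝓜.ρ z (𝓜.act z τ e)) (𝓜.ρ z f) τ) -
  τ * (christoffelCurvature 𝓜.Ω z (𝓜.ρ z e) (𝓜.ρ z f) τ -
    christoffelCurvature 𝓜.Ω z (𝓜.ρ z (𝓜.act z τ e)) (𝓜.ρ z (𝓜.act z τ f)) τ)

lemma curvatureDefect_anticomm (hz : z ∈ 𝓜.U) (hτ : τ * τ = -1) (e f : F) :
    𝓜.curvatureDefect z τ e f * τ = -(τ * 𝓜.curvatureDefect z τ e f) := by
  unfold curvatureDefect
  simp only [sub_mul, add_mul, mul_sub, mul_add, curvature_Ω_anticomm hz hτ, mul_assoc, mul_neg]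
  abel

/-- The complexified Bianchi identity. -/
lemma curvatureDefect_cyclic (hz : z ∈ 𝓜.U) (hτ : τ * τ = -1) (e₁ e₂ e₃ : F) :
    ∃ v₁ v₂ : F, 𝓜.ρ z v₁ = 0 ∧ 𝓜.ρ z v₂ = 0 ∧
      𝓜.act z (τ * 𝓜.curvatureDefect z τ e₁ e₂) e₃ +
        𝓜.act z (τ * 𝓜.curvatureDefect z τ e₂ e₃) e₁ +
        𝓜.act z (τ * 𝓜.curvatureDefect z τ e₃ e₁) e₂ = v₂ + 𝓜.act z τ v₁ := by
  let J : F → F := 𝓜.act z τ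
  let S : F → F → F → F := fun e₁ e₂ e₃ ↦
    christoffelCurvature 𝓜.Γ z (𝓜.ρ z e₁) (𝓜.ρ z e₂) e₃ +
      christoffelCurvature 𝓜.Γ z (𝓜.ρ z e₂) (𝓜.ρ z e₃) e₁ +
      christoffelCurvature 𝓜.Γ z (𝓜.ρ z e₃) (𝓜.ρ z e₁) e₂
  have hS : ∀ e₁ e₂ e₃, 𝓜.ρ z (S e₁ e₂ e₃) = 0 := curvature_bianchi hz
  have hJ : ∀ f, 𝓜.act z τ (𝓜.act z τ f) = -f := fun f ↦ by
    rw [← 𝓜.act_mul z hz, hτ, (𝓜.act z).map_neg, clm_neg_apply, 𝓜.act_one z hz]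
  have hneg : ∀ u v f, christoffelCurvature 𝓜.Γ z u v (-f) =
      -christoffelCurvature 𝓜.Γ z u v f := by
    intro u v f
    unfold christoffelCurvature
    rw [(fderiv ℝ 𝓜.Γ z u v).map_neg, (fderiv ℝ 𝓜.Γ z v u).map_neg, (𝓜.Γ z u).map_neg,
      (𝓜.Γ z v).map_neg, (𝓜.Γ z u).map_neg, (𝓜.Γ z v).map_neg]
    abel
  -- Extend `S` complex linearly to the vectors `e + iJe`. Then `v₁` is minus the real part and `v₂`
  -- the imaginary part, so that `v₂ + Jv₁ = Im S - J Re S` measures the failure of `S` to lie in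
  -- `E^J`. Commuting the curvature with `J` turns it into the defects.
  refine ⟨-(S e₁ e₂ e₃ - S (J e₁) (J e₂) e₃ - S e₁ (J e₂) (J e₃) - S (J e₁) e₂ (J e₃)),
    S (J e₁) e₂ e₃ + S e₁ (J e₂) e₃ + S e₁ e₂ (J e₃) - S (J e₁) (J e₂) (J e₃), ?_, ?_, ?_⟩
  · simp only [(𝓜.ρ z).map_neg, (𝓜.ρ z).map_sub, hS, sub_zero, neg_zero]
  · simp only [(𝓜.ρ z).map_add, (𝓜.ρ z).map_sub, hS, add_zero, sub_zero]
  · simp only [S, J, curvatureDefect, (𝓜.act z τ).map_neg, (𝓜.act z τ).map_sub,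
      (𝓜.act z τ).map_add, mul_sub, mul_add, ← mul_assoc, hτ, neg_mul, one_mul,
      (𝓜.act z).map_sub, (𝓜.act z).map_add, (𝓜.act z).map_neg, clm_sub_apply, clm_add_apply,
      clm_neg_apply, curvature_act hz, ← 𝓜.act_mul z hz, 𝓜.act_one z hz]
    abel

lemma curvatureCondition_coCR (h : ∀ e f, 𝓜.curvatureDefect z τ e f = 0) :
    𝓜.CurvatureCondition 𝓜.coCRSpace z τ := by
  rintro ⟨_, _⟩ ⟨e, rfl, rfl⟩ ⟨_, _⟩ ⟨f, rfl, rfl⟩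
  exact sub_eq_zero.1 (h e f)

/-- The lift to `E^J` is `ι x.1` itself. -/
lemma crSpace_subset (hz : z ∈ 𝓜.U) : 𝓜.crSpace z τ ⊆ 𝓜.coCRSpace z τ := fun x hx ↦
  ⟨𝓜.ι z x.1, (𝓜.ρ_ι z hz _).symm, by rw [show 𝓜.act z τ (𝓜.ι z x.1) = _ from hx, 𝓜.ρ_ι z hz]⟩

variable (𝓜) in
/-- The fibre of `V`. -/
def V (z : B) : Submodule ℝ F := LinearMap.ker (𝓜.ρ z : F →ₗ[ℝ] B)

lemma mem_V {v : F} : v ∈ 𝓜.V z ↔ 𝓜.ρ z v = 0 := Iff.rfl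

variable (𝓜) in
/-- The linear complex structure determined by `τ`, as a linear map. -/
def actₗ (z : B) (τ : H) : F →ₗ[ℝ] F := (𝓜.act z τ : F →ₗ[ℝ] F)

lemma actₗ_apply (f : F) : 𝓜.actₗ z τ f = 𝓜.act z τ f := rfl

lemma act_act_of_sq (hz : z ∈ 𝓜.U) (hτ : τ * τ = -1) (f : F) :
    𝓜.act z τ (𝓜.act z τ f) = -f := by
  rw [← 𝓜.act_mul z hz, hτ, (𝓜.act z).map_neg, clm_neg_apply, 𝓜.act_one z hz]

/-- The fibres of `V` and `TM` meet only in zero. -/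
lemma eq_zero_of_mem_V {v w : F} (hv : v ∈ 𝓜.V z)
    (hw : 𝓜.ι z (𝓜.ρ z w) = w) (h : v + w = 0) : v = 0 := by
  have h1 := congrArg (𝓜.ρ z) h
  rw [(𝓜.ρ z).map_add, mem_V.1 hv, zero_add, (𝓜.ρ z).map_zero] at h1
  rw [h1, (𝓜.ι z).map_zero] at hw
  rw [← hw, add_zero] at h
  exact h

variable [FiniteDimensional ℝ F]

/-- The sum `V + iV + jV + ijV` is direct: `i`, `j` and `ij` map `V` into `TM`, which meets `V`
trivially. Applying `i`, then `j`, to a relation moves one more of its terms into `V`, where it must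
vanish. -/
lemma four_mul_finrank_V_le (hH : IsQuaternionic H) (hz : z ∈ 𝓜.U) :
    4 * finrank ℝ (𝓜.V z) ≤ finrank ℝ F := by
  obtain ⟨i, j, hi, hj, hij⟩ := hH.exists_basis
  have hk : (i * j) * (i * j) = -1 := by
    rw [mul_assoc, ← mul_assoc j, ← neg_eq_iff_eq_neg.2 hij, neg_mul, mul_neg, mul_assoc,
      hj, mul_neg, mul_one, mul_neg, hi, neg_neg]
  have hV := fun (τ : H) (hτ : τ * τ = -1) (v : 𝓜.V z) ↦ 𝓜.act_mem z hz τ hτ v v.2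
  let Ψ : (𝓜.V z × 𝓜.V z) × (𝓜.V z × 𝓜.V z) →ₗ[ℝ] F :=
    ((𝓜.V z).subtype.coprod (𝓜.actₗ z i ∘ₗ (𝓜.V z).subtype)).coprod
      ((𝓜.actₗ z j ∘ₗ (𝓜.V z).subtype).coprod (𝓜.actₗ z (i * j) ∘ₗ (𝓜.V z).subtype))
  have hΨ : ∀ v, Ψ v = (v.1.1 : F) + 𝓜.act z i v.1.2 +
      (𝓜.act z j v.2.1 + 𝓜.act z (i * j) v.2.2) := fun v ↦ rfl
  have hinj : Function.Injective Ψ := by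
    rw [← LinearMap.ker_eq_bot, LinearMap.ker_eq_bot']
    rintro ⟨⟨v₀, v₁⟩, ⟨v₂, v₃⟩⟩ h
    rw [hΨ] at h
    simp only at h
    have h0 : (v₀ : F) = 0 := by
      refine eq_zero_of_mem_V (w := 𝓜.act z i v₁ + (𝓜.act z j v₂ + 𝓜.act z (i * j) v₃)) v₀.2
        ?_ (by rw [← h]; abel)
      rw [(𝓜.ρ z).map_add, (𝓜.ρ z).map_add, (𝓜.ι z).map_add, (𝓜.ι z).map_add, hV i hi, hV j hj,
        hV _ hk]
    rw [h0, zero_add] at h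
    have h1 : (v₁ : F) = 0 := by
      have h' := congrArg (𝓜.act z i) h
      rw [(𝓜.act z i).map_add, (𝓜.act z i).map_add, act_act_of_sq hz hi, ← 𝓜.act_mul z hz,
        ← 𝓜.act_mul z hz, ← mul_assoc, hi, neg_one_mul, (𝓜.act z).map_neg, clm_neg_apply,
        (𝓜.act z i).map_zero] at h'
      refine eq_zero_of_mem_V (w := -𝓜.act z (i * j) v₂ + 𝓜.act z j v₃) v₁.2
        ?_ (by rw [← neg_zero, ← h']; abel)
      rw [(𝓜.ρ z).map_add, (𝓜.ρ z).map_neg, (𝓜.ι z).map_add, (𝓜.ι z).map_neg, hV j hj, hV _ hk]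
    rw [h1, (𝓜.act z i).map_zero, zero_add] at h
    have h' := congrArg (𝓜.act z j) h
    rw [(𝓜.act z j).map_add, act_act_of_sq hz hj, ← 𝓜.act_mul z hz, ← mul_assoc,
      ← neg_eq_iff_eq_neg.2 hij, neg_mul, mul_assoc, hj, mul_neg, mul_one, neg_neg,
      (𝓜.act z j).map_zero] at h'
    have h2 : (v₂ : F) = 0 := by
      refine eq_zero_of_mem_V (w := -𝓜.act z i v₃) v₂.2 ?_ (by rw [← neg_zero, ← h']; abel)
      rw [(𝓜.ρ z).map_neg, (𝓜.ι z).map_neg, hV i hi]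
    rw [h2, neg_zero, zero_add] at h'
    have h3 : (v₃ : F) = 0 := by
      rw [← neg_eq_zero, ← act_act_of_sq hz hi, h', (𝓜.act z i).map_zero]
    simp only [ZeroMemClass.coe_eq_zero] at h0 h1 h2 h3
    rw [h0, h1, h2, h3]; rfl
  have := LinearMap.finrank_le_finrank_of_injective hinj
  rw [finrank_prod, finrank_prod] at this
  omega

/-- A nonzero quaternion `d` is invertible, so the cyclic identity can be solved for `e₃`. An
arbitrary vector is then in `V + JV + Qe₁ + Qe₂`, of dimension at most `2 dim V + 4`. -/
lemma finrank_le_of_curvatureDefect_ne_zero (hH : IsQuaternionic H) (hz : z ∈ 𝓜.U)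
    (hτ : τ * τ = -1) {e₁ e₂ : F} (h : 𝓜.curvatureDefect z τ e₁ e₂ ≠ 0) :
    finrank ℝ F ≤ 2 * finrank ℝ (𝓜.V z) + 4 := by
  have : FiniteDimensional ℝ H := .of_finrank_pos (by rw [hH.finrank_eq]; norm_num)
  set d := τ * 𝓜.curvatureDefect z τ e₁ e₂ with hd
  have hd0 : d ≠ 0 := fun h0 ↦ h <| by
    have := congrArg (τ * ·) (hd.symm.trans h0)
    simpa [← mul_assoc, hτ] using this
  obtain ⟨b, hb⟩ := hH.exists_mul_eq_one d hd0
  let Q := anticommSubmodule H τ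
  let Ψ : (𝓜.V z × 𝓜.V z) × (Q × Q) →ₗ[ℝ] F :=
    ((𝓜.V z).subtype.coprod (𝓜.actₗ z τ ∘ₗ (𝓜.V z).subtype)).coprod
      ((LinearMap.coprod
        ((ContinuousLinearMap.apply ℝ F e₁ : (F →L[ℝ] F) →ₗ[ℝ] F) ∘ₗ
          (𝓜.act z : H →ₗ[ℝ] F →L[ℝ] F) ∘ₗ Q.subtype)
        ((ContinuousLinearMap.apply ℝ F e₂ : (F →L[ℝ] F) →ₗ[ℝ] F) ∘ₗ
          (𝓜.act z : H →ₗ[ℝ] F →L[ℝ] F) ∘ₗ Q.subtype)))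
  have hΨ : ∀ v, Ψ v = (v.1.1 : F) + 𝓜.act z τ v.1.2 +
      (𝓜.act z v.2.1 e₁ + 𝓜.act z v.2.2 e₂) := fun v ↦ rfl
  have hQ : ∀ e f, -(τ * 𝓜.curvatureDefect z τ e f) ∈ Q := fun e f ↦ by
    have := curvatureDefect_anticomm hz hτ e f
    change -(τ * 𝓜.curvatureDefect z τ e f) * τ = -(τ * -(τ * 𝓜.curvatureDefect z τ e f))
    rw [neg_mul, mul_assoc, this]
  have hsurj : Function.Surjective Ψ := by
    intro f
    -- Taking `e₃ = b f` with `d * b = 1` makes the first term of the identity equal to `f`.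
    obtain ⟨v₁, v₂, h₁, h₂, hv⟩ := curvatureDefect_cyclic hz hτ e₁ e₂ (𝓜.act z b f)
    refine ⟨((⟨v₂, h₂⟩, ⟨v₁, h₁⟩), (⟨_, hQ e₂ (𝓜.act z b f)⟩, ⟨_, hQ (𝓜.act z b f) e₁⟩)), ?_⟩
    rw [hΨ]
    simp only
    rw [← hv, ← hd, ← 𝓜.act_mul z hz d b, hb, 𝓜.act_one z hz, (𝓜.act z).map_neg,
      (𝓜.act z).map_neg, clm_neg_apply, clm_neg_apply]
    abel
  have h1 := LinearMap.finrank_le_finrank_of_surjective hsurj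
  have h2 : finrank ℝ Q ≤ 2 := finrank_anticommSubmodule_le hH hτ
  rw [finrank_prod, finrank_prod, finrank_prod] at h1
  omega

/-- The curvature condition for the co-CR twistorial structure. -/
theorem curvatureCondition_coCR_of_finrank (hH : IsQuaternionic H) (hz : z ∈ 𝓜.U)
    (hτ : τ * τ = -1) {k l : ℕ} (hk : finrank ℝ F = 4 * k) (hl : finrank ℝ (𝓜.V z) = l)
    (h₀ : (k, l) ≠ (1, 0)) (h₁ : (k, l) ≠ (1, 1)) (h₂ : (k, l) ≠ (2, 2)) :
    𝓜.CurvatureCondition 𝓜.coCRSpace z τ := by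
  refine curvatureCondition_coCR fun e f ↦ ?_
  by_contra h
  have a := four_mul_finrank_V_le (𝓜 := 𝓜) hH hz
  have b := finrank_le_of_curvatureDefect_ne_zero hH hz hτ h
  rw [hk, hl] at a b
  -- The inequalities `l ≤ k` and `4k ≤ 2l + 4` do not exclude `k = 0`; in that case the fibre is
  -- zero and so are all curvature terms. Otherwise `k` is `1` or `2`, and `k = 2` forces `l = 2`.
  have hne : k ≠ 0 := by
    rintro rfl
    have : Subsingleton F := by
      rw [← finrank_zero_iff (R := ℝ)]; omega
    refine h ?_
    unfold curvatureDefect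
    have hc : ∀ (g : F) (v : B), christoffelCurvature 𝓜.Ω z (𝓜.ρ z g) v τ = 0 := fun g v ↦ by
      rw [Subsingleton.elim g ((0 : ℝ) • g), (𝓜.ρ z).map_smul, christoffelCurvature_smul_left,
        zero_smul]
    rw [hc, hc, hc, hc, sub_self, mul_zero, add_zero, sub_zero]
  have hk2 : k = 1 ∨ k = 2 := by omega
  obtain rfl | rfl := hk2
  · obtain rfl | rfl : l = 0 ∨ l = 1 := by omega
    exacts [h₀ rfl, h₁ rfl]
  · obtain rfl : l = 2 := by omega
    exact h₂ rfl

/-- The curvature condition for the CR twistorial structure, when `E` is a quaternionic line bundle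
and `V` is a real line bundle. -/
theorem curvatureCondition_CR_one_one (hz : z ∈ 𝓜.U)
    (hτ : τ * τ = -1) (hk : finrank ℝ F = 4) (hl : finrank ℝ (𝓜.V z) = 1) :
    𝓜.CurvatureCondition 𝓜.crSpace z τ := by
  rintro ⟨x₁, x₂⟩ hx ⟨y₁, y₂⟩ hy
  simp only
  have hx : 𝓜.act z τ (𝓜.ι z x₁) = 𝓜.ι z x₂ := hx
  have hy : 𝓜.act z τ (𝓜.ι z y₁) = 𝓜.ι z y₂ := hy
  have hρ := 𝓜.ρ_ι z hz
  have hJ := act_act_of_sq hz hτ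
  by_cases hx0 : x₁ = 0
  · have hx2 : x₂ = 0 := by
      rw [hx0, (𝓜.ι z).map_zero, (𝓜.act z τ).map_zero] at hx
      rw [← hρ x₂, ← hx, (𝓜.ρ z).map_zero]
    have hc : ∀ v : B, christoffelCurvature 𝓜.Ω z 0 v τ = 0 := fun v ↦ by
      rw [← zero_smul ℝ (0 : B), christoffelCurvature_smul_left, zero_smul]
    rw [hx0, hx2, hc, hc, sub_self, mul_zero, add_zero]
  have hιx : 𝓜.ι z x₁ ≠ 0 := fun h ↦ hx0 (by rw [← hρ x₁, h, (𝓜.ρ z).map_zero])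
  obtain ⟨v, hv0⟩ : ∃ v : 𝓜.V z, v ≠ 0 := by
    have : Nontrivial (𝓜.V z) := nontrivial_of_finrank_pos (R := ℝ) (by omega)
    exact exists_ne 0
  have hv0 : (v : F) ≠ 0 := fun h ↦ hv0 (Subtype.ext h)
  have hv := 𝓜.act_mem z hz τ hτ v v.2
  let R := LinearMap.range (𝓜.ι z : B →ₗ[ℝ] F)
  -- The largest `J`-stable subspace of `TM`. It is disjoint from the plane spanned by `v` and `Jv`,
  -- so its dimension is at most `4 - 2 = 2`, and it is spanned by `ι x₁` and `J ι x₁`.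
  let P := R ⊓ R.comap (𝓜.actₗ z τ)
  have hmem : ∀ {a b : B}, 𝓜.act z τ (𝓜.ι z a) = 𝓜.ι z b → 𝓜.ι z a ∈ P := fun {a b} h ↦
    ⟨⟨a, rfl⟩, ⟨b, h.symm⟩⟩
  have hPJ : ∀ {f}, f ∈ P → 𝓜.act z τ f ∈ P := fun {f} h ↦
    ⟨h.2, by
      change 𝓜.act z τ (𝓜.act z τ f) ∈ R
      rw [hJ]
      exact R.neg_mem h.1⟩
  have hdisj : Disjoint P (Submodule.span ℝ {(v : F), 𝓜.actₗ z τ v}) := by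
    rw [Submodule.disjoint_def]
    intro f hf hf'
    obtain ⟨s, t, rfl⟩ := Submodule.mem_span_pair.1 hf'
    have hR : ∀ {s t : ℝ}, s • (v : F) + t • 𝓜.actₗ z τ v ∈ R → s = 0 := by
      rintro s t ⟨b, hb⟩
      have : s • (v : F) + (t • 𝓜.act z τ v - 𝓜.ι z b) = 0 := by
        rw [← add_sub_assoc, sub_eq_zero]; exact hb.symm
      have := eq_zero_of_mem_V ((𝓜.V z).smul_mem s v.2) (by
        rw [(𝓜.ρ z).map_sub, (𝓜.ι z).map_sub, hρ, (𝓜.ρ z).map_smul, (𝓜.ι z).map_smul, hv]) this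
      exact (smul_eq_zero.1 this).resolve_right hv0
    have hs := hR hf.1
    have ht : -t = 0 := by
      refine hR (t := s) ?_
      have h2 : 𝓜.act z τ (s • (v : F) + t • 𝓜.act z τ v) ∈ R := hf.2
      rw [(𝓜.act z τ).map_add, (𝓜.act z τ).map_smul, (𝓜.act z τ).map_smul, hJ, smul_neg,
        ← neg_smul, add_comm] at h2
      exact h2
    rw [hs, neg_eq_zero.1 ht, zero_smul, zero_smul, add_zero]
  have h2 := finrank_span_pair_of_sq (𝓜.actₗ z τ) hJ hv0
  have h3 := finrank_span_pair_of_sq (𝓜.actₗ z τ) hJ hιx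
  have h4 := Submodule.finrank_add_finrank_le_of_disjoint hdisj
  have hle : Submodule.span ℝ {𝓜.ι z x₁, 𝓜.actₗ z τ (𝓜.ι z x₁)} ≤ P := by
    rw [Submodule.span_le]
    rintro f (rfl | rfl)
    · exact hmem hx
    · exact hPJ (hmem hx)
  have heq := Submodule.eq_of_le_of_finrank_le hle (by omega)
  have hy' := hmem hy
  rw [← heq] at hy'
  obtain ⟨s, t, hst⟩ := Submodule.mem_span_pair.1 hy'
  rw [actₗ_apply] at hst
  -- In complex terms `y = (s - it) x`, hence `R(x, y) = (s - it) R(x, x) = 0`: both sides of the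
  -- condition vanish.
  have e1 : y₁ = s • x₁ + t • x₂ := by
    rw [← hρ y₁, ← hst, hx, (𝓜.ρ z).map_add, (𝓜.ρ z).map_smul, (𝓜.ρ z).map_smul, hρ, hρ]
  have e2 : y₂ = s • x₂ + (-t) • x₁ := by
    rw [← hρ y₂, ← hy, ← hst, (𝓜.act z τ).map_add, (𝓜.act z τ).map_smul, (𝓜.act z τ).map_smul,
      hJ, hx, (𝓜.ρ z).map_add, (𝓜.ρ z).map_smul, (𝓜.ρ z).map_smul, (𝓜.ρ z).map_neg, hρ, hρ,
      smul_neg, neg_smul]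
  have hself : ∀ x, christoffelCurvature 𝓜.Ω z x x τ = 0 := fun x ↦ by
    unfold christoffelCurvature; abel
  rw [e1, e2]
  simp only [christoffelCurvature_add_right, christoffelCurvature_smul_right, hself]
  rw [christoffelCurvature_swap 𝓜.Ω z x₂ x₁]
  simp only [smul_zero, smul_neg, neg_smul, neg_neg, zero_add, add_zero, add_neg_cancel, sub_self,
    mul_zero]

end LocalFQuaternionicModel

/-! ### Sections of vector bundles in a chart and a trivialisation. -/

section SectionCoordinates

variable {B : Type*} [NormedAddCommGroup B] [NormedSpace ℝ B]
  {M : Type*} [TopologicalSpace M] [ChartedSpace B M] [IsManifold 𝓘(ℝ, B) ∞ M]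
  {F : Type*} [NormedAddCommGroup F] [NormedSpace ℝ F]
  {E : M → Type*} [∀ x, AddCommGroup (E x)] [∀ x, Module ℝ (E x)] [∀ x, TopologicalSpace (E x)]
  [TopologicalSpace (TotalSpace F E)] [FiberBundle F E] [VectorBundle ℝ F E]
  [ContMDiffVectorBundle ∞ F E 𝓘(ℝ, B)]

variable (F E) in
/-- The open set on which both the chart and the preferred trivialization at `x₀` are defined. -/
def chartDomain (x₀ : M) : Set M := (chartAt B x₀).source ∩ (trivializationAt F E x₀).baseSet

variable (F) in
/-- The linear coordinates on the fibre of `E` at `x`. -/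
def fibreCoord (x₀ x : M) : E x →ₗ[ℝ] F := (trivializationAt F E x₀).linearMapAt ℝ x

variable (F) in
/-- The coordinates of a section of `E`, in the chart and in the preferred trivialization at
`x₀`. -/
def sectionCoord (x₀ : M) (s : Π x, E x) (z : B) : F :=
  fibreCoord F x₀ _ (s ((extChartAt 𝓘(ℝ, B) x₀).symm z))

/-- The sections which are constant in the preferred trivialization at `x₀`. -/
def constSection (E : M → Type*) [∀ x, AddCommGroup (E x)] [∀ x, Module ℝ (E x)]
    [∀ x, TopologicalSpace (E x)]
    [TopologicalSpace (TotalSpace F E)] [FiberBundle F E] [VectorBundle ℝ F E]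
    (x₀ : M) (f : F) (x : M) : E x := (trivializationAt F E x₀).symmₗ ℝ x f

lemma fibreCoord_apply {x₀ x : M} (hx : x ∈ (trivializationAt F E x₀).baseSet) (v : E x) :
    fibreCoord F x₀ x v = (trivializationAt F E x₀ ⟨x, v⟩).2 := by
  unfold fibreCoord
  rw [Trivialization.linearMapAt_apply, if_pos hx]

lemma fibreCoord_constSection {x₀ x : M} (hx : x ∈ (trivializationAt F E x₀).baseSet) (f : F) :
    fibreCoord F x₀ x (constSection E x₀ f x) = f :=
  Trivialization.linearMapAt_symmₗ _ hx f

lemma constSection_fibreCoord {x₀ x : M} (hx : x ∈ (trivializationAt F E x₀).baseSet) (v : E x) :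
    constSection E x₀ (fibreCoord F x₀ x v) x = v :=
  Trivialization.symmₗ_linearMapAt _ hx v

lemma constSection_add (x₀ : M) (f g : F) :
    constSection E x₀ (f + g) = constSection E x₀ f + constSection E x₀ g :=
  funext fun x ↦ map_add ((trivializationAt F E x₀).symmₗ ℝ x) f g

lemma constSection_smul (x₀ : M) (r : ℝ) (f : F) :
    constSection E x₀ (r • f) = r • constSection E x₀ f :=
  funext fun x ↦ map_smul ((trivializationAt F E x₀).symmₗ ℝ x) r f

lemma fibreCoord_injective {x₀ x : M} (hx : x ∈ (trivializationAt F E x₀).baseSet) :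
    Function.Injective (fibreCoord F x₀ x : E x →ₗ[ℝ] F) := fun v w h ↦ by
  rw [← constSection_fibreCoord hx v, h, constSection_fibreCoord hx]

lemma isOpen_chartDomain (x₀ : M) : IsOpen (chartDomain (B := B) F E x₀) :=
  (chartAt B x₀).open_source.inter (trivializationAt F E x₀).open_baseSet

lemma contMDiffOn_constSection (x₀ : M) (f : F) :
    ContMDiffOn 𝓘(ℝ, B) (𝓘(ℝ, B).prod 𝓘(ℝ, F)) ∞
      (fun x ↦ TotalSpace.mk' F x (constSection E x₀ f x)) (trivializationAt F E x₀).baseSet := by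
  rw [Trivialization.contMDiffOn_section_baseSet_iff]
  refine (contMDiffOn_const (c := f)).congr fun x hx ↦ ?_
  rw [← fibreCoord_apply hx, fibreCoord_constSection hx]

lemma contMDiffAt_constSection {x₀ x : M} (hx : x ∈ (trivializationAt F E x₀).baseSet) (f : F) :
    ContMDiffAt 𝓘(ℝ, B) (𝓘(ℝ, B).prod 𝓘(ℝ, F)) ∞
      (fun x ↦ TotalSpace.mk' F x (constSection E x₀ f x)) x :=
  (contMDiffOn_constSection x₀ f).contMDiffAt ((trivializationAt F E x₀).open_baseSet.mem_nhds hx)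

lemma mdifferentiableAt_constSection {x₀ x : M} (hx : x ∈ (trivializationAt F E x₀).baseSet)
    (f : F) : MDifferentiableAt 𝓘(ℝ, B) (𝓘(ℝ, B).prod 𝓘(ℝ, F))
      (fun x ↦ TotalSpace.mk' F x (constSection E x₀ f x)) x :=
  (contMDiffAt_constSection hx f).mdifferentiableAt (by simp)

lemma contMDiffAt_section_iff_fibreCoord {x₀ x : M} {n : ℕ∞ω} [ContMDiffVectorBundle n F E 𝓘(ℝ, B)]
    (hx : x ∈ (trivializationAt F E x₀).baseSet) {s : Π x, E x} :
    ContMDiffAt 𝓘(ℝ, B) (𝓘(ℝ, B).prod 𝓘(ℝ, F)) n (fun x ↦ TotalSpace.mk' F x (s x)) x ↔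
      ContMDiffAt 𝓘(ℝ, B) 𝓘(ℝ, F) n (fun x ↦ fibreCoord F x₀ x (s x)) x := by
  rw [Trivialization.contMDiffAt_section_iff _ hx]
  refine Filter.EventuallyEq.contMDiffAt_iff ?_
  filter_upwards [(trivializationAt F E x₀).open_baseSet.mem_nhds hx] with y hy
  rw [fibreCoord_apply hy]

lemma mdifferentiableAt_section_iff_fibreCoord {x₀ x : M}
    (hx : x ∈ (trivializationAt F E x₀).baseSet) {s : Π x, E x} :
    MDifferentiableAt 𝓘(ℝ, B) (𝓘(ℝ, B).prod 𝓘(ℝ, F)) (fun x ↦ TotalSpace.mk' F x (s x)) x ↔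
      MDifferentiableAt 𝓘(ℝ, B) 𝓘(ℝ, F) (fun x ↦ fibreCoord F x₀ x (s x)) x := by
  rw [Trivialization.mdifferentiableAt_section_iff _ _ _ hx]
  refine Filter.EventuallyEq.mdifferentiableAt_iff ?_
  filter_upwards [(trivializationAt F E x₀).open_baseSet.mem_nhds hx] with y hy
  rw [fibreCoord_apply hy]

/-- The image of an open set under a chart. -/
lemma mem_chart_target_of_mem {x₀ x : M} (hx : x ∈ (chartAt B x₀).source) :
    extChartAt 𝓘(ℝ, B) x₀ x ∈ (extChartAt 𝓘(ℝ, B) x₀).target :=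
  (extChartAt 𝓘(ℝ, B) x₀).map_source (by rwa [extChartAt_source])

lemma chart_symm_apply {x₀ x : M} (hx : x ∈ (chartAt B x₀).source) :
    (extChartAt 𝓘(ℝ, B) x₀).symm (extChartAt 𝓘(ℝ, B) x₀ x) = x :=
  (extChartAt 𝓘(ℝ, B) x₀).left_inv (by rwa [extChartAt_source])

lemma contMDiffAt_chart_symm {x₀ x : M} (hx : x ∈ (chartAt B x₀).source) :
    ContMDiffAt 𝓘(ℝ, B) 𝓘(ℝ, B) ∞ (extChartAt 𝓘(ℝ, B) x₀).symm (extChartAt 𝓘(ℝ, B) x₀ x) :=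
  (contMDiffOn_extChartAt_symm x₀).contMDiffAt
    ((isOpen_extChartAt_target x₀).mem_nhds (mem_chart_target_of_mem hx))

lemma contDiffAt_sectionCoord {x₀ x : M} (hx : x ∈ chartDomain (B := B) F E x₀) {s : Π x, E x}
    (hs : ContMDiffAt 𝓘(ℝ, B) (𝓘(ℝ, B).prod 𝓘(ℝ, F)) ∞ (fun x ↦ TotalSpace.mk' F x (s x)) x) :
    ContDiffAt ℝ ∞ (sectionCoord F x₀ s) (extChartAt 𝓘(ℝ, B) x₀ x) := by
  rw [contMDiffAt_section_iff_fibreCoord hx.2] at hs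
  rw [← contMDiffAt_iff_contDiffAt]
  refine ContMDiffAt.comp (g := fun x ↦ fibreCoord F x₀ x (s x)) _ ?_
    (contMDiffAt_chart_symm hx.1)
  rwa [chart_symm_apply hx.1]

lemma differentiableAt_sectionCoord {x₀ x : M} (hx : x ∈ chartDomain (B := B) F E x₀)
    {s : Π x, E x}
    (hs : MDifferentiableAt 𝓘(ℝ, B) (𝓘(ℝ, B).prod 𝓘(ℝ, F)) (fun x ↦ TotalSpace.mk' F x (s x)) x) :
    DifferentiableAt ℝ (sectionCoord F x₀ s) (extChartAt 𝓘(ℝ, B) x₀ x) := by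
  rw [mdifferentiableAt_section_iff_fibreCoord hx.2] at hs
  rw [← mdifferentiableAt_iff_differentiableAt]
  refine MDifferentiableAt.comp (g := fun x ↦ fibreCoord F x₀ x (s x))  (I' := 𝓘(ℝ, B)) _ ?_
    ((contMDiffAt_chart_symm hx.1).mdifferentiableAt (by simp))
  rwa [chart_symm_apply hx.1]

/-- The coordinates on the tangent bundle are given by the differential of the chart. -/
lemma fibreCoord_tangentSpace {x₀ x : M} (hx : x ∈ (chartAt B x₀).source)
    (X : TangentSpace 𝓘(ℝ, B) x) :
    fibreCoord B x₀ x X = mfderiv 𝓘(ℝ, B) 𝓘(ℝ, B) (extChartAt 𝓘(ℝ, B) x₀) x X := by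
  rw [← TangentBundle.continuousLinearMapAt_trivializationAt hx]
  rfl

lemma mem_baseSet_tangentSpace {x₀ x : M} :
    x ∈ (trivializationAt B (TangentSpace 𝓘(ℝ, B) : M → Type _) x₀).baseSet ↔ x ∈ (chartAt B x₀).source := Iff.rfl

lemma mfderiv_fibreCoord {x₀ x : M} (hx : x ∈ chartDomain (B := B) F E x₀) {s : Π x, E x}
    (hs : MDifferentiableAt 𝓘(ℝ, B) (𝓘(ℝ, B).prod 𝓘(ℝ, F)) (fun x ↦ TotalSpace.mk' F x (s x)) x)
    (X : TangentSpace 𝓘(ℝ, B) x) :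
    mvfderiv 𝓘(ℝ, B) (fun x ↦ fibreCoord F x₀ x (s x)) x X =
      fderiv ℝ (sectionCoord F x₀ s) (extChartAt 𝓘(ℝ, B) x₀ x) (fibreCoord B x₀ x X) := by
  have h1 : (fun x ↦ fibreCoord F x₀ x (s x)) =ᶠ[𝓝 x]
      sectionCoord F x₀ s ∘ extChartAt 𝓘(ℝ, B) x₀ := by
    filter_upwards [(chartAt B x₀).open_source.mem_nhds hx.1] with y hy
    unfold sectionCoord
    rw [Function.comp_apply, chart_symm_apply hy]
  have hd := (differentiableAt_sectionCoord hx hs).mdifferentiableAt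
  rw [fibreCoord_tangentSpace hx.1]
  unfold mvfderiv
  rw [h1.mfderiv_eq, mfderiv_comp (I' := 𝓘(ℝ, B)) x hd
    (mdifferentiableAt_extChartAt hx.1), mfderiv_eq_fderiv]
  rfl

lemma sectionCoord_apply {x₀ x : M} (hx : x ∈ (chartAt B x₀).source) (s : Π x, E x) :
    sectionCoord F x₀ s (extChartAt 𝓘(ℝ, B) x₀ x) = fibreCoord F x₀ x (s x) := by
  unfold sectionCoord
  rw [chart_symm_apply hx]

lemma sectionCoord_constSection_eventuallyEq {x₀ x : M} (hx : x ∈ chartDomain (B := B) F E x₀)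
    (f : F) :
    sectionCoord F x₀ (constSection E x₀ f) =ᶠ[𝓝 (extChartAt 𝓘(ℝ, B) x₀ x)] fun _ ↦ f := by
  have hc := (contMDiffAt_chart_symm hx.1).continuousAt
  have := hc.preimage_mem_nhds (t := (trivializationAt F E x₀).baseSet) (by
    rw [chart_symm_apply hx.1]
    exact (trivializationAt F E x₀).open_baseSet.mem_nhds hx.2)
  filter_upwards [this] with y hy
  exact fibreCoord_constSection hy f

lemma fderiv_sectionCoord_constSection {x₀ x : M} (hx : x ∈ chartDomain (B := B) F E x₀)
    (f : F) :
    fderiv ℝ (sectionCoord F x₀ (constSection E x₀ f)) (extChartAt 𝓘(ℝ, B) x₀ x) = 0 := by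
  rw [(sectionCoord_constSection_eventuallyEq hx f).fderiv_eq, fderiv_fun_const]; rfl

lemma eventually_symm_mem_chartDomain {x₀ x : M} (hx : x ∈ chartDomain (B := B) F E x₀) :
    ∀ᶠ z in 𝓝 (extChartAt 𝓘(ℝ, B) x₀ x), z ∈ (extChartAt 𝓘(ℝ, B) x₀).target ∧
      (extChartAt 𝓘(ℝ, B) x₀).symm z ∈ chartDomain (B := B) F E x₀ := by
  have hc := (contMDiffAt_chart_symm hx.1).continuousAt
  have := hc.preimage_mem_nhds (t := chartDomain (B := B) F E x₀) (by
    rw [chart_symm_apply hx.1]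
    exact (isOpen_chartDomain x₀).mem_nhds hx)
  filter_upwards [this, (isOpen_extChartAt_target x₀).mem_nhds (mem_chart_target_of_mem hx.1)]
    with z hz hz' using ⟨hz', hz⟩

end SectionCoordinates

/-! ### Christoffel symbols and their smoothness. -/

section Christoffel

variable {B : Type*} [NormedAddCommGroup B] [NormedSpace ℝ B] [FiniteDimensional ℝ B]
  {M : Type*} [TopologicalSpace M] [ChartedSpace B M] [IsManifold 𝓘(ℝ, B) ∞ M]
  {F : Type*} [NormedAddCommGroup F] [NormedSpace ℝ F] [FiniteDimensional ℝ F]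
  {E : M → Type*} [∀ x, AddCommGroup (E x)] [∀ x, Module ℝ (E x)] [∀ x, TopologicalSpace (E x)]
  [∀ x, IsTopologicalAddGroup (E x)] [∀ x, ContinuousSMul ℝ (E x)]
  [TopologicalSpace (TotalSpace F E)] [FiberBundle F E] [VectorBundle ℝ F E]
  [ContMDiffVectorBundle ∞ F E 𝓘(ℝ, B)] (nabla : CovariantDerivative 𝓘(ℝ, B) F E)

/-- The covariant derivative, in coordinates. -/
lemma fibreCoord_nabla {x₀ x : M} (hx : x ∈ chartDomain (B := B) F E x₀) {s : Π x, E x}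
    (hs : MDifferentiableAt 𝓘(ℝ, B) (𝓘(ℝ, B).prod 𝓘(ℝ, F)) (fun x ↦ TotalSpace.mk' F x (s x)) x)
    (X : TangentSpace 𝓘(ℝ, B) x) :
    fibreCoord F x₀ x (nabla s x X) =
      fderiv ℝ (sectionCoord F x₀ s) (extChartAt 𝓘(ℝ, B) x₀ x) (fibreCoord B x₀ x X) +
        fibreCoord F x₀ x (nabla (constSection E x₀ (fibreCoord F x₀ x (s x))) x X) := by
  have hcov := nabla.isCovariantDerivativeOn (s := Set.univ)
  -- The difference between `∇` and the derivative of the coordinates is tensorial. So `s` may be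
  -- replaced by the constant section with the same value at `x`, whose coordinates have zero
  -- derivative.
  let Φ : (Π x, E x) → F := fun s ↦ fibreCoord F x₀ x (nabla s x X) -
    mvfderiv 𝓘(ℝ, B) (fun x ↦ fibreCoord F x₀ x (s x)) x X
  have hΦ : TensorialAt 𝓘(ℝ, B) F Φ x := by
    constructor
    · intro g σ hg hσ
      have hσ' := (mdifferentiableAt_section_iff_fibreCoord hx.2).1 hσ
      have e1 : (fun x ↦ fibreCoord F x₀ x ((g • σ) x)) =
          g • (fun x ↦ fibreCoord F x₀ x (σ x)) := funext fun y ↦ map_smul _ _ _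
      simp only [Φ]
      rw [e1, mvfderiv_smul hg hσ', hcov.leibniz hσ hg]
      simp only [add_apply, smul_apply,
        ContinuousLinearMap.smulRight_apply, map_add, map_smul, smul_sub]
      abel
    · intro σ σ' hσ hσ'
      have h1 := (mdifferentiableAt_section_iff_fibreCoord hx.2).1 hσ
      have h2 := (mdifferentiableAt_section_iff_fibreCoord hx.2).1 hσ'
      have e1 : (fun x ↦ fibreCoord F x₀ x ((σ + σ') x)) =
          (fun x ↦ fibreCoord F x₀ x (σ x)) + (fun x ↦ fibreCoord F x₀ x (σ' x)) :=
        funext fun y ↦ map_add _ _ _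
      simp only [Φ]
      rw [e1, mvfderiv_add h1 h2, hcov.add hσ hσ']
      simp only [add_apply, map_add]
      abel
  have hc := mdifferentiableAt_constSection (B := B) hx.2 (fibreCoord F x₀ x (s x))
  have := hΦ.pointwise hs hc (constSection_fibreCoord hx.2 _).symm
  simp only [Φ] at this
  rw [mfderiv_fibreCoord hx hs, mfderiv_fibreCoord hx hc, fderiv_sectionCoord_constSection hx,
    sub_eq_iff_eq_add] at this
  rw [this]
  simp only [zero_apply, sub_zero]
  rw [add_comm]

variable [T2Space M]

/-- A constant section is smooth only over the base set, while `hnabla` is applied to global smooth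
sections. Cutting off by a bump function does not change `∇` near `x`, since `∇` is local. -/
lemma contMDiffAt_nabla (hnabla : CovariantDerivative.ContMDiffCovariantDerivative nabla ∞)
    {x₀ x : M} (hx : x ∈ chartDomain (B := B) F E x₀) (f : F) (u : B) :
    ContMDiffAt 𝓘(ℝ, B) (𝓘(ℝ, B).prod 𝓘(ℝ, F)) ∞ (fun x ↦ TotalSpace.mk' F x
      (nabla (constSection E x₀ f) x
        (constSection (TangentSpace 𝓘(ℝ, B) : M → Type _) x₀ u x))) x := by
  have hb := (trivializationAt F E x₀).open_baseSet
  obtain ⟨ψ, -, hψ⟩ := (SmoothBumpFunction.nhds_basis_tsupport (I := 𝓘(ℝ, B)) x).mem_iff.1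
    (hb.mem_nhds hx.2)
  have h1 : ContMDiff 𝓘(ℝ, B) (𝓘(ℝ, B).prod 𝓘(ℝ, F)) ∞
      (fun x ↦ TotalSpace.mk' F x (((ψ : M → ℝ) • constSection E x₀ f) x)) :=
    ContMDiffOn.smul_section_of_tsupport ψ.contMDiff.contMDiffOn hb hψ
      (contMDiffOn_constSection x₀ f)
  have h2 := hnabla.contMDiff.contMDiff (σ := (ψ : M → ℝ) • constSection E x₀ f) h1.contMDiffOn
  rw [contMDiffOn_univ] at h2
  have h3 := (h2 x).clm_bundle_apply
    (contMDiffAt_constSection (E := (TangentSpace 𝓘(ℝ, B) : M → Type _)) (x := x) hx.1 u)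
  refine h3.congr_of_eventuallyEq ?_
  filter_upwards [eventually_eventually_nhds.2 ψ.eventuallyEq_one, hb.mem_nhds hx.2] with y hy hy'
  have : nabla (constSection E x₀ f) y = nabla ((ψ : M → ℝ) • constSection E x₀ f) y := by
    refine nabla.isCovariantDerivativeOn.congr_of_eventuallyEq (s := Set.univ)
      (mdifferentiableAt_constSection hy' f) ((h1 y).mdifferentiableAt (by simp)) Filter.univ_mem ?_
    filter_upwards [hy] with w hw
    rw [Pi.smul_apply', hw, Pi.one_apply, one_smul]
  rw [this]

end Christoffel

/-- As `V` is finite-dimensional, a linear map out of it amounts to the tuple of its values on a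
basis. -/
lemma contDiffAt_clm_of_forall_apply {B V W : Type*} [NormedAddCommGroup B] [NormedSpace ℝ B]
    [NormedAddCommGroup V] [NormedSpace ℝ V] [FiniteDimensional ℝ V]
    [NormedAddCommGroup W] [NormedSpace ℝ W] {n : ℕ∞ω} {Φ : B → V →L[ℝ] W} {z : B}
    (h : ∀ v, ContDiffAt ℝ n (fun y ↦ Φ y v) z) : ContDiffAt ℝ n Φ z := by
  let d := finrank ℝ V
  have hd : d = finrank ℝ (Fin d → ℝ) := (finrank_fin_fun ℝ).symm
  let e₁ := ContinuousLinearEquiv.ofFinrankEq hd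
  let e₂ := (e₁.arrowCongr (1 : W ≃L[ℝ] W)).trans (ContinuousLinearEquiv.piRing (Fin d))
  rw [← Function.id_comp Φ, ← e₂.symm_comp_self]
  exact e₂.symm.contDiff.contDiffAt.comp _ (contDiffAt_pi.mpr fun i ↦ h _)

section Christoffel

variable {B : Type*} [NormedAddCommGroup B] [NormedSpace ℝ B] [FiniteDimensional ℝ B]
  {M : Type*} [TopologicalSpace M] [ChartedSpace B M] [IsManifold 𝓘(ℝ, B) ∞ M]
  {F : Type*} [NormedAddCommGroup F] [NormedSpace ℝ F] [FiniteDimensional ℝ F]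
  {E : M → Type*} [∀ x, AddCommGroup (E x)] [∀ x, Module ℝ (E x)] [∀ x, TopologicalSpace (E x)]
  [∀ x, IsTopologicalAddGroup (E x)] [∀ x, ContinuousSMul ℝ (E x)]
  [TopologicalSpace (TotalSpace F E)] [FiberBundle F E] [VectorBundle ℝ F E]
  [ContMDiffVectorBundle ∞ F E 𝓘(ℝ, B)] (nabla : CovariantDerivative 𝓘(ℝ, B) F E)

open Classical in
/-- The Christoffel symbols of a connection. -/
def christoffel (x₀ : M) (z : B) : B →L[ℝ] F →L[ℝ] F :=
  let x := (extChartAt 𝓘(ℝ, B) x₀).symm z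
  -- Linearity in `f` needs the constant sections to be differentiable at `x`, which is known on the
  -- base set; elsewhere the value is the default `0`.
  if hx : x ∈ (trivializationAt F E x₀).baseSet then
    (LinearMap.mk₂ ℝ (fun (u : B) (f : F) ↦ fibreCoord F x₀ x (nabla (constSection E x₀ f) x
      (constSection (TangentSpace 𝓘(ℝ, B) : M → Type _) x₀ u x)))
    (fun u v f ↦ by rw [constSection_add, Pi.add_apply, map_add, map_add])
    (fun r u f ↦ by rw [constSection_smul, Pi.smul_apply, map_smul, map_smul])
    (fun u f g ↦ by
      rw [constSection_add, nabla.isCovariantDerivativeOn.add (s := Set.univ)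
        (mdifferentiableAt_constSection hx f) (mdifferentiableAt_constSection hx g)]
      exact map_add _ _ _)
    (fun r u f ↦ by
      rw [constSection_smul, nabla.isCovariantDerivativeOn.smul_const (s := Set.univ) r
        (mdifferentiableAt_constSection hx f)]
      exact map_smul _ _ _)).toContinuousBilinearMap
  else 0

lemma christoffel_apply {x₀ x : M} (hx : x ∈ chartDomain (B := B) F E x₀) (u : B) (f : F) :
    christoffel nabla x₀ (extChartAt 𝓘(ℝ, B) x₀ x) u f =
      fibreCoord F x₀ x (nabla (constSection E x₀ f) x
        (constSection (TangentSpace 𝓘(ℝ, B) : M → Type _) x₀ u x)) := by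
  have h := chart_symm_apply hx.1
  unfold christoffel
  simp only
  rw [dif_pos (by rw [h]; exact hx.2)]
  simp only [LinearMap.toContinuousBilinearMap_apply, LinearMap.mk₂_apply]
  rw [h]

/-- The covariant derivative, in coordinates. -/
lemma fibreCoord_nabla_eq {x₀ x : M} (hx : x ∈ chartDomain (B := B) F E x₀) {s : Π x, E x}
    (hs : MDifferentiableAt 𝓘(ℝ, B) (𝓘(ℝ, B).prod 𝓘(ℝ, F)) (fun x ↦ TotalSpace.mk' F x (s x)) x)
    (X : TangentSpace 𝓘(ℝ, B) x) :
    fibreCoord F x₀ x (nabla s x X) =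
      fderiv ℝ (sectionCoord F x₀ s) (extChartAt 𝓘(ℝ, B) x₀ x) (fibreCoord B x₀ x X) +
        christoffel nabla x₀ (extChartAt 𝓘(ℝ, B) x₀ x) (fibreCoord B x₀ x X)
          (fibreCoord F x₀ x (s x)) := by
  rw [christoffel_apply nabla hx, constSection_fibreCoord (mem_baseSet_tangentSpace.2 hx.1)]
  exact fibreCoord_nabla nabla hx hs X

lemma contDiffAt_christoffel [T2Space M]
    (hnabla : CovariantDerivative.ContMDiffCovariantDerivative nabla ∞)
    {x₀ x : M} (hx : x ∈ chartDomain (B := B) F E x₀) :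
    ContDiffAt ℝ ∞ (christoffel nabla x₀) (extChartAt 𝓘(ℝ, B) x₀ x) := by
  refine contDiffAt_clm_of_forall_apply fun u ↦ contDiffAt_clm_of_forall_apply fun f ↦ ?_
  refine (contDiffAt_sectionCoord hx (contMDiffAt_nabla nabla hnabla hx f u)).congr_of_eventuallyEq ?_
  filter_upwards [eventually_symm_mem_chartDomain hx] with z hz
  have h := (extChartAt 𝓘(ℝ, B) x₀).right_inv hz.1
  rw [← h, christoffel_apply nabla hz.2, sectionCoord_apply hz.2.1]

end Christoffel

/-! ### Bundle maps in coordinates. -/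

section BundleMap

variable {B : Type*} [NormedAddCommGroup B] [NormedSpace ℝ B] [FiniteDimensional ℝ B]
  {M : Type*} [TopologicalSpace M] [ChartedSpace B M] [IsManifold 𝓘(ℝ, B) ∞ M]
  {F₁ : Type*} [NormedAddCommGroup F₁] [NormedSpace ℝ F₁] [FiniteDimensional ℝ F₁]
  {E₁ : M → Type*} [∀ x, AddCommGroup (E₁ x)] [∀ x, Module ℝ (E₁ x)]
  [∀ x, TopologicalSpace (E₁ x)]
  [∀ x, IsTopologicalAddGroup (E₁ x)] [∀ x, ContinuousSMul ℝ (E₁ x)]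
  [TopologicalSpace (TotalSpace F₁ E₁)] [FiberBundle F₁ E₁] [VectorBundle ℝ F₁ E₁]
  [ContMDiffVectorBundle ∞ F₁ E₁ 𝓘(ℝ, B)]
  {F₂ : Type*} [NormedAddCommGroup F₂] [NormedSpace ℝ F₂] [FiniteDimensional ℝ F₂]
  {E₂ : M → Type*} [∀ x, AddCommGroup (E₂ x)] [∀ x, Module ℝ (E₂ x)]
  [∀ x, TopologicalSpace (E₂ x)]
  [∀ x, IsTopologicalAddGroup (E₂ x)] [∀ x, ContinuousSMul ℝ (E₂ x)]
  [TopologicalSpace (TotalSpace F₂ E₂)] [FiberBundle F₂ E₂] [VectorBundle ℝ F₂ E₂]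
  [ContMDiffVectorBundle ∞ F₂ E₂ 𝓘(ℝ, B)]

/-- A bundle map, in coordinates. -/
def bundleMapCoord (F₁ F₂ : Type*) [NormedAddCommGroup F₁] [NormedSpace ℝ F₁]
    [FiniteDimensional ℝ F₁]
    {E₁ : M → Type*} [∀ x, AddCommGroup (E₁ x)] [∀ x, Module ℝ (E₁ x)]
    [∀ x, TopologicalSpace (E₁ x)]
    [TopologicalSpace (TotalSpace F₁ E₁)] [FiberBundle F₁ E₁] [VectorBundle ℝ F₁ E₁]
    [NormedAddCommGroup F₂] [NormedSpace ℝ F₂]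
    {E₂ : M → Type*} [∀ x, AddCommGroup (E₂ x)] [∀ x, Module ℝ (E₂ x)]
    [∀ x, TopologicalSpace (E₂ x)]
    [TopologicalSpace (TotalSpace F₂ E₂)] [FiberBundle F₂ E₂] [VectorBundle ℝ F₂ E₂]
    (x₀ : M) (L : ∀ x, E₁ x →ₗ[ℝ] E₂ x) (z : B) : F₁ →L[ℝ] F₂ :=
  let x := (extChartAt 𝓘(ℝ, B) x₀).symm z
  LinearMap.toContinuousLinearMap
    (fibreCoord F₂ x₀ x ∘ₗ L x ∘ₗ (trivializationAt F₁ E₁ x₀).symmₗ ℝ x)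

lemma bundleMapCoord_eq_sectionCoord (x₀ : M) (L : ∀ x, E₁ x →ₗ[ℝ] E₂ x) (z : B) (f : F₁) :
    bundleMapCoord F₁ F₂ x₀ L z f = sectionCoord F₂ x₀ (fun x ↦ L x (constSection E₁ x₀ f x)) z :=
  rfl

lemma bundleMapCoord_apply {x₀ x : M} (hx : x ∈ chartDomain (B := B) F₁ E₁ x₀)
    (L : ∀ x, E₁ x →ₗ[ℝ] E₂ x) (v : E₁ x) :
    bundleMapCoord F₁ F₂ x₀ L (extChartAt 𝓘(ℝ, B) x₀ x) (fibreCoord F₁ x₀ x v) =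
      fibreCoord F₂ x₀ x (L x v) := by
  rw [bundleMapCoord_eq_sectionCoord, sectionCoord_apply hx.1, constSection_fibreCoord hx.2]

lemma contDiffAt_bundleMapCoord {x₀ x : M} (hx : x ∈ chartDomain (B := B) F₂ E₂ x₀)
    {L : ∀ x, E₁ x →ₗ[ℝ] E₂ x}
    (hL : ∀ f : F₁, ContMDiffAt 𝓘(ℝ, B) (𝓘(ℝ, B).prod 𝓘(ℝ, F₂)) ∞
      (fun x ↦ TotalSpace.mk' F₂ x (L x (constSection E₁ x₀ f x))) x) :
    ContDiffAt ℝ ∞ (bundleMapCoord F₁ F₂ x₀ L) (extChartAt 𝓘(ℝ, B) x₀ x) :=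
  contDiffAt_clm_of_forall_apply fun f ↦ contDiffAt_sectionCoord hx (hL f)

variable (nabla₁ : CovariantDerivative 𝓘(ℝ, B) F₁ E₁) (nabla₂ : CovariantDerivative 𝓘(ℝ, B) F₂ E₂)

/-- The covariant derivative of the image of a constant section through a bundle map. -/
lemma fibreCoord_nabla_bundleMap {x₀ x : M} (hx : x ∈ chartDomain (B := B) F₁ E₁ x₀)
    (hx' : x ∈ chartDomain (B := B) F₂ E₂ x₀) {L : ∀ x, E₁ x →ₗ[ℝ] E₂ x}
    (hL : ∀ f : F₁, ContMDiffAt 𝓘(ℝ, B) (𝓘(ℝ, B).prod 𝓘(ℝ, F₂)) ∞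
      (fun x ↦ TotalSpace.mk' F₂ x (L x (constSection E₁ x₀ f x))) x) (u : B) (f : F₁) :
    fibreCoord F₂ x₀ x (nabla₂ (fun y ↦ L y (constSection E₁ x₀ f y)) x
        (constSection (TangentSpace 𝓘(ℝ, B) : M → Type _) x₀ u x)) =
      fderiv ℝ (bundleMapCoord F₁ F₂ x₀ L) (extChartAt 𝓘(ℝ, B) x₀ x) u f +
      christoffel nabla₂ x₀ (extChartAt 𝓘(ℝ, B) x₀ x) u
        (bundleMapCoord F₁ F₂ x₀ L (extChartAt 𝓘(ℝ, B) x₀ x) f) := by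
  have hd := (contDiffAt_bundleMapCoord hx' hL).differentiableAt (by simp)
  rw [fibreCoord_nabla_eq nabla₂ hx' ((hL f).mdifferentiableAt (by simp)),
    fibreCoord_constSection (mem_baseSet_tangentSpace.2 hx.1), bundleMapCoord_eq_sectionCoord,
    sectionCoord_apply hx.1, ← fderiv_clm_apply_const hd]
  rfl

/-- A parallel bundle map, in coordinates. -/
lemma fderiv_bundleMapCoord {x₀ x : M} (hx : x ∈ chartDomain (B := B) F₁ E₁ x₀)
    (hx' : x ∈ chartDomain (B := B) F₂ E₂ x₀) {L : ∀ x, E₁ x →ₗ[ℝ] E₂ x}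
    (hL : ∀ f : F₁, ContMDiffAt 𝓘(ℝ, B) (𝓘(ℝ, B).prod 𝓘(ℝ, F₂)) ∞
      (fun x ↦ TotalSpace.mk' F₂ x (L x (constSection E₁ x₀ f x))) x)
    (hpar : ∀ (s : Π x, E₁ x) (X : TangentSpace 𝓘(ℝ, B) x),
      MDifferentiableAt 𝓘(ℝ, B) (𝓘(ℝ, B).prod 𝓘(ℝ, F₁)) (fun x ↦ TotalSpace.mk' F₁ x (s x)) x →
      nabla₂ (fun y ↦ L y (s y)) x X = L x (nabla₁ s x X)) (u : B) (f : F₁) :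
    fderiv ℝ (bundleMapCoord F₁ F₂ x₀ L) (extChartAt 𝓘(ℝ, B) x₀ x) u f +
      christoffel nabla₂ x₀ (extChartAt 𝓘(ℝ, B) x₀ x) u
        (bundleMapCoord F₁ F₂ x₀ L (extChartAt 𝓘(ℝ, B) x₀ x) f) =
    bundleMapCoord F₁ F₂ x₀ L (extChartAt 𝓘(ℝ, B) x₀ x)
      (christoffel nabla₁ x₀ (extChartAt 𝓘(ℝ, B) x₀ x) u f) := by
  rw [← fibreCoord_nabla_bundleMap nabla₂ hx hx' hL, christoffel_apply nabla₁ hx,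
    bundleMapCoord_apply hx, hpar _ _ (mdifferentiableAt_constSection hx.2 f)]

end BundleMap

/-! ### Lie brackets in a chart, and torsion. -/

section ChartBracket

variable {B : Type*} [NormedAddCommGroup B] [NormedSpace ℝ B] [CompleteSpace B]
  {H : Type*} [TopologicalSpace H] {I : ModelWithCorners ℝ B H}
  {N : Type*} [TopologicalSpace N] [ChartedSpace H N] [IsManifold I ∞ N]

/-- The Lie bracket of two vector fields, in a chart. -/
lemma mfderiv_extChartAt_mlieBracket {x₀ x : N} (hx : x ∈ (chartAt H x₀).source)
    {X Y : Π x : N, TangentSpace I x} {X' Y' : B → B}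
    (hX : ∀ᶠ y in 𝓝 x, mfderiv I 𝓘(ℝ, B) (extChartAt I x₀) y (X y) = X' (extChartAt I x₀ y))
    (hY : ∀ᶠ y in 𝓝 x, mfderiv I 𝓘(ℝ, B) (extChartAt I x₀) y (Y y) = Y' (extChartAt I x₀ y))
    (hX' : ContDiffAt ℝ 1 X' (extChartAt I x₀ x))
    (hY' : ContDiffAt ℝ 1 Y' (extChartAt I x₀ x)) :
    mfderiv I 𝓘(ℝ, B) (extChartAt I x₀) x (mlieBracket I X Y x) =
      lieBracket ℝ X' Y' (extChartAt I x₀ x) := by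
  have : IsManifold I (minSmoothness ℝ 3) N := .of_le (n := ∞) (by
    rw [minSmoothness_of_isRCLikeNormedField]; exact ENat.LEInfty.out)
  have : IsManifold I 1 N := .of_le (n := ∞) (by simp)
  have hinv : ∀ᶠ y in 𝓝 x, (mfderiv I 𝓘(ℝ, B) (extChartAt I x₀) y).IsInvertible := by
    filter_upwards [(chartAt H x₀).open_source.mem_nhds hx] with y hy
    exact isInvertible_mfderiv_extChartAt (by rwa [extChartAt_source])
  -- Near `x` the fields are pull backs of `X'` and `Y'` by the chart, and pull back commutes with
  -- brackets.
  have key : ∀ {X : Π x : N, TangentSpace I x} {X' : B → B},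
      (∀ᶠ y in 𝓝 x, mfderiv I 𝓘(ℝ, B) (extChartAt I x₀) y (X y) = X' (extChartAt I x₀ y)) →
      X =ᶠ[𝓝 x] mpullback I 𝓘(ℝ, B) (extChartAt I x₀) X' := fun h ↦ by
    filter_upwards [h, hinv] with y hy hy'
    exact ((hy'.inverse_apply_eq).2 hy.symm).symm
  have hb := mpullback_mlieBracket (I := I) (f := extChartAt I x₀) (x₀ := x) (n := ∞)
    ((contMDiffAt_vectorSpace_iff_contDiffAt.2 hX').mdifferentiableAt (by simp))
    ((contMDiffAt_vectorSpace_iff_contDiffAt.2 hY').mdifferentiableAt (by simp))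
    (contMDiffAt_extChartAt' hx) (by
      rw [minSmoothness_of_isRCLikeNormedField]; exact ENat.LEInfty.out)
  rw [(key hX).mlieBracket_vectorField_eq (key hY), ← hb, mpullback_apply]
  refine (hinv.self_of_nhds.self_apply_inverse _).trans ?_
  have h := congrFun (mlieBracketWithin_eq_lieBracketWithin (𝕜 := ℝ) (V := X') (W := Y')
    (s := Set.univ)) (extChartAt I x₀ x)
  have h' : lieBracketWithin ℝ X' Y' Set.univ = lieBracket ℝ X' Y' := lieBracketWithin_univ
  exact (congrFun mlieBracketWithin_univ _).symm.trans (h.trans (congrFun h' _))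

end ChartBracket

section Torsion

variable {B : Type*} [NormedAddCommGroup B] [NormedSpace ℝ B] [FiniteDimensional ℝ B]
  {M : Type*} [TopologicalSpace M] [ChartedSpace B M] [IsManifold 𝓘(ℝ, B) ∞ M]
  (D : CovariantDerivative 𝓘(ℝ, B) B (TangentSpace 𝓘(ℝ, B) : M → Type _))

lemma mem_chartDomain_tangentSpace {x₀ x : M} :
    x ∈ chartDomain (B := B) B (TangentSpace 𝓘(ℝ, B) : M → Type _) x₀ ↔
      x ∈ (chartAt B x₀).source :=
  ⟨fun h ↦ h.1, fun h ↦ ⟨h, h⟩⟩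

/-- The coordinate vector fields commute. -/
lemma mlieBracket_constSection {x₀ x : M} (hx : x ∈ (chartAt B x₀).source) (u v : B) :
    mlieBracket 𝓘(ℝ, B) (constSection (TangentSpace 𝓘(ℝ, B) : M → Type _) x₀ u)
      (constSection (TangentSpace 𝓘(ℝ, B) : M → Type _) x₀ v) x = 0 := by
  have := FiniteDimensional.complete ℝ B
  have key (u : B) : ∀ᶠ y in 𝓝 x, mfderiv 𝓘(ℝ, B) 𝓘(ℝ, B) (extChartAt 𝓘(ℝ, B) x₀) y
      (constSection (TangentSpace 𝓘(ℝ, B) : M → Type _) x₀ u y) = u := by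
    filter_upwards [(chartAt B x₀).open_source.mem_nhds hx] with y hy
    rw [← fibreCoord_tangentSpace hy, fibreCoord_constSection (mem_baseSet_tangentSpace.2 hy)]
  have := mfderiv_extChartAt_mlieBracket hx (key u) (key v) contDiffAt_const contDiffAt_const
  apply fibreCoord_injective (mem_baseSet_tangentSpace.2 hx)
  rw [fibreCoord_tangentSpace hx, this, map_zero]
  simp [lieBracket]

/-- Coordinate fields commute, so zero torsion means precisely that the symbols are symmetric. -/
lemma christoffel_symm (htorsion : D.torsion = 0) {x₀ x : M} (hx : x ∈ (chartAt B x₀).source)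
    (u v : B) :
    christoffel D x₀ (extChartAt 𝓘(ℝ, B) x₀ x) u v =
      christoffel D x₀ (extChartAt 𝓘(ℝ, B) x₀ x) v u := by
  have hx' := mem_chartDomain_tangentSpace.2 hx
  rw [christoffel_apply D hx', christoffel_apply D hx', ← sub_eq_zero, ← map_sub,
    D.torsion_eq_zero_iff.1 htorsion (mdifferentiableAt_constSection hx'.2 u)
      (mdifferentiableAt_constSection hx'.2 v), mlieBracket_constSection hx, map_zero]

end Torsion

/-! ### The connection induced on the bundle of algebras. -/

section ConnectionOnAlgebra

variable {B F H : Type*} [NormedAddCommGroup B] [NormedSpace ℝ B] [FiniteDimensional ℝ B]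
  [NormedAddCommGroup F] [NormedSpace ℝ F] [FiniteDimensional ℝ F]
  [NormedAddCommGroup H] [NormedSpace ℝ H] [FiniteDimensional ℝ H]

/-- The covariant derivative, as a family of endomorphisms, of the endomorphism `act z a`. -/
def endDeriv (act : B → H →L[ℝ] F →L[ℝ] F) (Γ : B → B →L[ℝ] F →L[ℝ] F) (z u : B) (a : H) :
    F →L[ℝ] F :=
  fderiv ℝ act z u a + (Γ z u ∘L act z a - act z a ∘L Γ z u)

lemma endDeriv_apply (act : B → H →L[ℝ] F →L[ℝ] F) (Γ : B → B →L[ℝ] F →L[ℝ] F) (z u : B) (a : H)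
    (f : F) : endDeriv act Γ z u a f =
      fderiv ℝ act z u a f + (Γ z u (act z a f) - act z a (Γ z u f)) := rfl

/-- A connection which preserves a bundle of endomorphisms induces a connection on it. -/
lemma exists_induced_connection {act : B → H →L[ℝ] F →L[ℝ] F} {Γ : B → B →L[ℝ] F →L[ℝ] F}
    {U : Set B} (hU : IsOpen U) (hact : ContDiffOn ℝ ∞ act U) (hΓ : ContDiffOn ℝ ∞ Γ U)
    (hinj : ∀ z ∈ U, ∀ a, (∀ f, act z a f = 0) → a = 0)
    (hex : ∀ z ∈ U, ∀ u a, ∃ b, act z b = endDeriv act Γ z u a) :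
    ∃ Ω : B → B →L[ℝ] H →L[ℝ] H, ContDiffOn ℝ ∞ Ω U ∧
      ∀ z ∈ U, ∀ u a, act z (Ω z u a) = endDeriv act Γ z u a := by
  classical
  have hinj' : ∀ z ∈ U, ∀ a b, act z a = act z b → a = b := fun z hz a b h ↦ by
    refine sub_eq_zero.1 (hinj z hz _ fun f ↦ ?_)
    rw [(act z).map_sub, h, sub_self]; rfl
  choose b hb using hex
  -- Injectivity of `act z` makes the chosen `b` unique, hence bilinear in `u` and `a`.
  let Ω (z : B) : B →L[ℝ] H →L[ℝ] H := if hz : z ∈ U then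
    (LinearMap.mk₂ ℝ (fun (u : B) (a : H) ↦ b z hz u a)
      (fun u v a ↦ hinj' z hz _ _ (by
        rw [(act z).map_add, hb, hb, hb]
        ext f
        simp only [endDeriv_apply, clm_add_apply, (fderiv ℝ act z).map_add, (Γ z).map_add,
          (act z a).map_add]
        abel))
      (fun r u a ↦ hinj' z hz _ _ (by
        rw [(act z).map_smul, hb, hb]
        ext f
        simp only [endDeriv_apply, clm_smul_apply, (fderiv ℝ act z).map_smul, (Γ z).map_smul,
          (act z a).map_smul, smul_add, smul_sub]))
      (fun u a a' ↦ hinj' z hz _ _ (by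
        rw [(act z).map_add, hb, hb, hb]
        ext f
        simp only [endDeriv_apply, clm_add_apply, (fderiv ℝ act z u).map_add, (Γ z u).map_add,
          (act z).map_add]
        abel))
      (fun r u a ↦ hinj' z hz _ _ (by
        rw [(act z).map_smul, hb, hb]
        ext f
        simp only [endDeriv_apply, clm_smul_apply, (fderiv ℝ act z u).map_smul, (Γ z u).map_smul,
          (act z).map_smul, smul_add, smul_sub]))).toContinuousBilinearMap
    else 0
  have hΩ : ∀ z ∈ U, ∀ u a, act z (Ω z u a) = endDeriv act Γ z u a := fun z hz u a ↦ by
    simp only [Ω, dif_pos hz, LinearMap.toContinuousBilinearMap_apply, LinearMap.mk₂_apply, hb]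
  refine ⟨Ω, fun z₀ hz₀ ↦ ContDiffAt.contDiffWithinAt ?_, hΩ⟩
  have hact₀ := hact.contDiffAt (hU.mem_nhds hz₀)
  have hΓ₀ := hΓ.contDiffAt (hU.mem_nhds hz₀)
  -- For smoothness, fix a left inverse `L` of `act z₀`. Near `z₀` the map `T z = L ∘ act z` stays
  -- invertible, and `Ω` is `(T z)⁻¹` applied to `L` of `endDeriv`, which is smooth in `z`.
  obtain ⟨L₀, hL₀⟩ := LinearMap.exists_leftInverse_of_injective
    (act z₀ : H →ₗ[ℝ] F →L[ℝ] F) (LinearMap.ker_eq_bot.2 fun a b h ↦ hinj' z₀ hz₀ a b h)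
  let L := L₀.toContinuousLinearMap
  let T (z : B) : H →L[ℝ] H := L ∘L act z
  have hT : ContDiffAt ℝ ∞ T z₀ := contDiffAt_const.clm_comp hact₀
  have hT₀ : T z₀ = 1 := by
    ext a
    exact congrArg (fun φ ↦ φ a) hL₀
  have := FiniteDimensional.complete ℝ H
  have hunit : ∀ᶠ z in 𝓝 z₀, IsUnit (T z) :=
    hT.continuousAt.eventually (Units.isOpen.mem_nhds (by rw [hT₀]; exact isUnit_one))
  have hinvT : ContDiffAt ℝ ∞ (fun z ↦ Ring.inverse (T z)) z₀ := by
    refine ContDiffAt.comp (g := Ring.inverse) z₀ ?_ hT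
    rw [hT₀]
    exact contDiffAt_ringInverse ℝ (1 : (H →L[ℝ] H)ˣ)
  refine contDiffAt_clm_of_forall_apply fun u ↦ contDiffAt_clm_of_forall_apply fun a ↦ ?_
  have hd : ContDiffAt ℝ ∞ (fun z ↦ endDeriv act Γ z u a) z₀ := by
    have h1 : ContDiffAt ℝ ∞ (fun z ↦ act z a) z₀ := hact₀.clm_apply contDiffAt_const
    have h2 : ContDiffAt ℝ ∞ (fun z ↦ Γ z u) z₀ := hΓ₀.clm_apply contDiffAt_const
    have h3 : ContDiffAt ℝ ∞ (fun z ↦ fderiv ℝ act z u a) z₀ :=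
      ((hact₀.fderiv_right (m := ∞) (by simp)).clm_apply contDiffAt_const).clm_apply
        contDiffAt_const
    exact h3.add ((h2.clm_comp h1).sub (h1.clm_comp h2))
  refine (hinvT.clm_apply (contDiffAt_const (c := L) |>.clm_apply hd)).congr_of_eventuallyEq ?_
  filter_upwards [hunit, hU.mem_nhds hz₀] with z hz hz'
  rw [← hΩ z hz' u a]
  change _ = (Ring.inverse (T z) * T z) (Ω z u a)
  rw [Ring.inverse_mul_cancel _ hz]
  rfl

end ConnectionOnAlgebra

section DerivationRule

variable {B F H : Type*} [NormedAddCommGroup B] [NormedSpace ℝ B]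
  [NormedAddCommGroup F] [NormedSpace ℝ F] [NormedRing H] [NormedAlgebra ℝ H]

/-- The connection induced on a bundle of algebras of endomorphisms is compatible with the
multiplication. -/
lemma induced_connection_mul {act : B → H →L[ℝ] F →L[ℝ] F} {Γ : B → B →L[ℝ] F →L[ℝ] F}
    {Ω : B → B →L[ℝ] H →L[ℝ] H}
    {U : Set B} (hU : IsOpen U) (hact : ContDiffOn ℝ ∞ act U)
    (hinj : ∀ z ∈ U, ∀ a, (∀ f, act z a f = 0) → a = 0)
    (hmul : ∀ z ∈ U, ∀ a b f, act z (a * b) f = act z a (act z b f))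
    (hΩ : ∀ z ∈ U, ∀ u a f, fderiv ℝ act z u a f + Γ z u (act z a f) =
      act z (Ω z u a) f + act z a (Γ z u f)) {z : B} (hz : z ∈ U) (u : B) (a b : H) :
    Ω z u (a * b) = Ω z u a * b + a * Ω z u b := by
  have hd : DifferentiableAt ℝ act z :=
    (hact.contDiffAt (hU.mem_nhds hz)).differentiableAt (by simp)
  have hd' (a : H) : DifferentiableAt ℝ (fun y ↦ act y a) z :=
    hd.clm_apply (differentiableAt_const a)
  have key (f : F) : fderiv ℝ act z u (a * b) f =
      fderiv ℝ act z u a (act z b f) + act z a (fderiv ℝ act z u b f) := by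
    have e : (fun y ↦ act y (a * b) f) =ᶠ[𝓝 z] fun y ↦ act y a (act y b f) := by
      filter_upwards [hU.mem_nhds hz] with y hy using hmul y hy a b f
    rw [← fderiv_clm_apply_const hd, ← fderiv_clm_apply_const (hd' _), e.fderiv_eq,
      fderiv_clm_apply_apply (hd' a) ((hd' b).clm_apply (differentiableAt_const f)),
      fderiv_clm_apply_const hd, fderiv_clm_apply_const (hd' b), fderiv_clm_apply_const hd]
  -- By faithfulness it is enough to compare actions on `f`. The rule then follows from `key`, the
  -- derivative of the multiplicativity of `act`.
  refine sub_eq_zero.1 (hinj z hz _ fun f ↦ ?_)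
  have h1 := hΩ z hz u (a * b) f
  have h2 := hΩ z hz u a (act z b f)
  have h3 := congrArg (act z a) (hΩ z hz u b f)
  rw [key, hmul z hz, hmul z hz] at h1
  rw [(act z a).map_add, (act z a).map_add] at h3
  rw [(act z).map_sub, (act z).map_add, clm_sub_apply, clm_add_apply, hmul z hz, hmul z hz]
  rw [← sub_eq_zero] at h1 h2 h3
  have h := congrArg₂ (· - ·) (congrArg₂ (· + ·) h2 h3) h1
  simp only [add_zero, sub_zero] at h
  rw [← h]
  abel

/-- `Ω` is the connection induced by `Γ` on a bundle of algebras of endomorphisms, over `U`. -/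
structure IsInducedConnection (act : B → H →L[ℝ] F →L[ℝ] F) (Γ : B → B →L[ℝ] F →L[ℝ] F)
    (U : Set B) (Ω : B → B →L[ℝ] H →L[ℝ] H) : Prop where
  contDiffOn : ContDiffOn ℝ ∞ Ω U
  act_eq : ∀ z ∈ U, ∀ u a, act z (Ω z u a) = endDeriv act Γ z u a
  mul : ∀ z ∈ U, ∀ u a b, Ω z u (a * b) = Ω z u a * b + a * Ω z u b

lemma exists_isInducedConnection [FiniteDimensional ℝ B] [FiniteDimensional ℝ F]
    [FiniteDimensional ℝ H] {act : B → H →L[ℝ] F →L[ℝ] F} {Γ : B → B →L[ℝ] F →L[ℝ] F}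
    {U : Set B} (hU : IsOpen U) (hact : ContDiffOn ℝ ∞ act U) (hΓ : ContDiffOn ℝ ∞ Γ U)
    (hinj : ∀ z ∈ U, ∀ a, (∀ f, act z a f = 0) → a = 0)
    (hmul : ∀ z ∈ U, ∀ a b f, act z (a * b) f = act z a (act z b f))
    (hex : ∀ z ∈ U, ∀ u a, ∃ b, act z b = endDeriv act Γ z u a) :
    ∃ Ω, IsInducedConnection act Γ U Ω := by
  obtain ⟨Ω, h1, h2⟩ := exists_induced_connection hU hact hΓ hinj hex
  refine ⟨Ω, h1, h2, fun z hz u a b ↦ induced_connection_mul (Γ := Γ) hU hact hinj hmul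
    (fun z hz u a f ↦ ?_) hz u a b⟩
  rw [h2 z hz, endDeriv_apply]
  abel

/-- In rank zero the action determines no connection on `A`, and any derivation-valued `Ω` will do.
-/
lemma isInducedConnection_zero [Subsingleton F] (act : B → H →L[ℝ] F →L[ℝ] F)
    (Γ : B → B →L[ℝ] F →L[ℝ] F) (U : Set B) :
    IsInducedConnection act Γ U (0 : B → B →L[ℝ] H →L[ℝ] H) where
  contDiffOn := contDiffOn_const
  act_eq _ _ _ _ := ContinuousLinearMap.ext fun _ ↦ Subsingleton.elim _ _
  mul _ _ _ a b := by
    change (0 : H) = 0 * b + a * 0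
    rw [zero_mul, mul_zero, add_zero]

end DerivationRule

/-! ### The action of `A` on `E` in coordinates. -/

section ActionCoordinates

variable {B : Type*} [NormedAddCommGroup B] [NormedSpace ℝ B] [FiniteDimensional ℝ B]
  {M : Type*} [TopologicalSpace M] [ChartedSpace B M] [IsManifold 𝓘(ℝ, B) ∞ M]
  {H : Type*} [NormedAddCommGroup H] [NormedSpace ℝ H] [FiniteDimensional ℝ H]
  {A : M → Type*} [∀ x, AddCommGroup (A x)] [∀ x, Module ℝ (A x)] [∀ x, TopologicalSpace (A x)]
  [TopologicalSpace (TotalSpace H A)] [FiberBundle H A] [VectorBundle ℝ H A]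
  [ContMDiffVectorBundle ∞ H A 𝓘(ℝ, B)]
  {F : Type*} [NormedAddCommGroup F] [NormedSpace ℝ F] [FiniteDimensional ℝ F]
  {E : M → Type*} [∀ x, AddCommGroup (E x)] [∀ x, Module ℝ (E x)] [∀ x, TopologicalSpace (E x)]
  [∀ x, IsTopologicalAddGroup (E x)] [∀ x, ContinuousSMul ℝ (E x)]
  [TopologicalSpace (TotalSpace F E)] [FiberBundle F E] [VectorBundle ℝ F E]
  [ContMDiffVectorBundle ∞ F E 𝓘(ℝ, B)]

variable (H F) in
/-- An action of the bundle `A` on the bundle `E`, in coordinates. -/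
def actCoord (x₀ : M) (L : ∀ x, A x →ₗ[ℝ] E x →ₗ[ℝ] E x) (z : B) : H →L[ℝ] F →L[ℝ] F :=
  let x := (extChartAt 𝓘(ℝ, B) x₀).symm z
  (LinearMap.mk₂ ℝ (fun (a : H) (f : F) ↦
      fibreCoord F x₀ x (L x (constSection A x₀ a x) (constSection E x₀ f x)))
    (fun a b f ↦ by rw [constSection_add, Pi.add_apply, map_add, LinearMap.add_apply, map_add])
    (fun r a f ↦ by rw [constSection_smul, Pi.smul_apply, map_smul, LinearMap.smul_apply, map_smul])
    (fun a f g ↦ by rw [constSection_add, Pi.add_apply, map_add, map_add])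
    (fun r a f ↦ by
      rw [constSection_smul, Pi.smul_apply, map_smul, map_smul])).toContinuousBilinearMap

lemma actCoord_eq_sectionCoord (x₀ : M) (L : ∀ x, A x →ₗ[ℝ] E x →ₗ[ℝ] E x) (z : B) (a : H)
    (f : F) : actCoord H F x₀ L z a f =
      sectionCoord F x₀ (fun x ↦ L x (constSection A x₀ a x) (constSection E x₀ f x)) z := by
  unfold actCoord
  simp only [LinearMap.toContinuousBilinearMap_apply, LinearMap.mk₂_apply]
  rfl

variable {x₀ x : M} (hA : x ∈ chartDomain (B := B) H A x₀) (hE : x ∈ chartDomain (B := B) F E x₀)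
  {L : ∀ x, A x →ₗ[ℝ] E x →ₗ[ℝ] E x}

include hA hE in
lemma actCoord_apply (a : A x) (v : E x) :
    actCoord H F x₀ L (extChartAt 𝓘(ℝ, B) x₀ x) (fibreCoord H x₀ x a) (fibreCoord F x₀ x v) =
      fibreCoord F x₀ x (L x a v) := by
  rw [actCoord_eq_sectionCoord, sectionCoord_apply hE.1, constSection_fibreCoord hA.2,
    constSection_fibreCoord hE.2]

variable (hL : ∀ (a : H) (f : F), ContMDiffAt 𝓘(ℝ, B) (𝓘(ℝ, B).prod 𝓘(ℝ, F)) ∞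
      (fun x ↦ TotalSpace.mk' F x (L x (constSection A x₀ a x) (constSection E x₀ f x))) x)

include hE hL in
lemma contDiffAt_actCoord :
    ContDiffAt ℝ ∞ (actCoord H F x₀ L) (extChartAt 𝓘(ℝ, B) x₀ x) := by
  refine contDiffAt_clm_of_forall_apply fun a ↦ contDiffAt_clm_of_forall_apply fun f ↦ ?_
  simp only [actCoord_eq_sectionCoord]
  exact contDiffAt_sectionCoord hE (hL a f)

include hA hE in
lemma sectionCoord_act_eventuallyEq (a : Π x, A x) (s : Π x, E x) :
    sectionCoord F x₀ (fun y ↦ L y (a y) (s y)) =ᶠ[𝓝 (extChartAt 𝓘(ℝ, B) x₀ x)]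
      fun z ↦ actCoord H F x₀ L z (sectionCoord H x₀ a z) (sectionCoord F x₀ s z) := by
  filter_upwards [eventually_symm_mem_chartDomain hA, eventually_symm_mem_chartDomain hE]
    with z hz hz'
  have h := (extChartAt 𝓘(ℝ, B) x₀).right_inv hz.1
  rw [← h, sectionCoord_apply hz.2.1, sectionCoord_apply hz.2.1, sectionCoord_apply hz.2.1,
    actCoord_apply hz.2 hz'.2]

include hA hE hL in
lemma mdifferentiableAt_act {a : Π x, A x} {s : Π x, E x}
    (ha : MDifferentiableAt 𝓘(ℝ, B) (𝓘(ℝ, B).prod 𝓘(ℝ, H)) (fun x ↦ TotalSpace.mk' H x (a x)) x)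
    (hs : MDifferentiableAt 𝓘(ℝ, B) (𝓘(ℝ, B).prod 𝓘(ℝ, F)) (fun x ↦ TotalSpace.mk' F x (s x)) x) :
    MDifferentiableAt 𝓘(ℝ, B) (𝓘(ℝ, B).prod 𝓘(ℝ, F))
      (fun y ↦ TotalSpace.mk' F y (L y (a y) (s y))) x := by
  rw [mdifferentiableAt_section_iff_fibreCoord hE.2]
  have hd : DifferentiableAt ℝ
      (fun z ↦ actCoord H F x₀ L z (sectionCoord H x₀ a z) (sectionCoord F x₀ s z))
      (extChartAt 𝓘(ℝ, B) x₀ x) :=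
    (((contDiffAt_actCoord hE hL).differentiableAt (by simp)).clm_apply
      (differentiableAt_sectionCoord hA ha)).clm_apply (differentiableAt_sectionCoord hE hs)
  refine (hd.mdifferentiableAt.comp (I' := 𝓘(ℝ, B)) x
    (mdifferentiableAt_extChartAt hE.1)).congr_of_eventuallyEq ?_
  filter_upwards [(isOpen_chartDomain x₀).mem_nhds hA, (isOpen_chartDomain x₀).mem_nhds hE]
    with y hy hy'
  rw [Function.comp_apply, sectionCoord_apply hy.1, sectionCoord_apply hy.1,
    actCoord_apply hy hy']

variable (nabla : CovariantDerivative 𝓘(ℝ, B) F E)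

include hA hE hL in
lemma fibreCoord_nabla_act {a : Π x, A x} {s : Π x, E x}
    (ha : MDifferentiableAt 𝓘(ℝ, B) (𝓘(ℝ, B).prod 𝓘(ℝ, H)) (fun x ↦ TotalSpace.mk' H x (a x)) x)
    (hs : MDifferentiableAt 𝓘(ℝ, B) (𝓘(ℝ, B).prod 𝓘(ℝ, F)) (fun x ↦ TotalSpace.mk' F x (s x)) x)
    (X : TangentSpace 𝓘(ℝ, B) x) :
    fibreCoord F x₀ x (nabla (fun y ↦ L y (a y) (s y)) x X) -
        fibreCoord F x₀ x (L x (a x) (nabla s x X)) =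
      endDeriv (actCoord H F x₀ L) (christoffel nabla x₀) (extChartAt 𝓘(ℝ, B) x₀ x)
        (fibreCoord B x₀ x X) (fibreCoord H x₀ x (a x)) (fibreCoord F x₀ x (s x)) +
      actCoord H F x₀ L (extChartAt 𝓘(ℝ, B) x₀ x)
        (fderiv ℝ (sectionCoord H x₀ a) (extChartAt 𝓘(ℝ, B) x₀ x) (fibreCoord B x₀ x X))
        (fibreCoord F x₀ x (s x)) := by
  have h1 := (contDiffAt_actCoord hE hL).differentiableAt (by simp)
  have h2 := differentiableAt_sectionCoord hA ha
  have h3 := differentiableAt_sectionCoord hE hs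
  rw [fibreCoord_nabla_eq nabla hE (mdifferentiableAt_act hA hE hL ha hs),
    (sectionCoord_act_eventuallyEq hA hE a s).fderiv_eq,
    fderiv_clm_apply_apply (h1.clm_apply h2) h3, fderiv_clm_apply_apply h1 h2, clm_add_apply,
    ← actCoord_apply hA hE, ← actCoord_apply hA hE, fibreCoord_nabla_eq nabla hE hs,
    sectionCoord_apply hA.1, sectionCoord_apply hE.1, endDeriv_apply, ContinuousLinearMap.map_add]
  abel

include hA hE hL in
-- The defect of the Leibniz rule depends on `s` only through its value at `x`
-- (`fibreCoord_nabla_act`), so testing on constant sections is enough.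
lemma hasEndDeriv_iff_coord {a : Π x, A x}
    (ha : MDifferentiableAt 𝓘(ℝ, B) (𝓘(ℝ, B).prod 𝓘(ℝ, H)) (fun x ↦ TotalSpace.mk' H x (a x)) x)
    (X : TangentSpace 𝓘(ℝ, B) x) (b : A x) :
    (∀ s : Π y, E y, MDifferentiableAt 𝓘(ℝ, B) (𝓘(ℝ, B).prod 𝓘(ℝ, F))
        (fun y ↦ TotalSpace.mk' F y (s y)) x →
      nabla (fun y ↦ L y (a y) (s y)) x X = L x b (s x) + L x (a x) (nabla s x X)) ↔
    ∀ f : F, endDeriv (actCoord H F x₀ L) (christoffel nabla x₀) (extChartAt 𝓘(ℝ, B) x₀ x)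
        (fibreCoord B x₀ x X) (fibreCoord H x₀ x (a x)) f +
      actCoord H F x₀ L (extChartAt 𝓘(ℝ, B) x₀ x)
        (fderiv ℝ (sectionCoord H x₀ a) (extChartAt 𝓘(ℝ, B) x₀ x) (fibreCoord B x₀ x X)) f =
      actCoord H F x₀ L (extChartAt 𝓘(ℝ, B) x₀ x) (fibreCoord H x₀ x b) f := by
  constructor
  · intro h f
    have hs := mdifferentiableAt_constSection (B := B) (E := E) (x₀ := x₀) hE.2 f
    have := fibreCoord_nabla_act hA hE hL nabla ha hs X
    rw [h _ hs, map_add, add_sub_cancel_right, ← actCoord_apply hA hE,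
      fibreCoord_constSection hE.2] at this
    exact this.symm
  · intro h s hs
    apply fibreCoord_injective hE.2
    rw [map_add, ← sub_eq_iff_eq_add, fibreCoord_nabla_act hA hE hL nabla ha hs X, h,
      actCoord_apply hA hE]

end ActionCoordinates

/-! ### Quaternionic structures in a trivialisation. -/

section AlgebraBundle

variable {B : Type*} [NormedAddCommGroup B] [NormedSpace ℝ B]
  {M : Type*} [TopologicalSpace M] [ChartedSpace B M] [IsManifold 𝓘(ℝ, B) ∞ M]
  {F : Type*} [NormedAddCommGroup F] [NormedSpace ℝ F]
  {E : M → Type*} [∀ x, AddCommGroup (E x)] [∀ x, Module ℝ (E x)] [∀ x, TopologicalSpace (E x)]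
  [TopologicalSpace (TotalSpace F E)] [FiberBundle F E] [VectorBundle ℝ F E]
  [ContMDiffVectorBundle ∞ F E 𝓘(ℝ, B)]
  [FiniteDimensional ℝ B]
  {A : M → Type*} [∀ x, Ring (A x)] [∀ x, Algebra ℝ (A x)] [∀ x, TopologicalSpace (A x)]
  [TopologicalSpace (TotalSpace ℍ[ℝ] A)] [FiberBundle ℍ[ℝ] A] [VectorBundle ℝ ℍ[ℝ] A]
  [ContMDiffVectorBundle ∞ ℍ[ℝ] A 𝓘(ℝ, B)]
  [∀ x, IsTopologicalAddGroup (E x)] [∀ x, ContinuousSMul ℝ (E x)]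

namespace QuaternionicBundleStructure

variable (𝒬 : QuaternionicBundleStructure B A F E) {x₀ x : M}

include 𝒬 in
lemma fibreCoord_mul (hx : x ∈ (trivializationAt ℍ[ℝ] A x₀).baseSet) (a b : A x) :
    fibreCoord ℍ[ℝ] x₀ x (a * b) = fibreCoord ℍ[ℝ] x₀ x a * fibreCoord ℍ[ℝ] x₀ x b := by
  rw [fibreCoord_apply hx, fibreCoord_apply hx, fibreCoord_apply hx]
  exact 𝒬.trivialization_mul _ x hx a b

include 𝒬 in
-- The trivialisations are only assumed multiplicative. Being onto `ℍ`, they send `1` to a left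
-- unit, which is `1`.
lemma fibreCoord_one (hx : x ∈ (trivializationAt ℍ[ℝ] A x₀).baseSet) :
    fibreCoord ℍ[ℝ] x₀ x (1 : A x) = 1 := by
  have h := 𝒬.fibreCoord_mul hx 1 (constSection A x₀ (1 : ℍ[ℝ]) x)
  rwa [one_mul, fibreCoord_constSection hx, mul_one, eq_comm] at h

include 𝒬 in
lemma constSection_mul (hx : x ∈ (trivializationAt ℍ[ℝ] A x₀).baseSet) (a b : ℍ[ℝ]) :
    constSection A x₀ (a * b) x = constSection A x₀ a x * constSection A x₀ b x := by
  apply fibreCoord_injective hx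
  rw [𝒬.fibreCoord_mul hx, fibreCoord_constSection hx, fibreCoord_constSection hx,
    fibreCoord_constSection hx]

include 𝒬 in
lemma constSection_one (hx : x ∈ (trivializationAt ℍ[ℝ] A x₀).baseSet) :
    constSection A x₀ (1 : ℍ[ℝ]) x = 1 := by
  apply fibreCoord_injective hx
  rw [𝒬.fibreCoord_one hx, fibreCoord_constSection hx]

include 𝒬 in
lemma isImaginary_constSection (hx : x ∈ (trivializationAt ℍ[ℝ] A x₀).baseSet) {a : ℍ[ℝ]}
    (ha : a.re = 0) : IsImaginary (constSection A x₀ a x) := by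
  refine ⟨‖a‖, ?_⟩
  have h : a * a = (-(‖a‖ ^ 2)) • (1 : ℍ[ℝ]) := by
    have h1 : star a = -a := by rw [Quaternion.star_eq_neg]; exact ha
    have h2 := Quaternion.self_mul_star a
    rw [h1, mul_neg, neg_eq_iff_eq_neg] at h2
    rw [h2, Quaternion.normSq_eq_norm_mul_self, neg_smul, ← pow_two]
    exact congrArg _ (Algebra.algebraMap_eq_smul_one (A := ℍ[ℝ]) (‖a‖ ^ 2))
  rw [← 𝒬.constSection_mul hx, h, constSection_smul, Pi.smul_apply, 𝒬.constSection_one hx,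
    Algebra.algebraMap_eq_smul_one]

/-- The action of `A` on `E`, as a bundle of linear maps. -/
def actₗ (x : M) : A x →ₗ[ℝ] E x →ₗ[ℝ] E x := (𝒬.act x).toLinearMap

lemma actₗ_apply (a : A x) (v : E x) : 𝒬.actₗ x a v = 𝒬.act x a v := rfl

lemma contMDiffAt_act_constSection (hA : x ∈ (trivializationAt ℍ[ℝ] A x₀).baseSet)
    (hE : x ∈ (trivializationAt F E x₀).baseSet) (a : ℍ[ℝ]) (f : F) :
    ContMDiffAt 𝓘(ℝ, B) (𝓘(ℝ, B).prod 𝓘(ℝ, F)) ∞ (fun x ↦ TotalSpace.mk' F x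
      (𝒬.actₗ x (constSection A x₀ a x) (constSection E x₀ f x))) x := by
  have ho := (trivializationAt ℍ[ℝ] A x₀).open_baseSet.inter
    (trivializationAt F E x₀).open_baseSet
  exact (𝒬.act_smooth _ ho _ _ ((contMDiffOn_constSection x₀ a).mono Set.inter_subset_left)
    ((contMDiffOn_constSection x₀ f).mono Set.inter_subset_right)).contMDiffAt
    (ho.mem_nhds ⟨hA, hE⟩)

variable [FiniteDimensional ℝ F]

lemma actCoord_one (hA : x ∈ chartDomain (B := B) ℍ[ℝ] A x₀)
    (hE : x ∈ chartDomain (B := B) F E x₀) (f : F) :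
    actCoord ℍ[ℝ] F x₀ 𝒬.actₗ (extChartAt 𝓘(ℝ, B) x₀ x) 1 f = f := by
  rw [← fibreCoord_constSection hE.2 f, ← 𝒬.fibreCoord_one hA.2, actCoord_apply hA hE,
    actₗ_apply, map_one, Module.End.one_apply]

lemma actCoord_mul (hA : x ∈ chartDomain (B := B) ℍ[ℝ] A x₀)
    (hE : x ∈ chartDomain (B := B) F E x₀) (a b : ℍ[ℝ]) (f : F) :
    actCoord ℍ[ℝ] F x₀ 𝒬.actₗ (extChartAt 𝓘(ℝ, B) x₀ x) (a * b) f =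
      actCoord ℍ[ℝ] F x₀ 𝒬.actₗ (extChartAt 𝓘(ℝ, B) x₀ x) a
        (actCoord ℍ[ℝ] F x₀ 𝒬.actₗ (extChartAt 𝓘(ℝ, B) x₀ x) b f) := by
  rw [← fibreCoord_constSection hE.2 f, ← fibreCoord_constSection hA.2 a,
    ← fibreCoord_constSection hA.2 b, ← 𝒬.fibreCoord_mul hA.2, actCoord_apply hA hE,
    actCoord_apply hA hE, actCoord_apply hA hE, actₗ_apply, map_mul, Module.End.mul_apply]
  rfl

/-- If a nonzero `a` acted as zero then so would `a⁻¹ * a = 1`. -/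
lemma actCoord_faithful [Nontrivial F] (hA : x ∈ chartDomain (B := B) ℍ[ℝ] A x₀)
    (hE : x ∈ chartDomain (B := B) F E x₀) {a : ℍ[ℝ]}
    (ha : ∀ f : F, actCoord ℍ[ℝ] F x₀ 𝒬.actₗ (extChartAt 𝓘(ℝ, B) x₀ x) a f = 0) : a = 0 := by
  by_contra h
  obtain ⟨f, hf⟩ := exists_ne (0 : F)
  apply hf
  rw [← 𝒬.actCoord_one hA hE f, ← inv_mul_cancel₀ h, 𝒬.actCoord_mul hA hE, ha,
    ContinuousLinearMap.map_zero]

variable {𝒬} {nabla : CovariantDerivative 𝓘(ℝ, B) F E}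

/-- The hypothesis on `∇` concerns imaginary sections only, so it is applied to the constant section
`a.im`. The real part contributes nothing, since the unit acts as the identity, which is parallel.
-/
lemma exists_actCoord_eq_endDeriv (h𝒬 : 𝒬.IsQuaternionicConnection nabla)
    (hA : x ∈ chartDomain (B := B) ℍ[ℝ] A x₀) (hE : x ∈ chartDomain (B := B) F E x₀) (u : B)
    (a : ℍ[ℝ]) : ∃ b, actCoord ℍ[ℝ] F x₀ 𝒬.actₗ (extChartAt 𝓘(ℝ, B) x₀ x) b =
      endDeriv (actCoord ℍ[ℝ] F x₀ 𝒬.actₗ) (christoffel nabla x₀) (extChartAt 𝓘(ℝ, B) x₀ x)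
        u a := by
  have hL := 𝒬.contMDiffAt_act_constSection hA.2 hE.2
  obtain ⟨b, -, hb⟩ := h𝒬 _ (trivializationAt ℍ[ℝ] A x₀).open_baseSet (constSection A x₀ a.im)
    (contMDiffOn_constSection x₀ a.im)
    (fun y hy ↦ 𝒬.isImaginary_constSection hy (Quaternion.re_im a)) x hA.2
    (constSection (TangentSpace 𝓘(ℝ, B) : M → Type _) x₀ u x)
  have h := (hasEndDeriv_iff_coord hA hE hL nabla
    (mdifferentiableAt_constSection hA.2 a.im) _ b).1 hb
  rw [fderiv_sectionCoord_constSection hA, fibreCoord_constSection hA.2,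
    fibreCoord_constSection (mem_baseSet_tangentSpace.2 hA.1)] at h
  refine ⟨fibreCoord ℍ[ℝ] x₀ x b, ?_⟩
  ext f
  rw [← h f]
  have hd := (contDiffAt_actCoord hE hL).differentiableAt (by simp)
  have h1 : ∀ f, fderiv ℝ (actCoord ℍ[ℝ] F x₀ 𝒬.actₗ) (extChartAt 𝓘(ℝ, B) x₀ x) u 1 f = 0 := by
    intro f
    have e : (fun z ↦ actCoord ℍ[ℝ] F x₀ 𝒬.actₗ z 1 f) =ᶠ[𝓝 (extChartAt 𝓘(ℝ, B) x₀ x)]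
        fun _ ↦ f := by
      filter_upwards [eventually_symm_mem_chartDomain hA, eventually_symm_mem_chartDomain hE]
        with z hz hz'
      rw [← (extChartAt 𝓘(ℝ, B) x₀).right_inv hz.1, 𝒬.actCoord_one hz.2 hz'.2]
    rw [← fderiv_clm_apply_const hd, ← fderiv_clm_apply_const
      (hd.clm_apply (differentiableAt_const _)), e.fderiv_eq, fderiv_fun_const]
    rfl
  have h2 : a = a.re • (1 : ℍ[ℝ]) + a.im := by
    ext <;> simp
  rw [endDeriv_apply, endDeriv_apply]
  conv_rhs => rw [h2]
  simp only [ContinuousLinearMap.map_add, ContinuousLinearMap.map_smul, clm_add_apply,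
    clm_smul_apply, h1, 𝒬.actCoord_one hA hE, zero_apply, smul_zero]
  simp

end QuaternionicBundleStructure

end AlgebraBundle

/-! ### Construction of the local model. -/

section LocalModel

variable {B : Type*} [NormedAddCommGroup B] [NormedSpace ℝ B] [FiniteDimensional ℝ B]
  {M : Type*} [TopologicalSpace M] [ChartedSpace B M] [IsManifold 𝓘(ℝ, B) ∞ M]
  {A : M → Type*} [∀ x, Ring (A x)] [∀ x, Algebra ℝ (A x)] [∀ x, TopologicalSpace (A x)]
  [TopologicalSpace (TotalSpace ℍ[ℝ] A)] [FiberBundle ℍ[ℝ] A] [VectorBundle ℝ ℍ[ℝ] A]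
  [ContMDiffVectorBundle ∞ ℍ[ℝ] A 𝓘(ℝ, B)]
  {F : Type*} [NormedAddCommGroup F] [NormedSpace ℝ F] [FiniteDimensional ℝ F]
  {E : M → Type*} [∀ x, AddCommGroup (E x)] [∀ x, Module ℝ (E x)] [∀ x, TopologicalSpace (E x)]
  [∀ x, IsTopologicalAddGroup (E x)] [∀ x, ContinuousSMul ℝ (E x)]
  [TopologicalSpace (TotalSpace F E)] [FiberBundle F E] [VectorBundle ℝ F E]
  [ContMDiffVectorBundle ∞ F E 𝓘(ℝ, B)]

variable (B A F E) in
/-- The image in the chart at `x₀` of the set on which the chart and the preferred trivializations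
at `x₀` are defined. -/
def modelDomain (x₀ : M) : Set B :=
  extChartAt 𝓘(ℝ, B) x₀ '' (chartDomain (B := B) ℍ[ℝ] A x₀ ∩ chartDomain (B := B) F E x₀)

lemma isOpen_modelDomain (x₀ : M) : IsOpen (modelDomain B A F E x₀) := by
  rw [isOpen_iff_eventually]
  rintro _ ⟨x, ⟨hA, hE⟩, rfl⟩
  filter_upwards [eventually_symm_mem_chartDomain hA, eventually_symm_mem_chartDomain hE]
    with z hz hz'
  exact ⟨_, ⟨hz.2, hz'.2⟩, (extChartAt 𝓘(ℝ, B) x₀).right_inv hz.1⟩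

namespace QuaternionicBundleStructure

/-- The connection induced on the bundle of algebras by a quaternionic connection. -/
lemma exists_algebra_connection [T2Space M] [Nontrivial F]
    {𝒬 : QuaternionicBundleStructure B A F E}
    {nabla : CovariantDerivative 𝓘(ℝ, B) F E}
    (hnabla : CovariantDerivative.ContMDiffCovariantDerivative nabla ∞)
    (h𝒬 : 𝒬.IsQuaternionicConnection nabla) (x₀ : M) :
    ∃ Ω, IsInducedConnection (actCoord ℍ[ℝ] F x₀ 𝒬.actₗ) (christoffel nabla x₀)
      (modelDomain B A F E x₀) Ω := by
  have hact : ContDiffOn ℝ ∞ (actCoord ℍ[ℝ] F x₀ 𝒬.actₗ) (modelDomain B A F E x₀) := by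
    rintro _ ⟨x, ⟨hA, hE⟩, rfl⟩
    exact (contDiffAt_actCoord hE
      (𝒬.contMDiffAt_act_constSection hA.2 hE.2)).contDiffWithinAt
  have hΓ : ContDiffOn ℝ ∞ (christoffel nabla x₀) (modelDomain B A F E x₀) := by
    rintro _ ⟨x, ⟨hA, hE⟩, rfl⟩
    exact (contDiffAt_christoffel nabla hnabla hE).contDiffWithinAt
  have hinj : ∀ z ∈ modelDomain B A F E x₀, ∀ a,
      (∀ f, actCoord ℍ[ℝ] F x₀ 𝒬.actₗ z a f = 0) → a = 0 := by
    rintro _ ⟨x, ⟨hA, hE⟩, rfl⟩ a h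
    exact 𝒬.actCoord_faithful hA hE h
  have hmul : ∀ z ∈ modelDomain B A F E x₀, ∀ a b f, actCoord ℍ[ℝ] F x₀ 𝒬.actₗ z (a * b) f =
      actCoord ℍ[ℝ] F x₀ 𝒬.actₗ z a (actCoord ℍ[ℝ] F x₀ 𝒬.actₗ z b f) := by
    rintro _ ⟨x, ⟨hA, hE⟩, rfl⟩ a b f
    exact 𝒬.actCoord_mul hA hE a b f
  have hex : ∀ z ∈ modelDomain B A F E x₀, ∀ u a, ∃ b, actCoord ℍ[ℝ] F x₀ 𝒬.actₗ z b =
      endDeriv (actCoord ℍ[ℝ] F x₀ 𝒬.actₗ) (christoffel nabla x₀) z u a := by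
    rintro _ ⟨x, ⟨hA, hE⟩, rfl⟩ u a
    exact exists_actCoord_eq_endDeriv h𝒬 hA hE u a
  exact exists_isInducedConnection (H := ℍ[ℝ]) (isOpen_modelDomain x₀) hact hΓ hinj hmul hex

end QuaternionicBundleStructure

namespace AlmostFQuaternionicStructure

variable {𝒮 : AlmostFQuaternionicStructure B A F E} {x₀ x : M}

lemma contMDiffAt_ι_constSection (hx : x ∈ (chartAt B x₀).source) (u : B) :
    ContMDiffAt 𝓘(ℝ, B) (𝓘(ℝ, B).prod 𝓘(ℝ, F)) ∞ (fun x ↦ TotalSpace.mk' F x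
      (𝒮.ι x (constSection (TangentSpace 𝓘(ℝ, B) : M → Type _) x₀ u x))) x :=
  𝒮.ι_smooth.contMDiffAt.comp x
    (contMDiffAt_constSection (E := (TangentSpace 𝓘(ℝ, B) : M → Type _)) hx u)

lemma contMDiffAt_ρ_constSection (hx : x ∈ (trivializationAt F E x₀).baseSet) (f : F) :
    ContMDiffAt 𝓘(ℝ, B) 𝓘(ℝ, B).tangent ∞ (fun x ↦ TotalSpace.mk' B x
      (𝒮.ρ x (constSection E x₀ f x))) x :=
  𝒮.ρ_smooth.contMDiffAt.comp x (contMDiffAt_constSection hx f)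

variable [T2Space M] {nabla : CovariantDerivative 𝓘(ℝ, B) F E}
  {D : CovariantDerivative 𝓘(ℝ, B) B (TangentSpace 𝓘(ℝ, B) : M → Type _)}

/-- `𝓜` is the almost `f`-quaternionic structure, together with the connections, in coordinates. -/
structure IsLocalModel (𝒮 : AlmostFQuaternionicStructure B A F E)
    (nabla : CovariantDerivative 𝓘(ℝ, B) F E) (x₀ : M)
    (𝓜 : LocalFQuaternionicModel B F ℍ[ℝ]) : Prop where
  U_eq : 𝓜.U = modelDomain B A F E x₀
  ι_eq : 𝓜.ι = bundleMapCoord B F x₀ 𝒮.ι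
  ρ_eq : 𝓜.ρ = bundleMapCoord F B x₀ 𝒮.ρ
  act_eq : 𝓜.act = actCoord ℍ[ℝ] F x₀ 𝒮.actₗ
  Γ_eq : 𝓜.Γ = christoffel nabla x₀
  faithful : Subsingleton B ∨ ∀ z ∈ 𝓜.U, ∀ a, (∀ f, 𝓜.act z a f = 0) → a = 0

lemma exists_isLocalModel (hD : CovariantDerivative.ContMDiffCovariantDerivative D ∞)
    (hnabla : CovariantDerivative.ContMDiffCovariantDerivative nabla ∞)
    (hcompat : 𝒮.IsCompatibleConnection nabla D) (htorsion : D.torsion = 0) (x₀ : M) :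
    ∃ 𝓜 : LocalFQuaternionicModel B F ℍ[ℝ], 𝒮.IsLocalModel nabla x₀ 𝓜 := by
  obtain ⟨Ω, hΩ, hfaith⟩ : ∃ Ω, IsInducedConnection (actCoord ℍ[ℝ] F x₀ 𝒮.actₗ)
      (christoffel nabla x₀) (modelDomain B A F E x₀) Ω ∧
      (Subsingleton B ∨ ∀ z ∈ modelDomain B A F E x₀, ∀ a,
        (∀ f, actCoord ℍ[ℝ] F x₀ 𝒮.actₗ z a f = 0) → a = 0) := by
    -- If `E` has rank zero then so has `TM`, because `ρ ∘ ι = 1`; this replaces faithfulness later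
    -- on.
    rcases subsingleton_or_nontrivial F with h | h
    · refine ⟨0, isInducedConnection_zero _ _ _, Or.inl ?_⟩
      · refine ⟨fun u v ↦ ?_⟩
        have hx : x₀ ∈ (chartAt B x₀).source := mem_chart_source B x₀
        have hE := mem_baseSet_trivializationAt F E x₀
        have h1 : ∀ X Y : TangentSpace 𝓘(ℝ, B) x₀, X = Y := fun X Y ↦ by
          rw [← 𝒮.ρ_ι x₀ X, ← 𝒮.ρ_ι x₀ Y]
          exact congrArg _ (fibreCoord_injective hE (Subsingleton.elim _ _))
        exact h1 u v
    · obtain ⟨Ω, hΩ⟩ :=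
        QuaternionicBundleStructure.exists_algebra_connection hnabla hcompat.quaternionic x₀
      refine ⟨Ω, hΩ, Or.inr ?_⟩
      rintro _ ⟨x, ⟨hA, hE⟩, rfl⟩ a h
      exact 𝒮.actCoord_faithful hA hE h
  exact ⟨{
    U := modelDomain B A F E x₀
    isOpen_U := isOpen_modelDomain x₀
    ι := bundleMapCoord B F x₀ 𝒮.ι
    ρ := bundleMapCoord F B x₀ 𝒮.ρ
    act := actCoord ℍ[ℝ] F x₀ 𝒮.actₗ
    Γ := christoffel nabla x₀
    G := christoffel D x₀
    Ω := Ω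
    contDiffOn_ι := by
      rintro _ ⟨x, ⟨hA, hE⟩, rfl⟩
      exact (contDiffAt_bundleMapCoord hE
        (contMDiffAt_ι_constSection hE.1)).contDiffWithinAt
    contDiffOn_ρ := by
      rintro _ ⟨x, ⟨hA, hE⟩, rfl⟩
      exact (contDiffAt_bundleMapCoord (mem_chartDomain_tangentSpace.2 hE.1)
        (contMDiffAt_ρ_constSection hE.2)).contDiffWithinAt
    contDiffOn_act := by
      rintro _ ⟨x, ⟨hA, hE⟩, rfl⟩
      exact (contDiffAt_actCoord hE
        (𝒮.contMDiffAt_act_constSection hA.2 hE.2)).contDiffWithinAt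
    contDiffOn_Γ := by
      rintro _ ⟨x, ⟨hA, hE⟩, rfl⟩
      exact (contDiffAt_christoffel nabla hnabla hE).contDiffWithinAt
    contDiffOn_G := by
      rintro _ ⟨x, ⟨hA, hE⟩, rfl⟩
      exact (contDiffAt_christoffel D hD
        (mem_chartDomain_tangentSpace.2 hE.1)).contDiffWithinAt
    contDiffOn_Ω := hΩ.contDiffOn
    ρ_ι := by
      rintro _ ⟨x, ⟨hA, hE⟩, rfl⟩ v
      have hT := mem_chartDomain_tangentSpace.2 hE.1
      rw [← fibreCoord_constSection hT.2 v, bundleMapCoord_apply hT, bundleMapCoord_apply hE,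
        𝒮.ρ_ι]
    act_one := by
      rintro _ ⟨x, ⟨hA, hE⟩, rfl⟩ f
      exact 𝒮.actCoord_one hA hE f
    act_mul := by
      rintro _ ⟨x, ⟨hA, hE⟩, rfl⟩ a b f
      exact 𝒮.actCoord_mul hA hE a b f
    act_mem := by
      rintro _ ⟨x, ⟨hA, hE⟩, rfl⟩ τ hτ v hv
      have hT := mem_chartDomain_tangentSpace.2 hE.1
      rw [← fibreCoord_constSection hE.2 v, bundleMapCoord_apply hE,
        map_eq_zero_iff _ (fibreCoord_injective hT.2)] at hv
      have hJ : constSection A x₀ τ x * constSection A x₀ τ x = -1 := by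
        rw [← 𝒮.constSection_mul hA.2, hτ, ← neg_one_smul ℝ, constSection_smul, Pi.smul_apply,
          𝒮.constSection_one hA.2, neg_one_smul]
      obtain ⟨X, hX⟩ := 𝒮.act_mem x _ hJ _ hv
      rw [← fibreCoord_constSection hA.2 τ, ← fibreCoord_constSection hE.2 v,
        actCoord_apply hA hE, bundleMapCoord_apply hE, bundleMapCoord_apply hT,
        QuaternionicBundleStructure.actₗ_apply, ← hX, 𝒮.ρ_ι]
    G_symm := by
      rintro _ ⟨x, ⟨hA, hE⟩, rfl⟩ u v
      exact christoffel_symm D htorsion hE.1 u v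
    ι_parallel := by
      rintro _ ⟨x, ⟨hA, hE⟩, rfl⟩ u v
      exact fderiv_bundleMapCoord D nabla (mem_chartDomain_tangentSpace.2 hE.1) hE
        (contMDiffAt_ι_constSection hE.1)
        (fun s X hs ↦ hcompat.ι_comm x X s hs) u v
    ρ_parallel := by
      rintro _ ⟨x, ⟨hA, hE⟩, rfl⟩ u f
      exact fderiv_bundleMapCoord nabla D hE (mem_chartDomain_tangentSpace.2 hE.1)
        (contMDiffAt_ρ_constSection hE.2)
        (fun s X hs ↦ (hcompat.ρ_comm x X s hs).symm) u f
    act_parallel := by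
      intro z hz u a f
      rw [hΩ.act_eq z hz, endDeriv_apply]
      abel
    Ω_mul := hΩ.mul }, ⟨rfl, rfl, rfl, rfl, rfl, hfaith⟩⟩

end AlmostFQuaternionicStructure

end LocalModel

/-! ### Charts of the total space: vector fields, sections and vertical vectors. -/

section ChartVectorField

variable {B : Type*} [NormedAddCommGroup B] [NormedSpace ℝ B]
  {H : Type*} [TopologicalSpace H] {I : ModelWithCorners ℝ B H} [I.Boundaryless]
  {N : Type*} [TopologicalSpace N] [ChartedSpace H N] [IsManifold I ∞ N]

variable (I) in
/-- A vector field, in a chart. -/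
def chartVectorField (x₀ : N) (X : Π x : N, TangentSpace I x) (z : B) : B :=
  mfderiv I 𝓘(ℝ, B) (extChartAt I x₀) ((extChartAt I x₀).symm z) (X ((extChartAt I x₀).symm z))

lemma chartVectorField_apply {x₀ x : N} (hx : x ∈ (extChartAt I x₀).source)
    (X : Π x : N, TangentSpace I x) :
    chartVectorField I x₀ X (extChartAt I x₀ x) = mfderiv I 𝓘(ℝ, B) (extChartAt I x₀) x (X x) := by
  unfold chartVectorField
  rw [(extChartAt I x₀).left_inv hx]

lemma contDiffAt_chartVectorField {x₀ : N} {X : Π x : N, TangentSpace I x}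
    (hX : ContMDiffAt I I.tangent ∞ (fun x ↦ (⟨x, X x⟩ : TangentBundle I N)) x₀) :
    ContDiffAt ℝ ∞ (chartVectorField I x₀ X) (extChartAt I x₀ x₀) := by
  have : IsManifold I 1 N := .of_le (n := ∞) ENat.LEInfty.out
  rw [Bundle.contMDiffAt_section] at hX
  have h2 : ContMDiffAt I 𝓘(ℝ, B) ∞
      (fun x ↦ (mfderiv I 𝓘(ℝ, B) (extChartAt I x₀) x (X x) : B)) x₀ := by
    refine hX.congr_of_eventuallyEq ?_
    filter_upwards [(chartAt H x₀).open_source.mem_nhds (mem_chart_source H x₀)] with y hy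
    rw [← TangentBundle.continuousLinearMapAt_trivializationAt hy]
    exact congrFun (Trivialization.coe_linearMapAt_of_mem (R := ℝ)
      (trivializationAt B (TangentSpace I) x₀) hy) (X y)
  rw [← contMDiffAt_iff_contDiffAt]
  have h3 : ContMDiffAt 𝓘(ℝ, B) I ∞ (extChartAt I x₀).symm (extChartAt I x₀ x₀) :=
    (contMDiffOn_extChartAt_symm x₀).contMDiffAt
      ((isOpen_extChartAt_target x₀).mem_nhds (mem_extChartAt_target x₀))
  refine ContMDiffAt.comp (I' := I)
    (g := fun x ↦ (mfderiv I 𝓘(ℝ, B) (extChartAt I x₀) x (X x) : B)) _ ?_ h3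
  rwa [(extChartAt I x₀).left_inv (mem_extChartAt_source x₀)]

end ChartVectorField

section TotalSpaceChart

variable {B : Type*} [NormedAddCommGroup B] [NormedSpace ℝ B]
  {M : Type*} [TopologicalSpace M] [ChartedSpace B M] [IsManifold 𝓘(ℝ, B) ∞ M]
  {H : Type*} [NormedAddCommGroup H] [NormedSpace ℝ H]
  {A : M → Type*} [∀ x, AddCommGroup (A x)] [∀ x, Module ℝ (A x)] [∀ x, TopologicalSpace (A x)]
  [TopologicalSpace (TotalSpace H A)] [FiberBundle H A] [VectorBundle ℝ H A]
  [ContMDiffVectorBundle ∞ H A 𝓘(ℝ, B)]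

/-- The differential of the charts of the total space of a vector bundle. -/
def chartDeriv (p₀ p : TotalSpace H A)
    (ξ : TangentSpace (𝓘(ℝ, B).prod 𝓘(ℝ, H)) p) : B × H :=
  mfderiv (𝓘(ℝ, B).prod 𝓘(ℝ, H)) 𝓘(ℝ, B × H) (extChartAt (𝓘(ℝ, B).prod 𝓘(ℝ, H)) p₀) p ξ

lemma extChartAt_totalSpace_apply {p₀ p : TotalSpace H A}
    (hp : p.1 ∈ chartDomain (B := B) H A p₀.1) :
    extChartAt (𝓘(ℝ, B).prod 𝓘(ℝ, H)) p₀ p =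
      (extChartAt 𝓘(ℝ, B) p₀.1 p.1, fibreCoord H p₀.1 p.1 p.2) := by
  rw [FiberBundle.extChartAt, fibreCoord_apply hp.2]
  simp [(trivializationAt H A p₀.1).coe_fst' hp.2]

lemma mem_chartAt_totalSpace_source {p₀ p : TotalSpace H A}
    (hp : p.1 ∈ chartDomain (B := B) H A p₀.1) :
    p ∈ (chartAt (ModelProd B H) p₀).source := by
  rw [FiberBundle.chartedSpace_chartAt]
  simp only [OpenPartialHomeomorph.trans_source, OpenPartialHomeomorph.prod_source,
    OpenPartialHomeomorph.refl_source, Set.mem_inter_iff, Set.mem_preimage, Set.mem_prod,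
    Set.mem_univ, and_true]
  have h : p ∈ (trivializationAt H A p₀.1).source := (Trivialization.mem_source _).2 hp.2
  refine ⟨h, ?_⟩
  change (trivializationAt H A p₀.1 p).1 ∈ _
  rw [Trivialization.coe_fst _ h]
  exact hp.1

lemma mdifferentiableAt_extChartAt_totalSpace {p₀ p : TotalSpace H A}
    (hp : p.1 ∈ chartDomain (B := B) H A p₀.1) :
    MDifferentiableAt (𝓘(ℝ, B).prod 𝓘(ℝ, H)) 𝓘(ℝ, B × H)
      (extChartAt (𝓘(ℝ, B).prod 𝓘(ℝ, H)) p₀) p :=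
  have : IsManifold (𝓘(ℝ, B).prod 𝓘(ℝ, H)) 1 (TotalSpace H A) := .of_le (n := ∞) ENat.LEInfty.out
  mdifferentiableAt_extChartAt (mem_chartAt_totalSpace_source hp)

lemma chartDeriv_bijective {p₀ p : TotalSpace H A} (hp : p.1 ∈ chartDomain (B := B) H A p₀.1) :
    Function.Bijective (chartDeriv (B := B) p₀ p) :=
  have : IsManifold (𝓘(ℝ, B).prod 𝓘(ℝ, H)) 1 (TotalSpace H A) := .of_le (n := ∞) ENat.LEInfty.out
  (isInvertible_mfderiv_extChartAt (by
    rw [extChartAt_source]; exact mem_chartAt_totalSpace_source hp)).bijective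

lemma chartDeriv_add (p₀ p : TotalSpace H A)
    (ξ η : TangentSpace (𝓘(ℝ, B).prod 𝓘(ℝ, H)) p) :
    chartDeriv p₀ p (ξ + η) = chartDeriv p₀ p ξ + chartDeriv p₀ p η :=
  map_add (mfderiv (𝓘(ℝ, B).prod 𝓘(ℝ, H)) 𝓘(ℝ, B × H)
    (extChartAt (𝓘(ℝ, B).prod 𝓘(ℝ, H)) p₀) p) ξ η

lemma chartDeriv_sub (p₀ p : TotalSpace H A)
    (ξ η : TangentSpace (𝓘(ℝ, B).prod 𝓘(ℝ, H)) p) :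
    chartDeriv p₀ p (ξ - η) = chartDeriv p₀ p ξ - chartDeriv p₀ p η :=
  map_sub (mfderiv (𝓘(ℝ, B).prod 𝓘(ℝ, H)) 𝓘(ℝ, B × H)
    (extChartAt (𝓘(ℝ, B).prod 𝓘(ℝ, H)) p₀) p) ξ η

/-- The differential of a section, in coordinates. -/
lemma chartDeriv_mfderiv_section {p₀ : TotalSpace H A} {x : M}
    (hx : x ∈ chartDomain (B := B) H A p₀.1) {a : Π x, A x}
    (ha : MDifferentiableAt 𝓘(ℝ, B) (𝓘(ℝ, B).prod 𝓘(ℝ, H)) (fun x ↦ TotalSpace.mk' H x (a x)) x)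
    (X : TangentSpace 𝓘(ℝ, B) x) :
    chartDeriv p₀ ⟨x, a x⟩ (mfderiv 𝓘(ℝ, B) (𝓘(ℝ, B).prod 𝓘(ℝ, H))
      (fun x ↦ TotalSpace.mk' H x (a x)) x X) =
    (fibreCoord B p₀.1 x X, fderiv ℝ (sectionCoord H p₀.1 a) (extChartAt 𝓘(ℝ, B) p₀.1 x)
      (fibreCoord B p₀.1 x X)) := by
  have hs := differentiableAt_sectionCoord hx ha
  have hd : HasFDerivAt (fun z ↦ (z, sectionCoord H p₀.1 a z))
      ((ContinuousLinearMap.id ℝ B).prod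
        (fderiv ℝ (sectionCoord H p₀.1 a) (extChartAt 𝓘(ℝ, B) p₀.1 x)))
      (extChartAt 𝓘(ℝ, B) p₀.1 x) := (hasFDerivAt_id _).prodMk hs.hasFDerivAt
  have e : extChartAt (𝓘(ℝ, B).prod 𝓘(ℝ, H)) p₀ ∘ (fun x ↦ TotalSpace.mk' H x (a x)) =ᶠ[𝓝 x]
      (fun z ↦ (z, sectionCoord H p₀.1 a z)) ∘ extChartAt 𝓘(ℝ, B) p₀.1 := by
    filter_upwards [(isOpen_chartDomain p₀.1).mem_nhds hx] with y hy
    rw [Function.comp_apply, Function.comp_apply, extChartAt_totalSpace_apply hy,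
      sectionCoord_apply hy.1]
  have h1 := mfderiv_comp (I' := 𝓘(ℝ, B).prod 𝓘(ℝ, H)) x
    (mdifferentiableAt_extChartAt_totalSpace (p := ⟨x, a x⟩) hx) ha
  have h2 := mfderiv_comp (I' := 𝓘(ℝ, B)) x hd.differentiableAt.mdifferentiableAt
    (mdifferentiableAt_extChartAt hx.1)
  rw [e.mfderiv_eq, h2, mfderiv_eq_fderiv, hd.fderiv] at h1
  rw [fibreCoord_tangentSpace hx.1]
  exact (congrArg (fun f ↦ f X) h1).symm

end TotalSpaceChart

section VerticalLift

variable {B : Type*} [NormedAddCommGroup B] [NormedSpace ℝ B] [FiniteDimensional ℝ B]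
  {M : Type*} [TopologicalSpace M] [ChartedSpace B M] [IsManifold 𝓘(ℝ, B) ∞ M]
  {A : M → Type*} [∀ x, Ring (A x)] [∀ x, Algebra ℝ (A x)] [∀ x, TopologicalSpace (A x)]
  [TopologicalSpace (TotalSpace ℍ[ℝ] A)] [FiberBundle ℍ[ℝ] A] [VectorBundle ℝ ℍ[ℝ] A]
  [ContMDiffVectorBundle ∞ ℍ[ℝ] A 𝓘(ℝ, B)]

/-- The vertical lift, in coordinates. -/
lemma chartDeriv_verticalLift {p₀ p : TotalSpace ℍ[ℝ] A}
    (hp : p.1 ∈ chartDomain (B := B) ℍ[ℝ] A p₀.1) (q : A p.1) :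
    chartDeriv p₀ p (verticalLift B p q) = (0, fibreCoord ℍ[ℝ] p₀.1 p.1 q) := by
  let γ : ℝ → TotalSpace ℍ[ℝ] A := fun t : ℝ ↦ TotalSpace.mk' ℍ[ℝ] p.1 (p.2 + t • q)
  have hγ₀ : γ 0 = p := by simp [γ]
  have hd (w w' : ℍ[ℝ]) (z : B) : HasFDerivAt (fun t : ℝ ↦ (z, w + t • w'))
      (ContinuousLinearMap.toSpanSingleton ℝ ((0, w') : B × ℍ[ℝ])) (0 : ℝ) := by
    have h := ((hasDerivAt_id (0 : ℝ)).smul_const w').const_add w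
    have h' := (hasDerivAt_const (0 : ℝ) z).prodMk h
    rw [one_smul] at h'
    exact h'.hasFDerivAt
  have hγ : MDifferentiableAt 𝓘(ℝ, ℝ) (𝓘(ℝ, B).prod 𝓘(ℝ, ℍ[ℝ])) γ 0 := by
    rw [mdifferentiableAt_totalSpace]
    refine ⟨mdifferentiableAt_const, ?_⟩
    have hb := mem_baseSet_trivializationAt ℍ[ℝ] A p.1
    have : (fun t ↦ (trivializationAt ℍ[ℝ] A (γ 0).proj (γ t)).2) =
        fun t : ℝ ↦ fibreCoord ℍ[ℝ] p.1 p.1 p.2 + t • fibreCoord ℍ[ℝ] p.1 p.1 q := by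
      funext t
      rw [← map_smul, ← map_add, fibreCoord_apply hb]
    rw [this]
    exact (((differentiable_id.smul_const _).const_add _) 0).mdifferentiableAt
  have e : extChartAt (𝓘(ℝ, B).prod 𝓘(ℝ, ℍ[ℝ])) p₀ ∘ γ =
      fun t : ℝ ↦ (extChartAt 𝓘(ℝ, B) p₀.1 p.1,
        fibreCoord ℍ[ℝ] p₀.1 p.1 p.2 + t • fibreCoord ℍ[ℝ] p₀.1 p.1 q) := by
    funext t
    rw [Function.comp_apply, extChartAt_totalSpace_apply (p := γ t) hp, ← map_smul, ← map_add]
  have h1 := mfderiv_comp (I' := 𝓘(ℝ, B).prod 𝓘(ℝ, ℍ[ℝ])) (0 : ℝ)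
    (mdifferentiableAt_extChartAt_totalSpace (p := γ 0) hp) hγ
  rw [e, mfderiv_eq_fderiv, (hd _ _ _).fderiv, hγ₀] at h1
  have h2 := congrArg (fun f ↦ f (1 : ℝ)) h1
  refine h2.symm.trans ?_
  exact one_smul ℝ ((0, fibreCoord ℍ[ℝ] p₀.1 p.1 q) : B × ℍ[ℝ])

end VerticalLift

/-! ### Horizontal lifts and twistorial distributions in coordinates. -/

section Distributions

variable {B : Type*} [NormedAddCommGroup B] [NormedSpace ℝ B] [FiniteDimensional ℝ B]
  {M : Type*} [TopologicalSpace M] [T2Space M] [ChartedSpace B M] [IsManifold 𝓘(ℝ, B) ∞ M]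
  {A : M → Type*} [∀ x, Ring (A x)] [∀ x, Algebra ℝ (A x)] [∀ x, TopologicalSpace (A x)]
  [TopologicalSpace (TotalSpace ℍ[ℝ] A)] [FiberBundle ℍ[ℝ] A] [VectorBundle ℝ ℍ[ℝ] A]
  [ContMDiffVectorBundle ∞ ℍ[ℝ] A 𝓘(ℝ, B)]
  {F : Type*} [NormedAddCommGroup F] [NormedSpace ℝ F] [FiniteDimensional ℝ F]
  {E : M → Type*} [∀ x, AddCommGroup (E x)] [∀ x, Module ℝ (E x)] [∀ x, TopologicalSpace (E x)]
  [∀ x, IsTopologicalAddGroup (E x)] [∀ x, ContinuousSMul ℝ (E x)]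
  [TopologicalSpace (TotalSpace F E)] [FiberBundle F E] [VectorBundle ℝ F E]
  [ContMDiffVectorBundle ∞ F E 𝓘(ℝ, B)]

namespace AlmostFQuaternionicStructure.IsLocalModel

variable {𝒮 : AlmostFQuaternionicStructure B A F E} {nabla : CovariantDerivative 𝓘(ℝ, B) F E}
  {𝓜 : LocalFQuaternionicModel B F ℍ[ℝ]} {x₀ x : M} (h𝓜 : 𝒮.IsLocalModel nabla x₀ 𝓜)
  (hA : x ∈ chartDomain (B := B) ℍ[ℝ] A x₀) (hE : x ∈ chartDomain (B := B) F E x₀)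

include h𝓜 hA hE

lemma mem_U : extChartAt 𝓘(ℝ, B) x₀ x ∈ 𝓜.U := by
  rw [h𝓜.U_eq]
  exact ⟨x, ⟨hA, hE⟩, rfl⟩

lemma act_apply (a : A x) (v : E x) :
    𝓜.act (extChartAt 𝓘(ℝ, B) x₀ x) (fibreCoord ℍ[ℝ] x₀ x a) (fibreCoord F x₀ x v) =
      fibreCoord F x₀ x (𝒮.act x a v) := by
  rw [h𝓜.act_eq, actCoord_apply hA hE]
  rfl

omit hA in
lemma ι_apply (X : TangentSpace 𝓘(ℝ, B) x) :
    𝓜.ι (extChartAt 𝓘(ℝ, B) x₀ x) (fibreCoord B x₀ x X) = fibreCoord F x₀ x (𝒮.ι x X) := by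
  rw [h𝓜.ι_eq, bundleMapCoord_apply (mem_chartDomain_tangentSpace.2 hE.1)]

omit hA in
lemma ρ_apply (v : E x) :
    𝓜.ρ (extChartAt 𝓘(ℝ, B) x₀ x) (fibreCoord F x₀ x v) = fibreCoord B x₀ x (𝒮.ρ x v) := by
  rw [h𝓜.ρ_eq, bundleMapCoord_apply hE]

/-- In coordinates `∇_X a = 0` says that `da(X) + Ω(X)a` acts as zero. Faithfulness removes the
action; if instead `TM = 0`, both sides of the equation vanish. -/
lemma hasEndDeriv_zero_iff {a : Π x, A x}
    (ha : MDifferentiableAt 𝓘(ℝ, B) (𝓘(ℝ, B).prod 𝓘(ℝ, ℍ[ℝ]))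
      (fun x ↦ TotalSpace.mk' ℍ[ℝ] x (a x)) x) (X : TangentSpace 𝓘(ℝ, B) x) :
    𝒮.HasEndDeriv nabla a x X 0 ↔
      fderiv ℝ (sectionCoord ℍ[ℝ] x₀ a) (extChartAt 𝓘(ℝ, B) x₀ x) (fibreCoord B x₀ x X) =
        -𝓜.Ω (extChartAt 𝓘(ℝ, B) x₀ x) (fibreCoord B x₀ x X) (fibreCoord ℍ[ℝ] x₀ x (a x)) := by
  have hz := h𝓜.mem_U hA hE
  have hpar := 𝓜.act_parallel _ hz (fibreCoord B x₀ x X) (fibreCoord ℍ[ℝ] x₀ x (a x))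
  have h0 : ∀ f, 𝓜.act (extChartAt 𝓘(ℝ, B) x₀ x) (fibreCoord ℍ[ℝ] x₀ x (0 : A x)) f = 0 :=
    fun f ↦ by rw [map_zero, ContinuousLinearMap.map_zero, zero_apply]
  have h2 : ∀ f, fderiv ℝ 𝓜.act (extChartAt 𝓘(ℝ, B) x₀ x) (fibreCoord B x₀ x X)
        (fibreCoord ℍ[ℝ] x₀ x (a x)) f +
      (𝓜.Γ (extChartAt 𝓘(ℝ, B) x₀ x) (fibreCoord B x₀ x X)
          (𝓜.act (extChartAt 𝓘(ℝ, B) x₀ x) (fibreCoord ℍ[ℝ] x₀ x (a x)) f) -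
        𝓜.act (extChartAt 𝓘(ℝ, B) x₀ x) (fibreCoord ℍ[ℝ] x₀ x (a x))
          (𝓜.Γ (extChartAt 𝓘(ℝ, B) x₀ x) (fibreCoord B x₀ x X) f)) =
      𝓜.act (extChartAt 𝓘(ℝ, B) x₀ x) (𝓜.Ω (extChartAt 𝓘(ℝ, B) x₀ x) (fibreCoord B x₀ x X)
        (fibreCoord ℍ[ℝ] x₀ x (a x))) f := fun f ↦ by
    rw [← add_sub_assoc, hpar f, add_sub_cancel_right]
  refine (hasEndDeriv_iff_coord hA hE (𝒮.contMDiffAt_act_constSection hA.2 hE.2) nabla ha X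
    0).trans ?_
  rw [← h𝓜.act_eq, ← h𝓜.Γ_eq]
  simp only [endDeriv_apply, h2, h0]
  refine ⟨fun h ↦ ?_, fun h f ↦ ?_⟩
  · rcases h𝓜.faithful with hB | hf
    · rw [Subsingleton.elim (fibreCoord B x₀ x X) 0, ContinuousLinearMap.map_zero,
        ContinuousLinearMap.map_zero, zero_apply, neg_zero]
    · rw [eq_neg_iff_add_eq_zero, add_comm]
      refine hf _ hz _ fun f ↦ ?_
      rw [ContinuousLinearMap.map_add, clm_add_apply, h f]
  · rw [h, ContinuousLinearMap.map_neg, clm_neg_apply, add_neg_cancel]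

end AlmostFQuaternionicStructure.IsLocalModel

namespace AlmostFQuaternionicStructure.IsLocalModel

variable {𝒮 : AlmostFQuaternionicStructure B A F E} {nabla : CovariantDerivative 𝓘(ℝ, B) F E}
  {𝓜 : LocalFQuaternionicModel B F ℍ[ℝ]} {p₀ p : TotalSpace ℍ[ℝ] A}
  (h𝓜 : 𝒮.IsLocalModel nabla p₀.1 𝓜)
  (hA : p.1 ∈ chartDomain (B := B) ℍ[ℝ] A p₀.1) (hE : p.1 ∈ chartDomain (B := B) F E p₀.1)

include h𝓜 hA hE

lemma isHorizontalLift_iff (X : TangentSpace 𝓘(ℝ, B) p.1)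
    (ξ : TangentSpace (𝓘(ℝ, B).prod 𝓘(ℝ, ℍ[ℝ])) p) :
    𝒮.IsHorizontalLift nabla p X ξ ↔ chartDeriv p₀ p ξ = (fibreCoord B p₀.1 p.1 X,
      -𝓜.Ω (extChartAt 𝓘(ℝ, B) p₀.1 p.1) (fibreCoord B p₀.1 p.1 X)
        (fibreCoord ℍ[ℝ] p₀.1 p.1 p.2)) := by
  obtain ⟨x, τ⟩ := p
  constructor
  · rintro ⟨U, hU, hxU, a, ha, hax, hX, rfl⟩
    obtain rfl : τ = a x := hax.symm
    have ha' := (ha.contMDiffAt (hU.mem_nhds hxU)).mdifferentiableAt (by simp)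
    refine (chartDeriv_mfderiv_section hA ha' X).trans ?_
    rw [(h𝓜.hasEndDeriv_zero_iff hA hE ha' X).1 hX]
  · intro h
    let τ' := fibreCoord ℍ[ℝ] p₀.1 x τ
    let z := extChartAt 𝓘(ℝ, B) p₀.1 x
    -- Horizontality is a first order condition at one point, so an affine function suffices: its
    -- value at `z` is `τ'` and its derivative `-Ω z (·) τ'`.
    let a' : B → ℍ[ℝ] := fun y ↦ τ' - 𝓜.Ω z (y - z) τ'
    let a : Π x, A x := fun y ↦ constSection A p₀.1 (a' (extChartAt 𝓘(ℝ, B) p₀.1 y)) y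
    have ha'z : a' z = τ' := by
      simp only [a', sub_self, ContinuousLinearMap.map_zero, zero_apply, sub_zero]
    have hax : a x = τ := by
      change constSection A p₀.1 (a' z) x = τ
      rw [ha'z, constSection_fibreCoord hA.2]
    have ha'd : ContDiff ℝ ∞ a' := by
      refine contDiff_const.sub (ContDiff.clm_apply ?_ contDiff_const)
      exact (𝓜.Ω z).contDiff.comp (contDiff_id.sub contDiff_const)
    have hac : ∀ y ∈ chartDomain (B := B) ℍ[ℝ] A p₀.1,
        ContMDiffAt 𝓘(ℝ, B) (𝓘(ℝ, B).prod 𝓘(ℝ, ℍ[ℝ])) ∞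
          (fun x ↦ TotalSpace.mk' ℍ[ℝ] x (a x)) y := fun y hy ↦ by
      rw [contMDiffAt_section_iff_fibreCoord hy.2]
      refine (ContMDiffAt.comp y (g := a') (I' := 𝓘(ℝ, B)) ha'd.contMDiff.contMDiffAt
        (contMDiffAt_extChartAt' hy.1)).congr_of_eventuallyEq ?_
      filter_upwards [(isOpen_chartDomain p₀.1).mem_nhds hy] with w hw
      exact fibreCoord_constSection hw.2 _
    have hd := (hac x hA).mdifferentiableAt (by simp)
    have hder : fderiv ℝ (sectionCoord ℍ[ℝ] p₀.1 a) z (fibreCoord B p₀.1 x X) =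
        -𝓜.Ω z (fibreCoord B p₀.1 x X) τ' := by
      have e : sectionCoord ℍ[ℝ] p₀.1 a =ᶠ[𝓝 z] a' := by
        filter_upwards [eventually_symm_mem_chartDomain hA] with w hw
        unfold sectionCoord
        rw [fibreCoord_constSection hw.2.2, (extChartAt 𝓘(ℝ, B) p₀.1).right_inv hw.1]
      have hΩ : HasFDerivAt a' (-((𝓜.Ω z).flip τ')) z := by
        have h1 : HasFDerivAt (fun y : B ↦ (𝓜.Ω z).flip τ' (y - z)) ((𝓜.Ω z).flip τ') z := by
          have := ((𝓜.Ω z).flip τ').hasFDerivAt.comp (𝕜 := ℝ) z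
            ((hasFDerivAt_id z).sub_const z)
          exact this
        exact h1.const_sub τ'
      rw [e.fderiv_eq, hΩ.fderiv]
      rfl
    refine ⟨chartDomain (B := B) ℍ[ℝ] A p₀.1, isOpen_chartDomain _, hA, a,
      fun y hy ↦ (hac y hy).contMDiffWithinAt, hax, ?_, ?_⟩
    · rw [h𝓜.hasEndDeriv_zero_iff hA hE hd X, hax]
      exact hder
    · apply (chartDeriv_bijective (p₀ := p₀) (p := ⟨x, τ⟩) hA).1
      have h3 : ∀ σ, a x = σ → chartDeriv p₀ ⟨x, σ⟩ (mfderiv 𝓘(ℝ, B) (𝓘(ℝ, B).prod 𝓘(ℝ, ℍ[ℝ]))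
          (fun x ↦ TotalSpace.mk' ℍ[ℝ] x (a x)) x X : B × ℍ[ℝ]) =
          (fibreCoord B p₀.1 x X, -𝓜.Ω z (fibreCoord B p₀.1 x X) τ') := by
        rintro _ rfl
        rw [← hder]
        exact chartDeriv_mfderiv_section hA hd X
      exact h.trans (h3 τ hax).symm

/-- The twistorial distributions, in coordinates. -/
lemma mem_twistorDistribution_iff
    {S : ∀ x, A x → Set (TangentSpace 𝓘(ℝ, B) x × TangentSpace 𝓘(ℝ, B) x)}
    {S' : B → ℍ[ℝ] → Set (B × B)}
    (hS : ∀ X Y : TangentSpace 𝓘(ℝ, B) p.1, (X, Y) ∈ S p.1 p.2 ↔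
      (fibreCoord B p₀.1 p.1 X, fibreCoord B p₀.1 p.1 Y) ∈
        S' (extChartAt 𝓘(ℝ, B) p₀.1 p.1) (fibreCoord ℍ[ℝ] p₀.1 p.1 p.2))
    (ξ η : TangentSpace (𝓘(ℝ, B).prod 𝓘(ℝ, ℍ[ℝ])) p) :
    (ξ, η) ∈ 𝒮.twistorDistribution nabla S p ↔
      (chartDeriv p₀ p ξ, chartDeriv p₀ p η) ∈
        𝓜.distribution S' (extChartAt (𝓘(ℝ, B).prod 𝓘(ℝ, ℍ[ℝ])) p₀ p) := by
  have hT : p.1 ∈ (trivializationAt B (TangentSpace 𝓘(ℝ, B) : M → Type _) p₀.1).baseSet := hE.1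
  rw [extChartAt_totalSpace_apply hA]
  constructor
  · rintro ⟨X, Y, hXY, ξ', η', hξ, hη, q, hq, h⟩
    obtain ⟨rfl, rfl⟩ := Prod.mk.inj h
    have h1 := (h𝓜.isHorizontalLift_iff hA hE X ξ').1 hξ
    have h2 := (h𝓜.isHorizontalLift_iff hA hE Y η').1 hη
    rw [chartDeriv_add, chartDeriv_add, h1, h2, chartDeriv_verticalLift hA,
      chartDeriv_verticalLift hA, Prod.mk_add_mk, Prod.mk_add_mk, add_zero, add_zero]
    refine ⟨(hS X Y).1 hXY, ?_, ?_⟩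
    · simp only [LocalFQuaternionicModel.vert, neg_add_cancel_comm]
      rw [← 𝒮.fibreCoord_mul hA.2, ← 𝒮.fibreCoord_mul hA.2, hq, map_neg]
    · simp only [LocalFQuaternionicModel.vert, neg_add_cancel_comm]
      rw [𝒮.fibreCoord_mul hA.2]
  · rintro ⟨h1, h2, h3⟩
    have hb := chartDeriv_bijective (B := B) (p₀ := p₀) (p := p) hA
    have key (v : B × ℍ[ℝ]) : ∃ (X : TangentSpace 𝓘(ℝ, B) p.1)
        (ξ' : TangentSpace (𝓘(ℝ, B).prod 𝓘(ℝ, ℍ[ℝ])) p), fibreCoord B p₀.1 p.1 X = v.1 ∧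
        𝒮.IsHorizontalLift nabla p X ξ' ∧ chartDeriv p₀ p ξ' = (v.1,
          -𝓜.Ω (extChartAt 𝓘(ℝ, B) p₀.1 p.1) v.1 (fibreCoord ℍ[ℝ] p₀.1 p.1 p.2)) := by
      have hX := fibreCoord_constSection hT v.1
      obtain ⟨ξ', hξ'⟩ := hb.2 (v.1,
        -𝓜.Ω (extChartAt 𝓘(ℝ, B) p₀.1 p.1) v.1 (fibreCoord ℍ[ℝ] p₀.1 p.1 p.2))
      refine ⟨_, ξ', hX, (h𝓜.isHorizontalLift_iff hA hE _ ξ').2 ?_, hξ'⟩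
      rw [hX, hξ']
    obtain ⟨X, ξ', hX, hξ', hξ''⟩ := key (chartDeriv p₀ p ξ)
    obtain ⟨Y, η', hY, hη', hη''⟩ := key (chartDeriv p₀ p η)
    -- Horizontal lifts have zero vertical part, so the fibre component `q` must be the vertical
    -- part of `ξ`.
    let v := 𝓜.vert (extChartAt 𝓘(ℝ, B) p₀.1 p.1, fibreCoord ℍ[ℝ] p₀.1 p.1 p.2)
      (chartDeriv p₀ p ξ)
    have hv : fibreCoord ℍ[ℝ] p₀.1 p.1 (constSection A p₀.1 v p.1) = v :=
      fibreCoord_constSection hA.2 v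
    refine ⟨X, Y, (hS X Y).2 ?_, ξ', η', hξ', hη', constSection A p₀.1 v p.1, ?_, ?_⟩
    · rw [hX, hY]
      exact h1
    · apply fibreCoord_injective hA.2
      rw [map_neg, 𝒮.fibreCoord_mul hA.2, 𝒮.fibreCoord_mul hA.2, hv]
      exact h2
    · refine Prod.ext (hb.1 ?_) (hb.1 ?_)
      · rw [chartDeriv_add, hξ'', chartDeriv_verticalLift hA, hv]
        refine Prod.ext (add_zero _).symm ?_
        simp only [v, LocalFQuaternionicModel.vert, Prod.mk_add_mk]
        abel
      · rw [chartDeriv_add, hη'', chartDeriv_verticalLift hA, 𝒮.fibreCoord_mul hA.2, hv]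
        refine Prod.ext (add_zero _).symm ?_
        simp only [Prod.mk_add_mk]
        rw [neg_add_eq_sub, eq_sub_iff_add_eq]
        exact h3

end AlmostFQuaternionicStructure.IsLocalModel

end Distributions

/-! ### From local to global integrability. -/

section Integrability

variable {B : Type*} [NormedAddCommGroup B] [NormedSpace ℝ B] [FiniteDimensional ℝ B]
  {M : Type*} [TopologicalSpace M] [T2Space M] [ChartedSpace B M] [IsManifold 𝓘(ℝ, B) ∞ M]
  {A : M → Type*} [∀ x, Ring (A x)] [∀ x, Algebra ℝ (A x)] [∀ x, TopologicalSpace (A x)]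
  [TopologicalSpace (TotalSpace ℍ[ℝ] A)] [FiberBundle ℍ[ℝ] A] [VectorBundle ℝ ℍ[ℝ] A]
  [ContMDiffVectorBundle ∞ ℍ[ℝ] A 𝓘(ℝ, B)]
  {F : Type*} [NormedAddCommGroup F] [NormedSpace ℝ F] [FiniteDimensional ℝ F]
  {E : M → Type*} [∀ x, AddCommGroup (E x)] [∀ x, Module ℝ (E x)] [∀ x, TopologicalSpace (E x)]
  [∀ x, IsTopologicalAddGroup (E x)] [∀ x, ContinuousSMul ℝ (E x)]
  [TopologicalSpace (TotalSpace F E)] [FiberBundle F E] [VectorBundle ℝ F E]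
  [ContMDiffVectorBundle ∞ F E 𝓘(ℝ, B)]

namespace AlmostFQuaternionicStructure.IsLocalModel

variable {𝒮 : AlmostFQuaternionicStructure B A F E} {nabla : CovariantDerivative 𝓘(ℝ, B) F E}
  {𝓜 : LocalFQuaternionicModel B F ℍ[ℝ]} {x₀ x : M} (h𝓜 : 𝒮.IsLocalModel nabla x₀ 𝓜)
  (hA : x ∈ chartDomain (B := B) ℍ[ℝ] A x₀) (hE : x ∈ chartDomain (B := B) F E x₀)

include h𝓜

include hA hE in
-- The local space records only the first eigenvector equation; the second one follows from it by
-- `J² = -1`.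
lemma mem_crSpace_iff {J : A x} (hJ : J * J = -1) (X Y : TangentSpace 𝓘(ℝ, B) x) :
    (𝒮.ι x X, 𝒮.ι x Y) ∈ 𝒮.eigenspaceNegI x J ↔
      (fibreCoord B x₀ x X, fibreCoord B x₀ x Y) ∈
        𝓜.crSpace (extChartAt 𝓘(ℝ, B) x₀ x) (fibreCoord ℍ[ℝ] x₀ x J) := by
  simp only [QuaternionicBundleStructure.eigenspaceNegI, LocalFQuaternionicModel.crSpace,
    Set.mem_ofPred_eq]
  rw [h𝓜.ι_apply hE, h𝓜.ι_apply hE, h𝓜.act_apply hA hE, (fibreCoord_injective hE.2).eq_iff]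
  refine ⟨fun h ↦ h.1, fun h ↦ ⟨h, ?_⟩⟩
  rw [← h, ← Module.End.mul_apply, ← map_mul, hJ, map_neg, map_one, LinearMap.neg_apply,
    Module.End.one_apply]

include hA hE in
lemma mem_coCRSpace_iff {J : A x} (hJ : J * J = -1) (X Y : TangentSpace 𝓘(ℝ, B) x) :
    (∃ e f : E x, (e, f) ∈ 𝒮.eigenspaceNegI x J ∧ (X, Y) = (𝒮.ρ x e, 𝒮.ρ x f)) ↔
      (fibreCoord B x₀ x X, fibreCoord B x₀ x Y) ∈
        𝓜.coCRSpace (extChartAt 𝓘(ℝ, B) x₀ x) (fibreCoord ℍ[ℝ] x₀ x J) := by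
  have hT : x ∈ (trivializationAt B (TangentSpace 𝓘(ℝ, B) : M → Type _) x₀).baseSet := hE.1
  constructor
  · rintro ⟨e, f, ⟨h1, -⟩, h⟩
    obtain ⟨rfl, rfl⟩ := Prod.mk.inj h
    refine ⟨fibreCoord F x₀ x e, (h𝓜.ρ_apply hE e).symm, ?_⟩
    rw [h𝓜.act_apply hA hE, h𝓜.ρ_apply hE, h1]
  · rintro ⟨e, h1, h2⟩
    rw [← fibreCoord_constSection hE.2 e] at h1 h2
    rw [h𝓜.act_apply hA hE] at h2
    rw [h𝓜.ρ_apply hE] at h1 h2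
    refine ⟨_, _, ⟨rfl, ?_⟩, Prod.ext (fibreCoord_injective hT h1) (fibreCoord_injective hT h2)⟩
    rw [← Module.End.mul_apply, ← map_mul, hJ, map_neg, map_one, LinearMap.neg_apply,
      Module.End.one_apply]

include hE in
lemma finrank_V : finrank ℝ (𝓜.V (extChartAt 𝓘(ℝ, B) x₀ x)) = finrank ℝ (𝒮.V x) := by
  let e : E x ≃ₗ[ℝ] F := LinearEquiv.ofBijective (fibreCoord F x₀ x)
    ⟨fibreCoord_injective hE.2, fun f ↦ ⟨_, fibreCoord_constSection hE.2 f⟩⟩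
  have hT : x ∈ (trivializationAt B (TangentSpace 𝓘(ℝ, B) : M → Type _) x₀).baseSet := hE.1
  rw [(e.submoduleMap (𝒮.V x)).finrank_eq]
  suffices 𝓜.V (extChartAt 𝓘(ℝ, B) x₀ x) = (𝒮.V x).map (e : E x →ₗ[ℝ] F) by rw [this]
  ext f
  rw [LocalFQuaternionicModel.mem_V, Submodule.mem_map]
  constructor
  · intro h
    rw [← fibreCoord_constSection hE.2 f, h𝓜.ρ_apply hE,
      map_eq_zero_iff _ (fibreCoord_injective hT)] at h
    exact ⟨_, h, fibreCoord_constSection hE.2 f⟩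
  · rintro ⟨v, hv, rfl⟩
    have hv' : 𝒮.ρ x v = 0 := hv
    exact (h𝓜.ρ_apply hE v).trans (by rw [hv', map_zero])

end AlmostFQuaternionicStructure.IsLocalModel

namespace QuaternionicBundleStructure

variable (𝒬 : QuaternionicBundleStructure B A F E) {x₀ x : M}

include 𝒬 in
lemma fibreCoord_mul_self_iff (hx : x ∈ (trivializationAt ℍ[ℝ] A x₀).baseSet) (J : A x) :
    fibreCoord ℍ[ℝ] x₀ x J * fibreCoord ℍ[ℝ] x₀ x J = -1 ↔ J * J = -1 := by
  rw [← 𝒬.fibreCoord_mul hx, ← 𝒬.fibreCoord_one hx, ← map_neg, (fibreCoord_injective hx).eq_iff]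

end QuaternionicBundleStructure

namespace AlmostFQuaternionicStructure

variable {𝒮 : AlmostFQuaternionicStructure B A F E} {nabla : CovariantDerivative 𝓘(ℝ, B) F E}

/-- A twistorial distribution is integrable if it is so in the local models. -/
lemma isIntegrableAlong_of_isLocalModel
    {S : ∀ x, A x → Set (TangentSpace 𝓘(ℝ, B) x × TangentSpace 𝓘(ℝ, B) x)}
    (h : ∀ p₀ : TotalSpace ℍ[ℝ] A, p₀.2 * p₀.2 = -1 →
      ∃ (𝓜 : LocalFQuaternionicModel B F ℍ[ℝ]) (S' : B → ℍ[ℝ] → Set (B × B)),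
      𝒮.IsLocalModel nabla p₀.1 𝓜 ∧
      (∀ p : TotalSpace ℍ[ℝ] A, p.1 ∈ chartDomain (B := B) ℍ[ℝ] A p₀.1 →
        p.1 ∈ chartDomain (B := B) F E p₀.1 → p.2 * p.2 = -1 →
        ∀ X Y : TangentSpace 𝓘(ℝ, B) p.1, (X, Y) ∈ S p.1 p.2 ↔
          (fibreCoord B p₀.1 p.1 X, fibreCoord B p₀.1 p.1 Y) ∈
            S' (extChartAt 𝓘(ℝ, B) p₀.1 p.1) (fibreCoord ℍ[ℝ] p₀.1 p.1 p.2)) ∧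
      ∀ X₁ X₂ Y₁ Y₂ : B × ℍ[ℝ] → B × ℍ[ℝ],
        let q₀ := extChartAt (𝓘(ℝ, B).prod 𝓘(ℝ, ℍ[ℝ])) p₀ p₀
        DifferentiableAt ℝ X₁ q₀ → DifferentiableAt ℝ X₂ q₀ → DifferentiableAt ℝ Y₁ q₀ →
        DifferentiableAt ℝ Y₂ q₀ →
        (∀ᶠ q in 𝓝 q₀, q.2 * q.2 = -1 → (X₁ q, X₂ q) ∈ 𝓜.distribution S' q) →
        (∀ᶠ q in 𝓝 q₀, q.2 * q.2 = -1 → (Y₁ q, Y₂ q) ∈ 𝓜.distribution S' q) →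
        (lieBracket ℝ X₁ Y₁ q₀ - lieBracket ℝ X₂ Y₂ q₀,
          lieBracket ℝ X₁ Y₂ q₀ + lieBracket ℝ X₂ Y₁ q₀) ∈ 𝓜.distribution S' q₀) :
    IsIntegrableAlong (𝓘(ℝ, B).prod 𝓘(ℝ, ℍ[ℝ])) (admissibleBundle A)
      (𝒮.twistorDistribution nabla S) := by
  intro O hO X₁ X₂ Y₁ Y₂ hX₁ hX₂ hY₁ hY₂ hX hY p₀ hp₀
  obtain ⟨𝓜, S', h𝓜, hS, hint⟩ := h p₀ hp₀.2
  have hA₀ : p₀.1 ∈ chartDomain (B := B) ℍ[ℝ] A p₀.1 :=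
    ⟨mem_chart_source B _, mem_baseSet_trivializationAt ℍ[ℝ] A _⟩
  have hE₀ : p₀.1 ∈ chartDomain (B := B) F E p₀.1 :=
    ⟨mem_chart_source B _, mem_baseSet_trivializationAt F E _⟩
  let I := 𝓘(ℝ, B).prod 𝓘(ℝ, ℍ[ℝ])
  let Φ := extChartAt I p₀
  have hsm {X : Π p : TotalSpace ℍ[ℝ] A, TangentSpace I p}
      (hX : ContMDiffOn I I.tangent ∞ (fun p ↦ (⟨p, X p⟩ : TangentBundle I _)) O) :
      ContDiffAt ℝ ∞ (chartVectorField I p₀ X) (Φ p₀) :=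
    contDiffAt_chartVectorField (hX.contMDiffAt (hO.mem_nhds hp₀.1))
  have hev : ∀ᶠ q in 𝓝 (Φ p₀), ∃ p ∈ O, p.1 ∈ chartDomain (B := B) ℍ[ℝ] A p₀.1 ∧
      p.1 ∈ chartDomain (B := B) F E p₀.1 ∧ p ∈ Φ.source ∧ Φ p = q := by
    have hc : ContinuousAt Φ.symm (Φ p₀) := continuousAt_extChartAt_symm p₀
    have hpi : Continuous (TotalSpace.proj : TotalSpace ℍ[ℝ] A → M) :=
      FiberBundle.continuous_proj ℍ[ℝ] A
    have hn : O ∩ TotalSpace.proj ⁻¹' (chartDomain (B := B) ℍ[ℝ] A p₀.1 ∩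
        chartDomain (B := B) F E p₀.1) ∈ 𝓝 (Φ.symm (Φ p₀)) := by
      rw [Φ.left_inv (mem_extChartAt_source p₀)]
      exact (hO.inter (((isOpen_chartDomain _).inter (isOpen_chartDomain _)).preimage
        hpi)).mem_nhds ⟨hp₀.1, hA₀, hE₀⟩
    filter_upwards [hc.preimage_mem_nhds hn,
      (isOpen_extChartAt_target p₀).mem_nhds (mem_extChartAt_target p₀)] with q hq hq'
    exact ⟨Φ.symm q, hq.1, hq.2.1, hq.2.2, Φ.map_target hq', Φ.right_inv hq'⟩
  have hdist {X₁ X₂ : Π p : TotalSpace ℍ[ℝ] A, TangentSpace I p}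
      (hX : ∀ p ∈ O ∩ admissibleBundle A, (X₁ p, X₂ p) ∈ 𝒮.twistorDistribution nabla S p) :
      ∀ᶠ q in 𝓝 (Φ p₀), q.2 * q.2 = -1 → (chartVectorField I p₀ X₁ q,
        chartVectorField I p₀ X₂ q) ∈ 𝓜.distribution S' q := by
    filter_upwards [hev] with q hq hq'
    obtain ⟨p, hpO, hpA, hpE, hps, rfl⟩ := hq
    have hpZ : p.2 * p.2 = -1 := by
      rw [← 𝒮.fibreCoord_mul_self_iff hpA.2]
      simpa only [Φ, I, extChartAt_totalSpace_apply hpA] using hq'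
    rw [chartVectorField_apply hps, chartVectorField_apply hps]
    exact (h𝓜.mem_twistorDistribution_iff hpA hpE (hS p hpA hpE hpZ) _ _).1 (hX p ⟨hpO, hpZ⟩)
  have hbr {X Y : Π p : TotalSpace ℍ[ℝ] A, TangentSpace I p}
      (hX : ContMDiffOn I I.tangent ∞ (fun p ↦ (⟨p, X p⟩ : TangentBundle I _)) O)
      (hY : ContMDiffOn I I.tangent ∞ (fun p ↦ (⟨p, Y p⟩ : TangentBundle I _)) O) :
      chartDeriv p₀ p₀ (mlieBracket I X Y p₀) =
        lieBracket ℝ (chartVectorField I p₀ X) (chartVectorField I p₀ Y) (Φ p₀) := by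
    have key (X : Π p : TotalSpace ℍ[ℝ] A, TangentSpace I p) : ∀ᶠ p in 𝓝 p₀,
        mfderiv I 𝓘(ℝ, B × ℍ[ℝ]) (extChartAt I p₀) p (X p) =
          chartVectorField I p₀ X (extChartAt I p₀ p) := by
      filter_upwards [extChartAt_source_mem_nhds (I := I) p₀] with p hp
      rw [chartVectorField_apply hp]
    exact mfderiv_extChartAt_mlieBracket (mem_chart_source _ p₀) (key X) (key Y)
      ((hsm hX).of_le (by simp)) ((hsm hY).of_le (by simp))
  have hd {X : Π p : TotalSpace ℍ[ℝ] A, TangentSpace I p}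
      (hX : ContMDiffOn I I.tangent ∞ (fun p ↦ (⟨p, X p⟩ : TangentBundle I _)) O) :
      DifferentiableAt ℝ (chartVectorField I p₀ X) (Φ p₀) := (hsm hX).differentiableAt (by simp)
  have := hint _ _ _ _ (hd hX₁) (hd hX₂) (hd hY₁) (hd hY₂) (hdist hX) (hdist hY)
  unfold complexBracket
  rw [h𝓜.mem_twistorDistribution_iff hA₀ hE₀ (hS p₀ hA₀ hE₀ hp₀.2), chartDeriv_sub,
    chartDeriv_add, hbr hX₁ hY₁, hbr hX₂ hY₂, hbr hX₁ hY₂, hbr hX₂ hY₁]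
  exact this

end AlmostFQuaternionicStructure

end Integrability

/-! ### The subbundle `W`. -/

section LargestQuaternionicSubbundle

variable {B : Type*} [NormedAddCommGroup B] [NormedSpace ℝ B] [FiniteDimensional ℝ B]
  {M : Type*} [TopologicalSpace M] [ChartedSpace B M] [IsManifold 𝓘(ℝ, B) ∞ M]
  {A : M → Type*} [∀ x, Ring (A x)] [∀ x, Algebra ℝ (A x)] [∀ x, TopologicalSpace (A x)]
  [TopologicalSpace (TotalSpace ℍ[ℝ] A)] [FiberBundle ℍ[ℝ] A] [VectorBundle ℝ ℍ[ℝ] A]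
  [ContMDiffVectorBundle ∞ ℍ[ℝ] A 𝓘(ℝ, B)]
  {F : Type*} [NormedAddCommGroup F] [NormedSpace ℝ F]
  {E : M → Type*} [∀ x, AddCommGroup (E x)] [∀ x, Module ℝ (E x)] [∀ x, TopologicalSpace (E x)]
  [∀ x, IsTopologicalAddGroup (E x)] [∀ x, ContinuousSMul ℝ (E x)]
  [TopologicalSpace (TotalSpace F E)] [FiberBundle F E] [VectorBundle ℝ F E]
  [ContMDiffVectorBundle ∞ F E 𝓘(ℝ, B)]

namespace AlmostFQuaternionicStructure

variable {𝒮 : AlmostFQuaternionicStructure B A F E} {nabla : CovariantDerivative 𝓘(ℝ, B) F E}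
  {D : CovariantDerivative 𝓘(ℝ, B) B (TangentSpace 𝓘(ℝ, B) : M → Type _)}

/-- The covariant derivatives of the sections of `W` are sections of `W`. -/
lemma covariantDerivative_mem_W (hcompat : 𝒮.IsCompatibleConnection nabla D)
    {U : Set M} (hU : IsOpen U) {Y : Π x : M, TangentSpace 𝓘(ℝ, B) x}
    (hY : ContMDiffOn 𝓘(ℝ, B) 𝓘(ℝ, B).tangent ∞
      (fun x ↦ (⟨x, Y x⟩ : TangentBundle 𝓘(ℝ, B) M)) U)
    (hYW : ∀ x ∈ U, Y x ∈ 𝒮.W x) {x : M} (hx : x ∈ U) (v : TangentSpace 𝓘(ℝ, B) x) :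
    D Y x v ∈ 𝒮.W x := by
  have hb := mem_baseSet_trivializationAt ℍ[ℝ] A x
  have ho := (trivializationAt ℍ[ℝ] A x).open_baseSet
  have him (c : ℍ[ℝ]) (hc : c.re = 0) :
      𝒮.act x (constSection A x c x) (𝒮.ι x (D Y x v)) ∈ LinearMap.range (𝒮.ι x) := by
    obtain ⟨b, -, hbd⟩ := hcompat.quaternionic _ ho (constSection A x c)
      (contMDiffOn_constSection x c) (fun y hy ↦ 𝒮.isImaginary_constSection hy hc) x hb v
    have hιY : ContMDiffOn 𝓘(ℝ, B) (𝓘(ℝ, B).prod 𝓘(ℝ, F)) ∞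
        (fun y ↦ TotalSpace.mk' F y (𝒮.ι y (Y y))) U := fun y hy ↦
      𝒮.ι_smooth.contMDiffAt.comp_contMDiffWithinAt y (hY y hy)
    have hιY' := (hιY.contMDiffAt (hU.mem_nhds hx)).mdifferentiableAt (by simp)
    have hUo := hU.inter ho
    have hUn := hUo.mem_nhds ⟨hx, hb⟩
    have hact := (𝒮.act_smooth _ hUo _ _
      ((contMDiffOn_constSection x c).mono Set.inter_subset_right)
      (hιY.mono Set.inter_subset_left)).contMDiffAt hUn
    have hρ : ContMDiffAt 𝓘(ℝ, B) 𝓘(ℝ, B).tangent ∞ (fun y ↦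
        (⟨y, 𝒮.ρ y (𝒮.act y (constSection A x c y) (𝒮.ι y (Y y)))⟩ : TangentBundle 𝓘(ℝ, B) M)) x :=
      𝒮.ρ_smooth.contMDiffAt.comp x hact
    -- Here `∇(a ιY) = b ιY + a ι(DY)`. Since `Y` is in `W`, near `x` the section `a ιY` is `ι` of
    -- its projection, so its derivative is tangent; and `b ιY` is tangent as well. This leaves `a
    -- ι(DY)` tangent.
    have h1 := hbd _ hιY'
    rw [hcompat.ι_comm x v Y ((hY.contMDiffAt (hU.mem_nhds hx)).mdifferentiableAt (by simp)),
      nabla.isCovariantDerivativeOn.congr_of_eventuallyEq (s := Set.univ)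
        (σ' := fun y ↦ 𝒮.ι y (𝒮.ρ y (𝒮.act y (constSection A x c y) (𝒮.ι y (Y y)))))
        (hact.mdifferentiableAt (by simp))
        ((𝒮.ι_smooth.contMDiffAt.comp x hρ).mdifferentiableAt (by simp)) Filter.univ_mem ?_,
      hcompat.ι_comm x v _ (hρ.mdifferentiableAt (by simp)), ← sub_eq_iff_eq_add'] at h1
    · rw [← h1]
      exact sub_mem (LinearMap.mem_range_self _ _) (hYW x hx b)
    · filter_upwards [hUn] with y hy
      obtain ⟨w, hw⟩ := hYW y hy.1 (constSection A x c y)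
      rw [← hw, 𝒮.ρ_ι]
  intro a
  -- Scalars preserve `TM`, so only the imaginary part of `a` matters.
  have ha : a = (fibreCoord ℍ[ℝ] x x a).re • (1 : A x) +
      constSection A x (fibreCoord ℍ[ℝ] x x a).im x := by
    rw [← 𝒮.constSection_one hb]
    conv_lhs => rw [← constSection_fibreCoord hb a]
    have h2 : ∀ c : ℍ[ℝ], c = c.re • (1 : ℍ[ℝ]) + c.im := fun c ↦ by ext <;> simp
    conv_lhs => rw [h2 (fibreCoord ℍ[ℝ] x x a)]
    rw [constSection_add, constSection_smul]
    rfl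
  rw [ha, map_add, map_smul, map_one, LinearMap.add_apply]
  exact add_mem (Submodule.smul_mem _ _ (LinearMap.mem_range_self _ _))
    (him _ (Quaternion.re_im _))

lemma wIsGeodesic (hcompat : 𝒮.IsCompatibleConnection nabla D) : 𝒮.WIsGeodesic D :=
  fun _ hU _ _ _ hY _ hYW _ hx ↦ covariantDerivative_mem_W hcompat hU hY hYW hx _

lemma wIsIntegrable (hcompat : 𝒮.IsCompatibleConnection nabla D) (htorsion : D.torsion = 0) :
    𝒮.WIsIntegrable := fun U hU X Y hX hY hXW hYW x hx ↦ by
  rw [← D.torsion_eq_zero_iff.1 htorsion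
    ((hX.contMDiffAt (hU.mem_nhds hx)).mdifferentiableAt (by simp))
    ((hY.contMDiffAt (hU.mem_nhds hx)).mdifferentiableAt (by simp))]
  exact sub_mem (covariantDerivative_mem_W hcompat hU hY hYW hx _)
    (covariantDerivative_mem_W hcompat hU hX hXW hx _)

end AlmostFQuaternionicStructure

end LargestQuaternionicSubbundle

/-! ### Proof of the theorem. -/

namespace AlmostFQuaternionicStructure

variable {B : Type*} [NormedAddCommGroup B] [NormedSpace ℝ B] [FiniteDimensional ℝ B]
  {M : Type*} [TopologicalSpace M] [T2Space M] [ChartedSpace B M] [IsManifold 𝓘(ℝ, B) ∞ M]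
  {A : M → Type*} [∀ x, Ring (A x)] [∀ x, Algebra ℝ (A x)] [∀ x, TopologicalSpace (A x)]
  [TopologicalSpace (TotalSpace ℍ[ℝ] A)] [FiberBundle ℍ[ℝ] A] [VectorBundle ℝ ℍ[ℝ] A]
  [ContMDiffVectorBundle ∞ ℍ[ℝ] A 𝓘(ℝ, B)]
  {F : Type*} [NormedAddCommGroup F] [NormedSpace ℝ F] [FiniteDimensional ℝ F]
  {E : M → Type*} [∀ x, AddCommGroup (E x)] [∀ x, Module ℝ (E x)] [∀ x, TopologicalSpace (E x)]
  [∀ x, IsTopologicalAddGroup (E x)] [∀ x, ContinuousSMul ℝ (E x)]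
  [TopologicalSpace (TotalSpace F E)] [FiberBundle F E] [VectorBundle ℝ F E]
  [ContMDiffVectorBundle ∞ F E 𝓘(ℝ, B)]
  {𝒮 : AlmostFQuaternionicStructure B A F E} {nabla : CovariantDerivative 𝓘(ℝ, B) F E}

variable (hex : ∀ x₀, ∃ 𝓜 : LocalFQuaternionicModel B F ℍ[ℝ], 𝒮.IsLocalModel nabla x₀ 𝓜)
include hex

/-- The co-CR twistorial structure is integrable if the curvature conditions hold. -/
lemma isCoCRQuaternionic_of_curvatureCondition
    (hR : ∀ x₀ (𝓜 : LocalFQuaternionicModel B F ℍ[ℝ]), 𝒮.IsLocalModel nabla x₀ 𝓜 →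
      ∀ τ : ℍ[ℝ], τ * τ = -1 →
        𝓜.CurvatureCondition 𝓜.coCRSpace (extChartAt 𝓘(ℝ, B) x₀ x₀) τ) :
    𝒮.IsCoCRQuaternionic nabla := by
  refine isIntegrableAlong_of_isLocalModel fun p₀ hp₀ ↦ ?_
  obtain ⟨𝓜, h𝓜⟩ := hex p₀.1
  have hA : p₀.1 ∈ chartDomain (B := B) ℍ[ℝ] A p₀.1 :=
    ⟨mem_chart_source B _, mem_baseSet_trivializationAt ℍ[ℝ] A _⟩
  have hE : p₀.1 ∈ chartDomain (B := B) F E p₀.1 :=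
    ⟨mem_chart_source B _, mem_baseSet_trivializationAt F E _⟩
  refine ⟨𝓜, 𝓜.coCRSpace, h𝓜, fun p hpA hpE hp ↦ h𝓜.mem_coCRSpace_iff hpA hpE hp, ?_⟩
  intro X₁ X₂ Y₁ Y₂
  have hτ := (𝒮.fibreCoord_mul_self_iff hA.2 p₀.2).2 hp₀
  rw [extChartAt_totalSpace_apply hA]
  intro q₀ hX₁ hX₂ hY₁ hY₂ hX hY
  exact LocalFQuaternionicModel.coCR_integrable Quaternion.isQuaternionic.anticommSqNonpos
    (h𝓜.mem_U hA hE) hτ hX₁ hX₂ hY₁ hY₂ hX hY (hR _ 𝓜 h𝓜 _ hτ)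

/-- The CR twistorial structure is integrable if the curvature conditions hold. -/
lemma isCRQuaternionic_of_curvatureCondition
    (hR : ∀ x₀ (𝓜 : LocalFQuaternionicModel B F ℍ[ℝ]), 𝒮.IsLocalModel nabla x₀ 𝓜 →
      ∀ τ : ℍ[ℝ], τ * τ = -1 →
        𝓜.CurvatureCondition 𝓜.crSpace (extChartAt 𝓘(ℝ, B) x₀ x₀) τ) :
    𝒮.IsCRQuaternionic nabla := by
  refine isIntegrableAlong_of_isLocalModel fun p₀ hp₀ ↦ ?_
  obtain ⟨𝓜, h𝓜⟩ := hex p₀.1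
  have hA : p₀.1 ∈ chartDomain (B := B) ℍ[ℝ] A p₀.1 :=
    ⟨mem_chart_source B _, mem_baseSet_trivializationAt ℍ[ℝ] A _⟩
  have hE : p₀.1 ∈ chartDomain (B := B) F E p₀.1 :=
    ⟨mem_chart_source B _, mem_baseSet_trivializationAt F E _⟩
  refine ⟨𝓜, 𝓜.crSpace, h𝓜, fun p hpA hpE hp ↦ h𝓜.mem_crSpace_iff hpA hpE hp, ?_⟩
  intro X₁ X₂ Y₁ Y₂
  have hτ := (𝒮.fibreCoord_mul_self_iff hA.2 p₀.2).2 hp₀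
  rw [extChartAt_totalSpace_apply hA]
  intro q₀ hX₁ hX₂ hY₁ hY₂ hX hY
  exact LocalFQuaternionicModel.CR_integrable Quaternion.isQuaternionic.anticommSqNonpos
    (h𝓜.mem_U hA hE) hτ hX₁ hX₂ hY₁ hY₂ hX hY (hR _ 𝓜 h𝓜 _ hτ)

end AlmostFQuaternionicStructure

theorem theorem8p6
    {EM : Type*} [NormedAddCommGroup EM] [NormedSpace ℝ EM] [FiniteDimensional ℝ EM]
    {M : Type*} [TopologicalSpace M] [T2Space M] [ChartedSpace EM M] [IsManifold 𝓘(ℝ, EM) ∞ M]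
    {A : M → Type*} [∀ x, Ring (A x)] [∀ x, Algebra ℝ (A x)] [∀ x, TopologicalSpace (A x)]
    [TopologicalSpace (TotalSpace ℍ[ℝ] A)] [FiberBundle ℍ[ℝ] A] [VectorBundle ℝ ℍ[ℝ] A]
    [ContMDiffVectorBundle ∞ ℍ[ℝ] A 𝓘(ℝ, EM)]
    {F : Type*} [NormedAddCommGroup F] [NormedSpace ℝ F] [FiniteDimensional ℝ F]
    {E : M → Type*} [∀ x, AddCommGroup (E x)] [∀ x, Module ℝ (E x)]
    [∀ x, TopologicalSpace (E x)] [∀ x, IsTopologicalAddGroup (E x)]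
    [∀ x, ContinuousSMul ℝ (E x)]
    [TopologicalSpace (TotalSpace F E)] [FiberBundle F E] [VectorBundle ℝ F E]
    [ContMDiffVectorBundle ∞ F E 𝓘(ℝ, EM)]
    (𝒮 : AlmostFQuaternionicStructure EM A F E) (k l : ℕ)
    (hk : Module.finrank ℝ F = 4 * k) (hl : ∀ x : M, Module.finrank ℝ (𝒮.V x) = l)
    (hkl₁ : (k, l) ≠ (2, 2)) (hkl₂ : (k, l) ≠ (1, 0))
    (D : CovariantDerivative 𝓘(ℝ, EM) EM (TangentSpace 𝓘(ℝ, EM) : M → Type _))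
    (hD : CovariantDerivative.ContMDiffCovariantDerivative D ∞)
    (nabla : CovariantDerivative 𝓘(ℝ, EM) F E)
    (hnabla : CovariantDerivative.ContMDiffCovariantDerivative nabla ∞)
    (hcompat : 𝒮.IsCompatibleConnection nabla D)
    (htorsion : D.torsion = 0) :
    𝒮.IsCRQuaternionic nabla ∧
      ((k, l) ≠ (1, 1) → 𝒮.IsFQuaternionic nabla) ∧
      𝒮.WIsIntegrable ∧ 𝒮.WIsGeodesic D := by
  have hex := 𝒮.exists_isLocalModel hD hnabla hcompat htorsion
  have hmem (x : M) (𝓜 : LocalFQuaternionicModel EM F ℍ[ℝ]) (h : 𝒮.IsLocalModel nabla x 𝓜) :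
      extChartAt 𝓘(ℝ, EM) x x ∈ 𝓜.U ∧ finrank ℝ (𝓜.V (extChartAt 𝓘(ℝ, EM) x x)) = l := by
    have hE : x ∈ chartDomain (B := EM) F E x :=
      ⟨mem_chart_source EM _, mem_baseSet_trivializationAt F E _⟩
    exact ⟨h.mem_U ⟨mem_chart_source EM _, mem_baseSet_trivializationAt ℍ[ℝ] A _⟩ hE,
      (h.finrank_V hE).trans (hl x)⟩
  have hR (h₁ : (k, l) ≠ (1, 1)) (x : M) (𝓜 : LocalFQuaternionicModel EM F ℍ[ℝ])
      (h : 𝒮.IsLocalModel nabla x 𝓜) (τ : ℍ[ℝ]) (hτ : τ * τ = -1) :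
      𝓜.CurvatureCondition 𝓜.coCRSpace (extChartAt 𝓘(ℝ, EM) x x) τ :=
    LocalFQuaternionicModel.curvatureCondition_coCR_of_finrank Quaternion.isQuaternionic
      (hmem x 𝓜 h).1 hτ hk (hmem x 𝓜 h).2 hkl₂ h₁ hkl₁
  have hCR : 𝒮.IsCRQuaternionic nabla := by
    refine 𝒮.isCRQuaternionic_of_curvatureCondition hex fun x 𝓜 h τ hτ ↦ ?_
    obtain ⟨hz, hV⟩ := hmem x 𝓜 h
    -- Apart from `(1, 1)`, the condition on the larger co-CR spaces is available and restricts to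
    -- the CR spaces.
    by_cases h₁ : (k, l) = (1, 1)
    · obtain ⟨rfl, rfl⟩ := Prod.mk.inj h₁
      exact LocalFQuaternionicModel.curvatureCondition_CR_one_one hz hτ hk hV
    · intro x hx y hy
      exact hR h₁ _ 𝓜 h τ hτ _ (LocalFQuaternionicModel.crSpace_subset hz hx) _
        (LocalFQuaternionicModel.crSpace_subset hz hy)
  exact ⟨hCR, fun h₁ ↦ ⟨hCR, 𝒮.isCoCRQuaternionic_of_curvatureCondition hex (hR h₁)⟩,
    AlmostFQuaternionicStructure.wIsIntegrable hcompat htorsion,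
    AlmostFQuaternionicStructure.wIsGeodesic hcompat⟩

end
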